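/- Let $k$ be a complete algebraically closed extension of $\mathbb{Q}_p$ with $|p|=p^{-1}$, let $Y$ be a rig-smooth strictly $k$-analytic curve (in the sense of Berkovich), and let $D\subset Y$ be a relatively compact open disk with a single boundary point $\zeta$ in $Y$, equipped with an overconvergent coordinate $T$, i.e. an analytic function on a neighbourhood of $D\cup\{\zeta\}$ which restricts to an isomorphism $T:D\to D(0,1^-)$ onto the open unit disk. Let $r\in(0,1)\cap|k|$, let $C=\{x\in D : r<|T(x)|<1\}$, and let $\mathscr{H}_{D,Y}(r,1)$ be the completion, for the sup-norm on $C$, of the ring of analytic functions on $C$ which extend to a neighbourhood in $Y$ of the closure of $C$. Its elements $g$ have values $g(\zeta)$ in the completed residue field $\mathscr{H}(\zeta)$. Consider a differential system $$\Sigma:\quad \frac{dY}{dT}=G\,Y,$$ where $G$ is an $n\times n$ matrix of meromorphic functions on $D$ whose restrictions to $C$ belong to $\mathscr{H}_{D,Y}(r,1)$. Assume that all singularities of $\Sigma$ in $D$ are apparent: for every $a\in k$ with $|a|<1$ the system has a matrix solution in $GL_n(k((T-a)))$. Let the generic radius of convergence $R_{D\subset Y}(\Sigma)$ be the radius, not exceeding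 $1$, of the largest open disk centered at $t=T(\zeta)$ on which all solutions of $\Sigma$ in $\mathscr{H}(\zeta)[[T-t]]^n$ converge, where $G$ is expanded at $t$ as $\sum_{m\ge 0}\frac{1}{m!}\frac{d^mG}{dT^m}(\zeta)\,(T-t)^m$. Then for every $k$-rational point $x$ of $D=D(0,1^-)$, every solution of $\Sigma$ at $x$ (with entries in $k((T-x))$) is meromorphic on the open disk of $T$-radius $R_{D\subset Y}(\Sigma)$ around $x$. -/

import Mathlib

open Filter Topology

universe u

/-! ### The residue field of a multiplicative seminorm -/

namespace MulRingSeminorm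

variable {A : Type u} [CommRing A] (s : MulRingSeminorm A)

/-- The kernel of a multiplicative seminorm. -/
def ker : Ideal A where
  carrier := {a | s a = 0}
  zero_mem' := map_zero s
  add_mem' := by
    intro a b ha hb
    have h := map_add_le_add s a b
    rw [Set.mem_ofPred_eq] at ha hb
    rw [ha, hb, add_zero] at h
    exact le_antisymm h (apply_nonneg s _)
  smul_mem' := by
    intro c a ha
    rw [Set.mem_ofPred_eq] at ha
    rw [Set.mem_ofPred_eq, smul_eq_mul, map_mul, ha, mul_zero]

theorem mem_ker {a : A} : a ∈ s.ker ↔ s a = 0 := Iff.rfl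

instance ker_isPrime : s.ker.IsPrime where
  ne_top' := by
    intro h
    have h1 : (1 : A) ∈ s.ker := by rw [h]; exact Submodule.mem_top
    rw [mem_ker, map_one] at h1
    exact one_ne_zero h1
  mem_or_mem' := by
    intro a b h
    rw [mem_ker, map_mul] at h
    exact mul_eq_zero.mp h

theorem eq_of_sub_mem_ker {a b : A} (h : a - b ∈ s.ker) : s a = s b := by
  rw [mem_ker] at h
  have h1 := map_add_le_add s (a - b) b
  have h2 := map_add_le_add s (b - a) a
  have h3 : s (b - a) = 0 := by rw [← neg_sub, map_neg_eq_map, h]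
  rw [sub_add_cancel, h, zero_add] at h1
  rw [sub_add_cancel, h3, zero_add] at h2
  exact le_antisymm h1 h2

theorem exists_frac (z : s.ker.ResidueField) : ∃ ab : A × A, s ab.2 ≠ 0 ∧
    z = algebraMap A s.ker.ResidueField ab.1 / algebraMap A s.ker.ResidueField ab.2 := by
  obtain ⟨x, rfl⟩ := IsLocalRing.residue_surjective z
  obtain ⟨a, ⟨b, hb⟩, rfl⟩ := IsLocalization.exists_mk'_eq s.ker.primeCompl x
  have hb' : algebraMap A s.ker.ResidueField b ≠ 0 := fun h =>
    hb (Ideal.algebraMap_residueField_eq_zero.mp h)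
  refine ⟨(a, b), hb, ?_⟩
  rw [eq_div_iff hb', IsScalarTower.algebraMap_apply A (Localization.AtPrime s.ker) _ b,
    IsScalarTower.algebraMap_apply A (Localization.AtPrime s.ker) _ a,
    IsLocalRing.ResidueField.algebraMap_eq, ← map_mul]
  congr 1
  exact IsLocalization.mk'_spec _ a ⟨b, hb⟩

/-- The value `|a| / |b|` of a fraction `a / b` of the residue field. -/
noncomputable def residueValue (z : s.ker.ResidueField) : ℝ :=
  s (Classical.choose (s.exists_frac z)).1 / s (Classical.choose (s.exists_frac z)).2

theorem residueValue_div (a b : A) (hb : s b ≠ 0) :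
    s.residueValue (algebraMap A s.ker.ResidueField a / algebraMap A s.ker.ResidueField b) =
      s a / s b := by
  obtain ⟨hd, he⟩ := Classical.choose_spec (s.exists_frac
    (algebraMap A s.ker.ResidueField a / algebraMap A s.ker.ResidueField b))
  rw [residueValue]
  generalize Classical.choose (s.exists_frac
    (algebraMap A s.ker.ResidueField a / algebraMap A s.ker.ResidueField b)) = cd at hd he ⊢
  have hb' : algebraMap A s.ker.ResidueField b ≠ 0 := fun h =>
    hb (Ideal.algebraMap_residueField_eq_zero.mp h)
  have hd' : algebraMap A s.ker.ResidueField cd.2 ≠ 0 := fun h =>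
    hd (Ideal.algebraMap_residueField_eq_zero.mp h)
  rw [div_eq_div_iff hb' hd', ← map_mul, ← map_mul, ← sub_eq_zero, ← map_sub,
    Ideal.algebraMap_residueField_eq_zero] at he
  have h := s.eq_of_sub_mem_ker he
  rw [map_mul, map_mul] at h
  rw [div_eq_div_iff hd hb, h]

/-- The absolute value induced by a multiplicative seminorm on the residue field of its kernel. -/
noncomputable def residueAbs : AbsoluteValue s.ker.ResidueField ℝ where
  toFun := s.residueValue
  map_mul' := by
    intro z w
    obtain ⟨⟨a, b⟩, hb, rfl⟩ := s.exists_frac z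
    obtain ⟨⟨c, d⟩, hd, rfl⟩ := s.exists_frac w
    dsimp only at hb hd ⊢
    have hbd : s (b * d) ≠ 0 := by rw [map_mul]; exact mul_ne_zero hb hd
    rw [div_mul_div_comm, ← map_mul, ← map_mul, residueValue_div _ _ _ hbd,
      residueValue_div _ _ _ hb, residueValue_div _ _ _ hd, map_mul, map_mul, div_mul_div_comm]
  nonneg' := fun z => div_nonneg (apply_nonneg s _) (apply_nonneg s _)
  eq_zero' := by
    intro z
    obtain ⟨⟨a, b⟩, hb, rfl⟩ := s.exists_frac z
    dsimp only at hb ⊢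
    have hb' : algebraMap A s.ker.ResidueField b ≠ 0 := fun h =>
      hb (Ideal.algebraMap_residueField_eq_zero.mp h)
    rw [residueValue_div _ _ _ hb, div_eq_zero_iff, div_eq_zero_iff,
      Ideal.algebraMap_residueField_eq_zero, mem_ker]
    exact ⟨fun h => Or.inl (h.resolve_right hb), fun h => Or.inl (h.resolve_right hb')⟩
  add_le' := by
    intro z w
    obtain ⟨⟨a, b⟩, hb, rfl⟩ := s.exists_frac z
    obtain ⟨⟨c, d⟩, hd, rfl⟩ := s.exists_frac w
    dsimp only at hb hd ⊢
    have hb' : algebraMap A s.ker.ResidueField b ≠ 0 := fun h =>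
      hb (Ideal.algebraMap_residueField_eq_zero.mp h)
    have hd' : algebraMap A s.ker.ResidueField d ≠ 0 := fun h =>
      hd (Ideal.algebraMap_residueField_eq_zero.mp h)
    have hbd : s (b * d) ≠ 0 := by rw [map_mul]; exact mul_ne_zero hb hd
    rw [div_add_div _ _ hb' hd', ← map_mul, ← map_mul, ← map_mul, ← map_add,
      residueValue_div _ _ _ hbd, residueValue_div _ _ _ hb, residueValue_div _ _ _ hd,
      div_add_div _ _ hb hd, map_mul]
    have h := map_add_le_add s (a * d) (b * c)
    rw [map_mul, map_mul] at h
    have h0 : 0 ≤ s b * s d := mul_nonneg (apply_nonneg s _) (apply_nonneg s _)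
    exact div_le_div_of_nonneg_right h h0

/-- The completed residue field of a multiplicative seminorm: the completion of the residue field
of its kernel. It is a complete normed field. -/
abbrev CompletedResidueField : Type u := s.residueAbs.Completion

/-- The class of the fraction `a / b` in the completed residue field. -/
noncomputable def fracValue (a b : A) : s.CompletedResidueField :=
  ((algebraMap A s.ker.ResidueField a / algebraMap A s.ker.ResidueField b :
    s.ker.ResidueField) : s.residueAbs.Completion)

end MulRingSeminorm

/-! ### Strictly affinoid algebras and their spectra -/

section Affinoid

variable (k : Type u) [NormedField k] [IsUltrametricDist k]

/-- The Tate algebra `k⟨T₁, …, Tₙ⟩` of power series whose coefficients tend to zero. -/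
def TateAlgebra (n : ℕ) : Subalgebra k (MvPowerSeries (Fin n) k) where
  toSubsemiring :=
    (MvPowerSeries.IsRestricted.subring (R := k) (fun _ : Fin n => (1 : ℝ))).toSubsemiring
  algebraMap_mem' := fun c => MvPowerSeries.isRestricted_C _ c

/-- The Gauss norm on the Tate algebra. -/
noncomputable def tateNorm {n : ℕ} (f : TateAlgebra k n) : ℝ :=
  MvPowerSeries.gaussNorm (fun c : k => ‖c‖) (fun _ => (1 : ℝ)) (f : MvPowerSeries (Fin n) k)

/-- A strictly `k`-affinoid algebra is a quotient of a Tate algebra. (Its Banach topology, and the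
boundedness of all algebra homomorphisms, are determined by the algebra structure.) -/
def IsStrictlyAffinoid (A : Type u) [CommRing A] [Algebra k A] : Prop :=
  ∃ (n : ℕ) (π : TateAlgebra k n →ₐ[k] A), Function.Surjective π

/-- The Berkovich spectrum: the multiplicative seminorms on `A` which extend the absolute value
of `k` and are bounded. Boundedness is tested on a presentation of `A` by a Tate algebra; a
multiplicative seminorm bounded by a multiple of the quotient norm is bounded by the quotient
norm itself, and the choice of the presentation does not matter. -/
def BerkovichSpectrum (A : Type u) [CommRing A] [Algebra k A] : Type u :=
  {s : MulRingSeminorm A // (∀ c : k, s (algebraMap k A c) = ‖c‖) ∧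
    ∃ (n : ℕ) (π : TateAlgebra k n →ₐ[k] A), Function.Surjective π ∧
      ∀ f : TateAlgebra k n, s (π f) ≤ tateNorm k f}

/-- The topology of pointwise convergence on the Berkovich spectrum. -/
instance (A : Type u) [CommRing A] [Algebra k A] : TopologicalSpace (BerkovichSpectrum k A) :=
  TopologicalSpace.induced (fun (x : BerkovichSpectrum k A) (f : A) => x.1 f) inferInstance

/-- The algebra of analytic functions on the closed disk of radius `s`: the power series
`∑ aₙ Tⁿ` with `|aₙ| sⁿ → 0`. -/
def ClosedDiskAlgebra (s : ℝ) : Subalgebra k (PowerSeries k) where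
  toSubsemiring := (PowerSeries.IsRestricted.subring (R := k) s).toSubsemiring
  algebraMap_mem' := fun c => PowerSeries.isRestricted_C s c

/-- The coordinate function on the closed disk of radius `s`. -/
noncomputable def ClosedDiskAlgebra.X (s : ℝ) : ClosedDiskAlgebra k s :=
  ⟨PowerSeries.X, by
    change PowerSeries.IsRestricted s PowerSeries.X
    rw [PowerSeries.X_eq]
    exact PowerSeries.isRestricted_monomial s 1 1⟩

end Affinoid

/-! ### Analytic spaces -/

/-- A strictly `k`-analytic space in the sense of Berkovich: a locally Hausdorff space with a dense
net of compact Hausdorff subsets and a strictly `k`-affinoid atlas on this net. -/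
structure StrictAnalyticSpace (k : Type u) [NormedField k] [IsUltrametricDist k] where
  /-- The points. -/
  carrier : Type u
  /-- The topology. -/
  [topology : TopologicalSpace carrier]
  locally_t2 : ∀ x : carrier, ∃ U : Set carrier, IsOpen U ∧ x ∈ U ∧ T2Space U
  /-- The net of affinoid domains of the atlas. -/
  net : Set (Set carrier)
  isCompact_of_net : ∀ V : net, IsCompact V.1
  t2_of_net : ∀ V : net, T2Space V.1
  /-- Every point has a neighbourhood which is a finite union of members of the net through it. -/
  net_cover : ∀ x : carrier, ∃ F : Set (Set carrier), F.Finite ∧ F ⊆ net ∧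
    (∀ V ∈ F, x ∈ V) ∧ ⋃₀ F ∈ 𝓝 x
  /-- The same for the points of the intersection of two members. -/
  net_inter : ∀ V W : net, ∀ x ∈ V.1 ∩ W.1, ∃ F : Set (Set carrier), F.Finite ∧ F ⊆ net ∧
    (∀ Z ∈ F, x ∈ Z ∧ Z ⊆ V.1 ∩ W.1) ∧ ⋃₀ F ∈ 𝓝[V.1 ∩ W.1] x
  /-- In each member, each point has a basis of neighbourhoods which belong to the net. -/
  net_dense : ∀ V : net, ∀ x ∈ V.1, ∀ N ∈ 𝓝[V.1] x, ∃ W ∈ net, W ⊆ V.1 ∧ W ⊆ N ∧ W ∈ 𝓝[V.1] x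
  /-- The affinoid algebras of the atlas. -/
  Alg : net → Type u
  [commRing : ∀ V, CommRing (Alg V)]
  [algebra : ∀ V, Algebra k (Alg V)]
  affinoid : ∀ V, IsStrictlyAffinoid k (Alg V)
  /-- The identification of each member of the net with the spectrum of its algebra. -/
  point : ∀ V : net, V.1 ≃ₜ BerkovichSpectrum k (Alg V)
  /-- The restriction homomorphisms. -/
  res : ∀ {V W : net}, V.1 ⊆ W.1 → Alg W →ₐ[k] Alg V
  res_self : ∀ (V : net) (f : Alg V), res (subset_refl V.1) f = f
  res_res : ∀ {V W Z : net} (h : V.1 ⊆ W.1) (h' : W.1 ⊆ Z.1) (f : Alg Z),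
    res h (res h' f) = res (h.trans h') f
  point_res : ∀ {V W : net} (h : V.1 ⊆ W.1) (x : carrier) (hx : x ∈ V.1) (f : Alg W),
    (point V ⟨x, hx⟩).1 (res h f) = (point W ⟨x, h hx⟩).1 f
  /-- If `V ⊆ W` then `V` is an affinoid domain in `W`: the homomorphisms from `Alg W` to a
  strictly affinoid algebra `B` under which the spectrum of `B` maps into `V` factor uniquely
  through `Alg V`. -/
  affinoid_domain : ∀ {V W : net} (h : V.1 ⊆ W.1) (B : Type u) [CommRing B] [Algebra k B],
    IsStrictlyAffinoid k B → ∀ φ : Alg W →ₐ[k] B,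
    (∀ y : BerkovichSpectrum k B, ∃ (x : carrier) (hx : x ∈ V.1),
      ∀ f : Alg W, y.1 (φ f) = (point W ⟨x, h hx⟩).1 f) →
    ∃! ψ : Alg V →ₐ[k] B, ψ.comp (res h) = φ

attribute [instance] StrictAnalyticSpace.topology StrictAnalyticSpace.commRing
  StrictAnalyticSpace.algebra

namespace StrictAnalyticSpace

variable {k : Type u} [NormedField k] [IsUltrametricDist k] (Y : StrictAnalyticSpace k)

/-- `Y` is a rig-smooth curve (over an algebraically closed field): the local rings of the affinoid
algebras at their maximal ideals are regular of dimension one. -/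
def IsRigSmoothCurve : Prop :=
  ∀ (V : Y.net) (m : Ideal (Y.Alg V)) [m.IsMaximal],
    ∃ _ : IsDomain (Localization.AtPrime m), IsDiscreteValuationRing (Localization.AtPrime m)

/-- A section of the structure sheaf over an open subset `U`: a compatible family of elements of
the affinoid algebras of the members of the net contained in `U`. -/
structure Sections (U : Set Y.carrier) where
  /-- The restriction to a member of the net. -/
  val : ∀ V : Y.net, V.1 ⊆ U → Y.Alg V
  compat : ∀ (V W : Y.net) (h : V.1 ⊆ W.1) (hW : W.1 ⊆ U), Y.res h (val W hW) = val V (h.trans hW)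

variable {Y}

open scoped Classical in
/-- The absolute value `|f(x)|` at a point of `U`; it is computed in any member of the net which
contains `x` and is contained in `U`. -/
noncomputable def Sections.absAt {U : Set Y.carrier} (f : Y.Sections U) (x : Y.carrier) : ℝ :=
  if h : ∃ V : Y.net, x ∈ V.1 ∧ V.1 ⊆ U then
    (Y.point h.choose ⟨x, h.choose_spec.1⟩).1 (f.val h.choose h.choose_spec.2)
  else 0

theorem exists_chart (x : Y.carrier) : ∃ V : Y.net, x ∈ V.1 := by
  obtain ⟨F, -, hF, hx, hn⟩ := Y.net_cover x
  obtain ⟨V, hV, hxV⟩ := mem_of_mem_nhds hn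
  exact ⟨⟨V, hF hV⟩, hxV⟩

/-- An affinoid domain containing a given point. -/
noncomputable def chart (x : Y.carrier) : Y.net := (exists_chart x).choose

theorem mem_chart (x : Y.carrier) : x ∈ (chart x).1 := (exists_chart x).choose_spec

/-- The point `x` as a multiplicative seminorm on the algebra of the chosen affinoid domain. -/
noncomputable def seminormAt (x : Y.carrier) : MulRingSeminorm (Y.Alg (chart x)) :=
  (Y.point (chart x) ⟨x, mem_chart x⟩).1

/-- The completed residue field `ℋ(x)` of the point `x`. It does not depend on the affinoid domain
used to compute it. -/
abbrev ResidueFieldAt (x : Y.carrier) : Type u := (seminormAt x).CompletedResidueField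

/-- `f(x) = v` in `ℋ(x)`, for a section `f` over an open neighbourhood of `x`: arbitrarily good
approximations of `f` at `x` by fractions `a / b` of functions on the chosen affinoid domain
are arbitrarily good approximations of `v`. -/
def Sections.HasValue {U : Set Y.carrier} (f : Y.Sections U) (x : Y.carrier)
    (v : ResidueFieldAt x) : Prop :=
  ∀ ε > 0, ∃ (a b : Y.Alg (chart x)) (V : Y.net) (hx : x ∈ V.1) (hU : V.1 ⊆ U)
    (hV : V.1 ⊆ (chart x).1), seminormAt x b ≠ 0 ∧
    (Y.point V ⟨x, hx⟩).1 (Y.res hV b * f.val V hU - Y.res hV a) ≤ ε * seminormAt x b ∧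
    ‖(seminormAt x).fracValue a b - v‖ ≤ ε

end StrictAnalyticSpace

/-! ### Power series, meromorphic functions and differential systems on disks -/

/-- The power series `f` converges on the open disk of radius `ρ` around the origin. -/
def ConvergesOnDisk {F : Type u} [NormedField F] (ρ : ℝ) (f : PowerSeries F) : Prop :=
  ∀ s : ℝ, 0 ≤ s → s < ρ → PowerSeries.IsRestricted s f

/-- The Laurent series `y` is the expansion at the origin of a meromorphic function, a quotient of
two analytic functions, on the open disk of radius `ρ`. -/
def IsMeromorphicOnDisk {F : Type u} [NormedField F] (ρ : ℝ) (y : LaurentSeries F) : Prop :=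
  ∃ h q : PowerSeries F, q ≠ 0 ∧ ConvergesOnDisk ρ h ∧ ConvergesOnDisk ρ q ∧
    HahnSeries.ofPowerSeries ℤ F q * y = HahnSeries.ofPowerSeries ℤ F h

/-- A meromorphic function `num / den` on the open unit disk `D(0, 1⁻)`. -/
structure UnitDiskMeromorphic (k : Type u) [NormedField k] where
  /-- The numerator. -/
  num : PowerSeries k
  /-- The denominator. -/
  den : PowerSeries k
  num_converges : ConvergesOnDisk 1 num
  den_converges : ConvergesOnDisk 1 den
  den_ne_zero : den ≠ 0

/-- The expansion at `a` of the function given by the power series `f`, as a power series in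
`T - a`. -/
noncomputable def recenter {k : Type u} [NormedField k] (a : k) (f : PowerSeries k) :
    PowerSeries k :=
  PowerSeries.mk fun n => ∑' m : ℕ, ((n + m).choose n : k) * PowerSeries.coeff (n + m) f * a ^ m

namespace UnitDiskMeromorphic

variable {k : Type u} [NormedField k]

/-- The Laurent expansion of `g` at a point `a` of the open unit disk, in powers of `T - a`. -/
noncomputable def laurentAt (g : UnitDiskMeromorphic k) (a : k) : LaurentSeries k :=
  HahnSeries.ofPowerSeries ℤ k (recenter a g.num) / HahnSeries.ofPowerSeries ℤ k (recenter a g.den)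

/-- The numerator `Nₘ` in `(1 / m!) dᵐg / dTᵐ = Nₘ / den ^ (m + 1)`. -/
noncomputable def hasseNum (g : UnitDiskMeromorphic k) : ℕ → PowerSeries k
  | 0 => g.num
  | m + 1 => PowerSeries.C ((m + 1 : k)⁻¹) *
      (PowerSeries.derivative k (g.hasseNum m) * g.den -
        PowerSeries.C (m + 1 : k) * (g.hasseNum m * PowerSeries.derivative k g.den))

end UnitDiskMeromorphic

section System

variable {k : Type u} [NormedField k] {n : ℕ}

/-- The vector `y` of Laurent series in `T - a` is a solution at `a` of the system
`dY / dT = G Y`. -/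
def IsSolutionAt (G : Matrix (Fin n) (Fin n) (UnitDiskMeromorphic k)) (a : k)
    (y : Fin n → LaurentSeries k) : Prop :=
  ∀ i, LaurentSeries.derivative k (y i) = ∑ j, (G i j).laurentAt a * y j

/-- All singularities of `dY / dT = G Y` in the open unit disk are apparent: at each `a` with
`|a| < 1` there is a matrix solution in `GLₙ(k((T - a)))`. -/
def HasOnlyApparentSingularities (G : Matrix (Fin n) (Fin n) (UnitDiskMeromorphic k)) : Prop :=
  ∀ a : k, ‖a‖ < 1 → ∃ Φ : Matrix.GeneralLinearGroup (Fin n) (LaurentSeries k),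
    ∀ j, IsSolutionAt G a fun i => Φ.1 i j

end System

/-! ### Open disks in an analytic space -/

/-- An open disk `D`, relatively compact in `Y`, with an overconvergent coordinate
`T : D ≅ D(0, 1⁻)`: a section of the structure sheaf over an open neighbourhood of the closure
of `D` which maps `D` isomorphically onto the open unit disk. The isomorphism is given on the closed
disks `{x ∈ D | |T(x)| ≤ |c|}`, `0 < |c| < 1`, which are affinoid domains (members of the net; a net
can always be enlarged by affinoid domains) with algebra `k⟨T / |c|⟩`. -/
structure CoordinateDisk {k : Type u} [NormedField k] [IsUltrametricDist k]
    (Y : StrictAnalyticSpace k) where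
  /-- The disk. -/
  carrier : Set Y.carrier
  isOpen_carrier : IsOpen carrier
  isCompact_closure : IsCompact (closure carrier)
  /-- The open set on which the coordinate is defined. -/
  domain : Set Y.carrier
  isOpen_domain : IsOpen domain
  closure_subset : closure carrier ⊆ domain
  /-- The coordinate. -/
  T : Y.Sections domain
  abs_lt_one : ∀ x ∈ carrier, T.absAt x < 1
  closedDisk_mem : ∀ c : k, c ≠ 0 → ‖c‖ < 1 → {x ∈ carrier | T.absAt x ≤ ‖c‖} ∈ Y.net
  /-- The identification of the functions on a closed disk with convergent power series. -/
  equiv : ∀ (c : k) (h0 : c ≠ 0) (h1 : ‖c‖ < 1),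
    ClosedDiskAlgebra k ‖c‖ ≃ₐ[k] Y.Alg ⟨_, closedDisk_mem c h0 h1⟩
  equiv_X : ∀ (c : k) (h0 : c ≠ 0) (h1 : ‖c‖ < 1),
    equiv c h0 h1 (ClosedDiskAlgebra.X k ‖c‖) =
      T.val ⟨_, closedDisk_mem c h0 h1⟩ fun _ hx => closure_subset (subset_closure hx.1)
  res_equiv : ∀ (c d : k) (hc0 : c ≠ 0) (hc1 : ‖c‖ < 1) (hd0 : d ≠ 0) (hd1 : ‖d‖ < 1)
    (h : ‖c‖ ≤ ‖d‖) (f : PowerSeries k) (hc : f ∈ ClosedDiskAlgebra k ‖c‖)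
    (hd : f ∈ ClosedDiskAlgebra k ‖d‖),
    Y.res (V := ⟨_, closedDisk_mem c hc0 hc1⟩) (W := ⟨_, closedDisk_mem d hd0 hd1⟩)
      (fun _ hx => ⟨hx.1, hx.2.trans h⟩) (equiv d hd0 hd1 ⟨f, hd⟩) = equiv c hc0 hc1 ⟨f, hc⟩

namespace CoordinateDisk

variable {k : Type u} [NormedField k] [IsUltrametricDist k] {Y : StrictAnalyticSpace k}
  (D : CoordinateDisk Y)

/-- The open annulus `r < |T| < 1` in `D`. -/
def annulus (r : ℝ) : Set Y.carrier := {x ∈ D.carrier | r < D.T.absAt x}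

/-- The closed disk `|T| ≤ |c|` in `D`, as a member of the net. -/
def closedDisk (c : k) (h0 : c ≠ 0) (h1 : ‖c‖ < 1) : Y.net := ⟨_, D.closedDisk_mem c h0 h1⟩

/-- The section `f` is at distance at most `ε` from the meromorphic function `p / q` of `T`, in the
sup-norm on the annulus `r < |T| < 1`. -/
def DistLE (r : ℝ) {U : Set Y.carrier} (f : Y.Sections U) (p q : PowerSeries k) (ε : ℝ) : Prop :=
  ∀ (c : k) (h0 : c ≠ 0) (h1 : ‖c‖ < 1) (hp : p ∈ ClosedDiskAlgebra k ‖c‖)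
    (hq : q ∈ ClosedDiskAlgebra k ‖c‖) (W : Y.net) (hU : W.1 ⊆ U)
    (hD : W.1 ⊆ (D.closedDisk c h0 h1).1) (x : Y.carrier) (hx : x ∈ W.1), x ∈ D.annulus r →
    (Y.point W ⟨x, hx⟩).1 (Y.res hD (D.equiv c h0 h1 ⟨q, hq⟩) * f.val W hU
      - Y.res hD (D.equiv c h0 h1 ⟨p, hp⟩)) ≤
      ε * (Y.point W ⟨x, hx⟩).1 (Y.res hD (D.equiv c h0 h1 ⟨q, hq⟩))

/-- The meromorphic function `p / q` on `D` restricts to a `Y`-analytic element on the annulus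
`r < |T| < 1`: it is, in the sup-norm on the annulus, a limit of analytic functions which extend to
a neighbourhood in `Y` of the closure of the annulus. -/
def IsAnalyticElement (r : ℝ) (p q : PowerSeries k) : Prop :=
  ∀ ε > 0, ∃ (U : Set Y.carrier) (f : Y.Sections U), IsOpen U ∧ closure (D.annulus r) ⊆ U ∧
    D.DistLE r f p q ε

/-- The `Y`-analytic element `p / q` has the value `v` in `ℋ(ζ)` at the boundary point `ζ`: the
values at `ζ` of approximations of `p / q` by sections of the structure sheaf tend to `v`. -/
def HasBoundaryValue (ζ : Y.carrier) (r : ℝ) (p q : PowerSeries k)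
    (v : StrictAnalyticSpace.ResidueFieldAt ζ) : Prop :=
  ∀ ε > 0, ∃ (U : Set Y.carrier) (f : Y.Sections U) (w : StrictAnalyticSpace.ResidueFieldAt ζ),
    IsOpen U ∧ closure (D.annulus r) ⊆ U ∧ D.DistLE r f p q ε ∧ f.HasValue ζ w ∧ ‖w - v‖ ≤ ε

/-- `γ` is the expansion of `g` at the canonical `ℋ(ζ)`-rational point `ζ'` above `ζ`, in powers
of `X = T - T(ζ)`: its coefficients are the values at `ζ` of `(1 / m!) dᵐg / dTᵐ`. -/
def IsTaylorExpansion (ζ : Y.carrier) (r : ℝ) (g : UnitDiskMeromorphic k)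
    (γ : PowerSeries (StrictAnalyticSpace.ResidueFieldAt ζ)) : Prop :=
  ∀ m : ℕ, D.HasBoundaryValue ζ r (g.hasseNum m) (g.den ^ (m + 1)) (PowerSeries.coeff m γ)

/-- The generic radius of convergence of `dY / dT = G Y`, where the entries of `G` are `Y`-analytic
elements: the radius, not exceeding one, of the largest open disk around `ζ'` on which all
formal solutions in `ℋ(ζ)[[T - T(ζ)]]` converge. The expansion `Γ` of `G` at `ζ'` exists and is
unique, because the analytic elements are stable under `d / dT`. -/
noncomputable def genericRadius (ζ : Y.carrier) (r : ℝ) {n : ℕ}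
    (G : Matrix (Fin n) (Fin n) (UnitDiskMeromorphic k)) : ℝ :=
  sSup {ρ : ℝ | 0 ≤ ρ ∧ ρ ≤ 1 ∧
    ∃ Γ : Matrix (Fin n) (Fin n) (PowerSeries (StrictAnalyticSpace.ResidueFieldAt ζ)),
      (∀ i j, D.IsTaylorExpansion ζ r (G i j) (Γ i j)) ∧
      ∀ y : Fin n → PowerSeries (StrictAnalyticSpace.ResidueFieldAt ζ),
        (∀ i, PowerSeries.derivative (StrictAnalyticSpace.ResidueFieldAt ζ) (y i)
          = ∑ j, Γ i j * y j) →
        ∀ i, ConvergesOnDisk ρ (y i)}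

end CoordinateDisk

/-!
The theorem says that the solutions at the boundary point `ζ` control the solutions at every point
of the disk, provided the singularities are apparent. It is Dwork's transfer principle, which
rests on the maximum principle in the following way.

Write the system as `v' = (A / d) v` with `A` and `d` analytic on the open unit disk. Its iterates
are `v⁽ᵐ⁾ = (Bₘ / dᵐ) v` (`systemNum`). If there were no singularities, then `Bₘ / dᵐ` would be
analytic on the disk, hence bounded at `x` by its values near the boundary. At a point `b` the
matrix `Bₘ / (m! dᵐ)` is the `m`-th Taylor coefficient of the fundamental matrix which is the
identity at `b` (`evalAt_systemNum`); it is a polynomial in the divided derivatives of `G` at `b`.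
These derivatives are analytic elements, so as `b` tends to `ζ` their absolute values do not
exceed, in the limit, those of their values at `ζ`, and the same is true of the polynomial.
Therefore the Taylor coefficients at `x` satisfy the Cauchy estimates which hold at `ζ`. (If the
generic radius is zero, the claim is only that the solution has a pole of finite order.)

Apparent singularities are removed by a gauge factor `q`. Since `G` has a value at `ζ`, it is
bounded near the boundary of the disk, hence has no poles there, and only finitely many in all.
For a suitable product `q` of powers of linear factors, `qΦ` and `qΦ⁻¹` have no poles, where `Φ`
is a fundamental matrix at one of the poles of `G`. Then the matrices `Pₘ / dᵐ` (`gaugeNum`),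
where `(qv)⁽ᵐ⁾ = (Pₘ / (q dᵐ)) v`, equal `(qΦ)⁽ᵐ⁾ (qΦ⁻¹)` and are analytic on the whole disk
(`unitDisk.exists_gauge`). The argument above applies to them (`unitDisk.exists_norm_coeff_le`),
because `‖q‖ ≤ 1`, so that the divided derivatives of `q` are bounded by one.

The ingredients are the theory of analytic functions on the disk: the maximum principle
(`unitDisk.norm_coeff_le`), the finiteness of zeros (`unitDisk.finite_zeros`) and the fact that
local divisibility implies divisibility (`unitDisk.dvd_of_forall_expand_dvd`); and the geometry of
the curve: the points `T = b` of the disk tend to `ζ` as `|b| → 1`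
(`CoordinateDisk.tendsto_rationalPoint`), and the absolute values of sections are continuous
(`StrictAnalyticSpace.Sections.continuousAt_absAt`). Limits of functions of `b` as `b` tends to
`ζ` are expressed by the relation `StrictAnalyticSpace.HasLimitValue`, which is compatible with
the ring operations and holds for the boundary values of analytic elements
(`CoordinateDisk.HasBoundaryValue.hasLimitValue`).
-/

/-! ### Evaluation of convergent power series -/

section Evaluation

variable {k : Type u} [NormedField k]

namespace PowerSeries

/-- The value `f(a) = ∑ fₙ aⁿ` of a power series at a point `a`. It is meaningful if the series
converges on a closed disk `|T| ≤ s` which contains `a`. -/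
noncomputable def evalAt (a : k) (f : PowerSeries k) : k := ∑' n, coeff n f * a ^ n

theorem IsRestricted.tendsto_term {s : ℝ} {f : PowerSeries k} (hf : IsRestricted s f) {a : k}
    (ha : ‖a‖ ≤ s) : Tendsto (fun n => coeff n f * a ^ n) cofinite (𝓝 0) := by
  rw [isRestricted_iff] at hf
  refine squeeze_zero_norm (fun n => ?_) hf
  rw [norm_mul, norm_pow]
  gcongr

theorem IsRestricted.exists_bound {s : ℝ} {f : PowerSeries k} (hf : IsRestricted s f) :
    ∃ M, 0 ≤ M ∧ ∀ n, ‖coeff n f‖ * s ^ n ≤ M := by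
  rw [isRestricted_iff'] at hf
  obtain ⟨M, hM⟩ := hf.bddAbove_range
  refine ⟨max M 0, le_max_right _ _, fun n => le_max_of_le_left (hM ⟨n, rfl⟩)⟩

theorem IsRestricted.exists_bound_tail {s : ℝ} {f : PowerSeries k} (hf : IsRestricted s f)
    {ε : ℝ} (hε : 0 < ε) : ∃ N, ∀ n, N ≤ n → ‖coeff n f‖ * s ^ n ≤ ε := by
  rw [isRestricted_iff'] at hf
  obtain ⟨N, hN⟩ := eventually_atTop.mp (hf.eventually_le_const hε)
  exact ⟨N, hN⟩

theorem isRestricted_of_bound {s t M : ℝ} (hs : 0 ≤ s) (hst : s < t) {f : PowerSeries k}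
    (h : ∀ n, ‖coeff n f‖ * t ^ n ≤ M) : IsRestricted s f := by
  rw [isRestricted_iff']
  have ht : 0 < t := hs.trans_lt hst
  have h1 : Tendsto (fun n : ℕ => M * (s / t) ^ n) atTop (𝓝 0) := by
    rw [← mul_zero M]
    exact (tendsto_pow_atTop_nhds_zero_of_lt_one (by positivity) ((div_lt_one ht).mpr
      hst)).const_mul M
  refine squeeze_zero (fun n => by positivity) (fun n => ?_) h1
  calc ‖coeff n f‖ * s ^ n = (‖coeff n f‖ * t ^ n) * (s / t) ^ n := by
        rw [div_pow]; field_simp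
    _ ≤ M * (s / t) ^ n := by gcongr; exact h n

theorem evalAt_C (a c : k) : evalAt a (C c) = c := by
  rw [evalAt, tsum_eq_single 0]
  · simp
  · intro n hn
    simp [coeff_C, hn]

theorem evalAt_X (a : k) : evalAt a X = a := by
  rw [evalAt, tsum_eq_single 1]
  · simp
  · intro n hn
    simp [coeff_X, hn]

variable [IsUltrametricDist k]

theorem norm_evalAt_le {s : ℝ} {f : PowerSeries k} {a : k} (ha : ‖a‖ ≤ s) {M : ℝ}
    (h : ∀ n, ‖coeff n f‖ * s ^ n ≤ M) : ‖evalAt a f‖ ≤ M := by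
  refine IsUltrametricDist.norm_tsum_le_of_forall_le fun n => ?_
  rw [norm_mul, norm_pow]
  refine le_trans ?_ (h n)
  gcongr

variable [CompleteSpace k]

theorem IsRestricted.summable_term {s : ℝ} {f : PowerSeries k} (hf : IsRestricted s f) {a : k}
    (ha : ‖a‖ ≤ s) : Summable fun n => coeff n f * a ^ n :=
  NonarchimedeanAddGroup.summable_of_tendsto_cofinite_zero (hf.tendsto_term ha)

theorem evalAt_add {s : ℝ} {f g : PowerSeries k} (hf : IsRestricted s f) (hg : IsRestricted s g)
    {a : k} (ha : ‖a‖ ≤ s) : evalAt a (f + g) = evalAt a f + evalAt a g := by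
  rw [evalAt, evalAt, evalAt, ← (hf.summable_term ha).tsum_add (hg.summable_term ha)]
  exact tsum_congr fun n => by rw [map_add, add_mul]

theorem tsum_mul_tsum_eq_tsum_antidiagonal_of_ultrametric {f g : ℕ → k} (hf : Summable f)
    (hg : Summable g) : (∑' n, f n) * ∑' n, g n =
      ∑' n, ∑ ij ∈ Finset.HasAntidiagonal.antidiagonal n, f ij.1 * g ij.2 :=
  Summable.tsum_mul_tsum_eq_tsum_sum_antidiagonal hf hg
    (NonarchimedeanAddGroup.summable_of_tendsto_cofinite_zero
      (tendsto_mul_cofinite_nhds_zero hf.tendsto_cofinite_zero hg.tendsto_cofinite_zero))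

theorem evalAt_mul {s : ℝ} {f g : PowerSeries k} (hf : IsRestricted s f) (hg : IsRestricted s g)
    {a : k} (ha : ‖a‖ ≤ s) : evalAt a (f * g) = evalAt a f * evalAt a g := by
  rw [evalAt, evalAt, evalAt, tsum_mul_tsum_eq_tsum_antidiagonal_of_ultrametric
    (hf.summable_term ha) (hg.summable_term ha)]
  refine tsum_congr fun n => ?_
  rw [coeff_mul, Finset.sum_mul]
  refine Finset.sum_congr rfl fun ij hij => ?_
  rw [← Finset.HasAntidiagonal.mem_antidiagonal.mp hij, pow_add, mul_mul_mul_comm]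

end PowerSeries

end Evaluation

/-! ### Coefficients of a power series and its values on a circle -/

section Averaging

open PowerSeries

variable {k : Type u} [NormedField k] [IsUltrametricDist k]

theorem exists_norm_natCast_eq_one (j : ℕ) : ∃ N : ℕ, j < N ∧ ‖(N : k)‖ = 1 := by
  by_cases h : ‖((j + 1 : ℕ) : k)‖ = 1
  · exact ⟨j + 1, by omega, h⟩
  · refine ⟨j + 2, by omega, ?_⟩
    have h1 : ‖((j + 1 : ℕ) : k)‖ ≠ ‖(1 : k)‖ := by rwa [norm_one]
    have h2 := IsUltrametricDist.norm_add_eq_max_of_norm_ne_norm h1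
    have h3 : ‖((j + 1 : ℕ) : k)‖ ≤ 1 := IsUltrametricDist.norm_natCast_le_one k _
    rw [norm_one, max_eq_right h3] at h2
    rw [← h2]
    push_cast
    ring_nf

variable [CompleteSpace k] [IsAlgClosed k]

/-- The coefficients of a power series are bounded by its values on a circle. The average of
`f(aω) ω⁻ʲ` over the `N`-th roots of unity `ω` is `∑ fₘ aᵐ` over `m ≡ j` modulo `N`, which is
close to `fⱼ aʲ` for large `N`; no denominators arise if `|N| = 1`. -/
theorem norm_coeff_mul_pow_le {f : PowerSeries k} {a : k} (hf : IsRestricted ‖a‖ f) {M : ℝ}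
    (h : ∀ b : k, ‖b‖ = ‖a‖ → ‖evalAt b f‖ ≤ M) (j : ℕ) : ‖coeff j f‖ * ‖a‖ ^ j ≤ M := by
  refine le_of_forall_pos_le_add fun ε hε => ?_
  have hM : 0 ≤ M := (norm_nonneg _).trans (h a rfl)
  obtain ⟨N₀, hN₀⟩ := hf.exists_bound_tail hε
  obtain ⟨N, hN, hN1⟩ := exists_norm_natCast_eq_one (k := k) (max j N₀)
  have hjN : j < N := (le_max_left _ _).trans_lt hN
  have hN₀N : N₀ < N := (le_max_right _ _).trans_lt hN
  have hNk : (N : k) ≠ 0 := by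
    intro h0
    rw [h0, norm_zero] at hN1
    exact zero_ne_one hN1
  have : NeZero (N : k) := ⟨hNk⟩
  obtain ⟨ζ, hζ⟩ := HasEnoughRootsOfUnity.exists_primitiveRoot k N
  have hζ1 : ‖ζ‖ = 1 := by
    have h1 : ‖ζ‖ ^ N = 1 := by rw [← norm_pow, hζ.pow_eq_one, norm_one]
    exact (pow_eq_one_iff_of_nonneg (norm_nonneg _) (by omega)).mp h1
  set c : ℕ → k := fun m => (N : k)⁻¹ * ∑ i ∈ Finset.range N, ζ ^ (i * (m + (N - j))) with hc
  have hcle : ∀ m, ‖c m‖ ≤ 1 := by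
    intro m
    rw [hc]
    simp only
    rw [norm_mul, norm_inv, hN1, inv_one, one_mul]
    refine IsUltrametricDist.norm_sum_le_of_forall_le_of_nonneg zero_le_one fun i _ => ?_
    rw [norm_pow, hζ1, one_pow]
  have hcj : c j = 1 := by
    rw [hc]
    simp only
    rw [Finset.sum_eq_card_nsmul (b := (1 : k)), Finset.card_range, nsmul_eq_mul, mul_one,
      inv_mul_cancel₀ hNk]
    intro i _
    rw [show j + (N - j) = N by omega, mul_comm, pow_mul, hζ.pow_eq_one, one_pow]
  have hc0 : ∀ m, m < N → m ≠ j → c m = 0 := by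
    intro m hm hmj
    rw [hc]
    simp only
    have h1 : ζ ^ (m + (N - j)) ≠ 1 := by
      intro h1
      rw [hζ.pow_eq_one_iff_dvd] at h1
      obtain ⟨t, ht⟩ := h1
      have : t = 1 := by
        have h2 : t < 2 := by
          by_contra h3
          have : N * 2 ≤ N * t := Nat.mul_le_mul_left N (not_lt.mp h3)
          omega
        have h4 : t ≠ 0 := by rintro rfl; omega
        omega
      subst this
      omega
    have h2 : ∑ i ∈ Finset.range N, ζ ^ (i * (m + (N - j))) = 0 := by
      have h3 : ∀ i ∈ Finset.range N, ζ ^ (i * (m + (N - j))) = (ζ ^ (m + (N - j))) ^ i := by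
        intro i _
        rw [← pow_mul, mul_comm]
      rw [Finset.sum_congr rfl h3, geom_sum_eq h1, ← pow_mul, mul_comm, pow_mul, hζ.pow_eq_one,
        one_pow, sub_self, zero_div]
    rw [h2, mul_zero]
  have hnorm : ∀ i : ℕ, ‖a * ζ ^ i‖ = ‖a‖ := by
    intro i
    rw [norm_mul, norm_pow, hζ1, one_pow, mul_one]
  have hsum : HasSum (fun m => (coeff m f * a ^ m) * c m)
      ((N : k)⁻¹ * ∑ i ∈ Finset.range N, evalAt (a * ζ ^ i) f * ζ ^ (i * (N - j))) := by
    have h1 : HasSum (fun m => (N : k)⁻¹ * ∑ i ∈ Finset.range N,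
        coeff m f * (a * ζ ^ i) ^ m * ζ ^ (i * (N - j))) ((N : k)⁻¹ * ∑ i ∈ Finset.range N,
          evalAt (a * ζ ^ i) f * ζ ^ (i * (N - j))) :=
      (hasSum_sum fun i _ => ((hf.summable_term (hnorm i).le).hasSum.mul_right _)).mul_left _
    convert! h1 using 2 with m
    rw [hc]
    simp only
    rw [mul_left_comm, Finset.mul_sum]
    congr 1
    refine Finset.sum_congr rfl fun i _ => ?_
    rw [mul_add, pow_add, mul_pow, ← pow_mul]
    ring
  have hsum2 := hsum.sub (hasSum_ite_eq j (coeff j f * a ^ j))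
  have hle : ‖((N : k)⁻¹ * ∑ i ∈ Finset.range N, evalAt (a * ζ ^ i) f * ζ ^ (i * (N - j)))
      - coeff j f * a ^ j‖ ≤ ε := by
    rw [← hsum2.tsum_eq]
    refine IsUltrametricDist.norm_tsum_le_of_forall_le_of_nonneg hε.le fun m => ?_
    by_cases hmj : m = j
    · subst hmj
      simp [hcj, hε.le]
    · rw [if_neg hmj, sub_zero]
      rcases lt_or_ge m N with hm | hm
      · rw [hc0 m hm hmj, mul_zero, norm_zero]
        exact hε.le
      · rw [norm_mul, norm_mul, norm_pow]
        exact (mul_le_of_le_one_right (by positivity) (hcle m)).trans (hN₀ m (by omega))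
  have hle2 : ‖(N : k)⁻¹ * ∑ i ∈ Finset.range N, evalAt (a * ζ ^ i) f * ζ ^ (i * (N - j))‖ ≤ M := by
    rw [norm_mul, norm_inv, hN1, inv_one, one_mul]
    refine IsUltrametricDist.norm_sum_le_of_forall_le_of_nonneg hM fun i _ => ?_
    rw [norm_mul, norm_pow, hζ1, one_pow, mul_one]
    exact h _ (hnorm i)
  rw [← norm_pow, ← norm_mul]
  calc ‖coeff j f * a ^ j‖ ≤ _ := norm_le_insert _ _
    _ ≤ M + ε := add_le_add hle2 hle

end Averaging

/-! ### Recentering of power series -/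

section Recenter

open PowerSeries

variable {k : Type u} [NormedField k]

theorem recenter_zero (f : PowerSeries k) : recenter 0 f = f := by
  ext n
  rw [recenter, coeff_mk, tsum_eq_single 0]
  · simp
  · intro m hm
    simp [hm]

theorem recenter_C (a c : k) : recenter a (C c) = C c := by
  ext n
  rw [recenter, coeff_mk, coeff_C]
  split_ifs with hn
  · subst hn
    rw [tsum_eq_single 0]
    · simp
    · intro m hm
      simp [coeff_C, hm]
  · refine (tsum_congr fun m => ?_).trans tsum_zero
    simp [coeff_C, hn]

theorem recenter_X (a : k) : recenter a X = X + C a := by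
  ext n
  rw [recenter, coeff_mk]
  match n with
  | 0 =>
    rw [tsum_eq_single 1]
    · simp [coeff_X]
    · intro m hm
      simp [coeff_X, hm]
  | 1 =>
    rw [tsum_eq_single 0]
    · simp [coeff_X]
    · intro m hm
      simp [coeff_X, hm]
  | n + 2 =>
    refine (tsum_congr fun m => ?_).trans (tsum_zero.trans ?_)
    · simp [coeff_X, show n + 2 + m ≠ 1 by omega]
    · simp [coeff_X]

theorem constantCoeff_recenter (a : k) (f : PowerSeries k) :
    constantCoeff (recenter a f) = evalAt a f := by
  rw [← coeff_zero_eq_constantCoeff_apply, recenter, coeff_mk, evalAt]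
  exact tsum_congr fun m => by simp

theorem unitDisk.exists_radius {a b : k} (ha : ‖a‖ < 1) (hb : ‖b‖ < 1) :
    ∃ s : ℝ, 0 < s ∧ s < 1 ∧ ‖a‖ ≤ s ∧ ‖b‖ ≤ s := by
  obtain ⟨s, hs, hs1⟩ := exists_between (max_lt ha hb)
  exact ⟨s, (norm_nonneg a).trans_lt ((le_max_left _ _).trans_lt hs), hs1,
    ((le_max_left _ _).trans_lt hs).le, ((le_max_right _ _).trans_lt hs).le⟩

variable [IsUltrametricDist k]

theorem norm_coeff_recenter_mul_pow_le {s : ℝ} (hs : 0 < s) {a : k} (ha : ‖a‖ ≤ s)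
    {f : PowerSeries k} {n : ℕ} {M : ℝ} (h : ∀ m, n ≤ m → ‖coeff m f‖ * s ^ m ≤ M) :
    ‖coeff n (recenter a f)‖ * s ^ n ≤ M := by
  rw [← le_div_iff₀ (by positivity), recenter, coeff_mk]
  refine IsUltrametricDist.norm_tsum_le_of_forall_le fun m => ?_
  rw [le_div_iff₀ (by positivity), norm_mul, norm_mul, norm_pow]
  calc ‖((n + m).choose n : k)‖ * ‖coeff (n + m) f‖ * ‖a‖ ^ m * s ^ n
      ≤ 1 * ‖coeff (n + m) f‖ * s ^ m * s ^ n := by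
        gcongr
        exact IsUltrametricDist.norm_natCast_le_one k _
    _ = ‖coeff (n + m) f‖ * s ^ (n + m) := by rw [pow_add]; ring
    _ ≤ M := h _ (by omega)

theorem PowerSeries.IsRestricted.recenter {s : ℝ} (hs : 0 < s) {a : k} (ha : ‖a‖ ≤ s)
    {f : PowerSeries k} (hf : IsRestricted s f) : IsRestricted s (recenter a f) := by
  rw [isRestricted_iff', Metric.tendsto_atTop]
  intro ε hε
  obtain ⟨N, hN⟩ := hf.exists_bound_tail (half_pos hε)
  refine ⟨N, fun n hn => ?_⟩
  rw [dist_zero_right, Real.norm_of_nonneg (by positivity)]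
  refine lt_of_le_of_lt ?_ (half_lt_self hε)
  exact norm_coeff_recenter_mul_pow_le hs ha fun m hm => hN m (hn.trans hm)

variable [CompleteSpace k]

/-- Recentering does not change the values. The double series `∑ C(n+m, n) f_{n+m} aᵐ wⁿ`
converges unconditionally, and may be summed along the antidiagonals, where the binomial theorem
applies. -/
theorem evalAt_recenter {s : ℝ} {a w : k} (ha : ‖a‖ ≤ s) (hw : ‖w‖ ≤ s)
    {f : PowerSeries k} (hf : IsRestricted s f) :
    evalAt w (recenter a f) = evalAt (a + w) f := by
  have hs : 0 ≤ s := (norm_nonneg _).trans ha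
  set F : ℕ × ℕ → k := fun x =>
    ((x.1 + x.2).choose x.1 : k) * coeff (x.1 + x.2) f * a ^ x.2 * w ^ x.1 with hF
  have hfin : Tendsto (fun x : ℕ × ℕ => x.1 + x.2) cofinite cofinite := by
    refine Tendsto.cofinite_of_finite_preimage_singleton fun b => ?_
    refine (Finset.finite_toSet (Finset.HasAntidiagonal.antidiagonal b)).subset fun x hx => ?_
    exact Finset.HasAntidiagonal.mem_antidiagonal.mpr hx
  have hsum : Summable F := by
    refine NonarchimedeanAddGroup.summable_of_tendsto_cofinite_zero ?_
    refine squeeze_zero_norm (fun x => ?_) (((isRestricted_iff s f).mp hf).comp hfin)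
    rw [hF]
    simp only [norm_mul, norm_pow, Function.comp_apply]
    calc ‖((x.1 + x.2).choose x.1 : k)‖ * ‖coeff (x.1 + x.2) f‖ * ‖a‖ ^ x.2 * ‖w‖ ^ x.1
        ≤ 1 * ‖coeff (x.1 + x.2) f‖ * s ^ x.2 * s ^ x.1 := by
          gcongr
          exact IsUltrametricDist.norm_natCast_le_one k _
      _ = ‖coeff (x.1 + x.2) f‖ * s ^ (x.1 + x.2) := by rw [pow_add]; ring
  have h1 : evalAt w (recenter a f) = ∑' n, ∑' m, F (n, m) := by
    rw [evalAt]
    refine tsum_congr fun n => ?_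
    rw [recenter, coeff_mk, ← tsum_mul_right]
  have h2 : ∑' n, ∑' m, F (n, m) = ∑' x, F x := hsum.tsum_prod.symm
  have h3 : ∑' x, F x = ∑' n, ∑ x ∈ Finset.HasAntidiagonal.antidiagonal n, F x := by
    rw [← Finset.HasAntidiagonal.sigmaAntidiagonalEquivProd.tsum_eq F]
    have h4 : Summable (F ∘ Finset.HasAntidiagonal.sigmaAntidiagonalEquivProd) :=
      (Equiv.summable_iff _).mpr hsum
    refine (h4.tsum_sigma' fun n => (hasSum_fintype _).summable).trans (tsum_congr fun n => ?_)
    exact (tsum_fintype _).trans (Finset.sum_coe_sort _ F)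
  rw [h1, h2, h3, evalAt]
  refine tsum_congr fun n => ?_
  rw [add_comm a w, Commute.add_pow' (Commute.all w a), Finset.mul_sum]
  refine Finset.sum_congr rfl fun x hx => ?_
  rw [hF, ← Finset.HasAntidiagonal.mem_antidiagonal.mp hx]
  simp only [nsmul_eq_mul]
  ring

end Recenter

section Values

variable {k : Type u} [NormedField k] [IsAlgClosed k]

/-- The absolute value of an algebraically closed field is dense, if it is nontrivial. -/
theorem unitDisk.exists_norm_between [hk : Fact (∃ c : k, c ≠ 0 ∧ ‖c‖ < 1)] {s t : ℝ} (hs : s < t)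
    (ht0 : 0 < t) (ht : t ≤ 1) : ∃ a : k, s < ‖a‖ ∧ ‖a‖ < t := by
  obtain ⟨c, hc0, hc1⟩ := hk.out
  have hs' : max s 0 / t < 1 := (div_lt_one ht0).mpr (max_lt hs ht0)
  have hs0 : 0 ≤ max s 0 / t := by positivity
  obtain ⟨N, hN⟩ := exists_pow_lt_of_lt_one (norm_pos_iff.mpr hc0) hs'
  have hN0 : N ≠ 0 := by
    rintro rfl
    rw [pow_zero] at hN
    exact lt_asymm hN hc1
  -- The powers of an `N`-th root `d` of `c` descend from `1` in steps by a factor close to `1`.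
  obtain ⟨d, hd⟩ := IsAlgClosed.exists_pow_nat_eq c (Nat.pos_of_ne_zero hN0)
  have hdN : ‖d‖ ^ N = ‖c‖ := by rw [← norm_pow, hd]
  have hd1 : ‖d‖ < 1 := by
    by_contra h
    exact (hdN ▸ hc1).not_ge (one_le_pow₀ (not_lt.mp h))
  have hds : max s 0 / t < ‖d‖ := lt_of_pow_lt_pow_left₀ N (norm_nonneg d) (hdN ▸ hN)
  have hex : ∃ j, ‖d‖ ^ j < t := exists_pow_lt_of_lt_one ht0 hd1
  classical
  refine ⟨d ^ Nat.find hex, ?_, by rw [norm_pow]; exact Nat.find_spec hex⟩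
  obtain ⟨j, hj⟩ : ∃ j, Nat.find hex = j + 1 := Nat.exists_eq_succ_of_ne_zero (by
    intro h
    have := Nat.find_spec hex
    rw [h, pow_zero] at this
    exact this.not_ge ht)
  have h1 : t ≤ ‖d‖ ^ j := not_lt.mp (Nat.find_min hex (by omega))
  rw [hj, norm_pow, pow_succ]
  calc s ≤ max s 0 := le_max_left _ _
    _ = t * (max s 0 / t) := by field_simp
    _ < t * ‖d‖ := by gcongr
    _ ≤ ‖d‖ ^ j * ‖d‖ := by gcongr

end Values

/-! ### Derivations of commutative rings -/

section Derivation

/-- Derivations of a commutative ring to itself, without a base ring. -/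
abbrev RingDerivation (S : Type*) [CommRing S] := Derivation ℤ S S

/-- An additive map which satisfies the Leibniz rule is a derivation. -/
def RingDerivation.ofLeibniz {S : Type*} [CommRing S] (D : S →+ S)
    (h : ∀ f g, D (f * g) = f * D g + g * D f) : RingDerivation S :=
  Derivation.mk' D.toIntLinearMap h

/-- The derivation `d / dX` of the ring of power series. -/
noncomputable def PowerSeries.derivation (k : Type u) [CommRing k] :
    RingDerivation (PowerSeries k) :=
  .ofLeibniz (PowerSeries.derivative k).toLinearMap.toAddMonoidHom
    fun f g => (PowerSeries.derivative k).leibniz f g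

end Derivation

/-! ### The ring of analytic functions on the open unit disk -/

section UnitDisk

open PowerSeries

variable (k : Type u) [NormedField k] [IsUltrametricDist k]

/-- The algebra of analytic functions on the open unit disk. -/
def unitDisk : Subalgebra k (PowerSeries k) where
  carrier := {f | ConvergesOnDisk 1 f}
  mul_mem' := fun hf hg s h0 h1 => isRestricted.mul s (hf s h0 h1) (hg s h0 h1)
  add_mem' := fun hf hg s h0 h1 => isRestricted.add s (hf s h0 h1) (hg s h0 h1)
  algebraMap_mem' := fun c s _ _ => isRestricted_C s c

variable {k}

theorem mem_unitDisk_of_pos {f : PowerSeries k}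
    (h : ∀ s : ℝ, 0 < s → s < 1 → IsRestricted s f) : f ∈ unitDisk k := by
  intro s h0 h1
  obtain ⟨t, hst, ht⟩ := exists_between h1
  obtain ⟨M, -, hM⟩ := (h t (h0.trans_lt hst) ht).exists_bound
  exact isRestricted_of_bound h0 hst hM

namespace unitDisk

/-- The coordinate function on the open unit disk. -/
noncomputable def T : unitDisk k :=
  ⟨X, fun s _ _ => by
    rw [X_eq]
    exact isRestricted_monomial s 1 1⟩

@[simp] theorem coe_T : ((T : unitDisk k) : PowerSeries k) = X := rfl

theorem derivative_mem {f : PowerSeries k} (hf : f ∈ unitDisk k) :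
    derivative k f ∈ unitDisk k := by
  refine mem_unitDisk_of_pos fun s h0 h1 => ?_
  have h := (isRestricted_iff' s f).mp (hf s h0.le h1)
  rw [isRestricted_iff']
  have h2 : Tendsto (fun n => ‖coeff (n + 1) f‖ * s ^ (n + 1) * s⁻¹) atTop (𝓝 0) := by
    rw [← zero_mul s⁻¹]
    exact ((tendsto_add_atTop_iff_nat 1).mpr h).mul_const _
  refine squeeze_zero (fun n => by positivity) (fun n => ?_) h2
  rw [coeff_derivative, norm_mul, pow_succ, mul_assoc, mul_assoc, mul_assoc,
    mul_inv_cancel₀ h0.ne', mul_one]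
  have h3 : ‖((n : k) + 1)‖ ≤ 1 := by
    exact_mod_cast IsUltrametricDist.norm_natCast_le_one k (n + 1)
  calc ‖coeff (n + 1) f‖ * (‖((n : k) + 1)‖ * s ^ n)
      ≤ ‖coeff (n + 1) f‖ * (1 * s ^ n) := by gcongr
    _ = _ := by rw [one_mul]

/-- The derivation `d / dT` of the ring of analytic functions on the open unit disk. -/
noncomputable def deriv : RingDerivation (unitDisk k) :=
  .ofLeibniz
    { toFun := fun f => ⟨derivative k f.1, derivative_mem f.2⟩
      map_zero' := Subtype.ext (map_zero _)
      map_add' := fun f g => Subtype.ext (map_add _ f.1 g.1) }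
    fun f g => Subtype.ext ((derivative k).leibniz f.1 g.1)

@[simp] theorem coe_deriv (f : unitDisk k) :
    ((deriv f : unitDisk k) : PowerSeries k) = derivative k f.1 := rfl

theorem recenter_mem {a : k} (ha : ‖a‖ < 1) (f : unitDisk k) : recenter a f.1 ∈ unitDisk k := by
  refine mem_unitDisk_of_pos fun s h0 h1 => ?_
  obtain ⟨t, ht, ht1⟩ := exists_between (max_lt ha h1)
  have hst := (le_max_right _ _).trans_lt ht
  have hat := (le_max_left _ _).trans_lt ht
  obtain ⟨M, -, hM⟩ := (IsRestricted.recenter (h0.trans hst) hat.le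
    (f.2 t (h0.trans hst).le ht1)).exists_bound
  exact isRestricted_of_bound h0.le hst hM

theorem norm_add_lt_one {a w : k} (ha : ‖a‖ < 1) (hw : ‖w‖ < 1) : ‖a + w‖ < 1 :=
  (IsUltrametricDist.norm_add_le_max a w).trans_lt (max_lt ha hw)

variable [CompleteSpace k]

/-- Evaluation of analytic functions at a point of the open unit disk. -/
noncomputable def eval {a : k} (ha : ‖a‖ < 1) : unitDisk k →ₐ[k] k :=
  { toFun := fun f => evalAt a f.1
    map_one' := evalAt_C a 1
    map_mul' := fun f g => evalAt_mul (f.2 _ (norm_nonneg a) ha) (g.2 _ (norm_nonneg a) ha) le_rfl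
    map_zero' := by simp [evalAt]
    map_add' := fun f g => evalAt_add (f.2 _ (norm_nonneg a) ha) (g.2 _ (norm_nonneg a) ha) le_rfl
    commutes' := fun c => evalAt_C a c }

theorem eval_apply {a : k} (ha : ‖a‖ < 1) (f : unitDisk k) : eval ha f = evalAt a f.1 := rfl

@[simp] theorem eval_T {a : k} (ha : ‖a‖ < 1) : eval ha T = a := evalAt_X a

theorem eval_recenter {a w : k} (ha : ‖a‖ < 1) (hw : ‖w‖ < 1) (haw : ‖a + w‖ < 1)
    (f : unitDisk k) : eval hw ⟨recenter a f.1, recenter_mem ha f⟩ = eval haw f := by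
  obtain ⟨s, h0, h1, has, hws⟩ := exists_radius ha hw
  exact evalAt_recenter has hws (f.2 s h0.le h1)

variable [IsAlgClosed k]

/-- The maximum principle: a bound for the values near the boundary of the disk is a bound for the
coefficients. It suffices that there are circles of radius close to one on which it holds. -/
theorem norm_coeff_le {f : unitDisk k} {M : ℝ}
    (h : ∀ s < 1, ∃ a : k, s < ‖a‖ ∧ ‖a‖ < 1 ∧ ∀ (b : k) (hb : ‖b‖ < 1), ‖b‖ = ‖a‖ →
      ‖eval hb f‖ ≤ M) (j : ℕ) : ‖coeff j f.1‖ ≤ M := by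
  have hlim : Tendsto (fun s : ℝ => ‖coeff j f.1‖ * s ^ j) (𝓝[<] 1) (𝓝 (‖coeff j f.1‖ * 1 ^ j)) :=
    ((continuous_const.mul (continuous_id.pow j)).tendsto 1).mono_left nhdsWithin_le_nhds
  rw [one_pow, mul_one] at hlim
  refine le_of_tendsto hlim ?_
  filter_upwards [Ioo_mem_nhdsLT (zero_lt_one' ℝ)] with s hs
  obtain ⟨a, hsa, ha, hM⟩ := h s hs.2
  have h1 := norm_coeff_mul_pow_le (f.2 _ (norm_nonneg a) ha) (M := M)
    (fun b hb => hM b (hb.trans_lt ha) hb) j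
  have hs0 := hs.1.le
  calc ‖coeff j f.1‖ * s ^ j ≤ ‖coeff j f.1‖ * ‖a‖ ^ j := by gcongr
    _ ≤ M := h1

theorem ext_eval [Fact (∃ c : k, c ≠ 0 ∧ ‖c‖ < 1)] {f g : unitDisk k}
    (h : ∀ (b : k) (hb : ‖b‖ < 1), eval hb f = eval hb g) : f = g := by
  rw [← sub_eq_zero]
  refine Subtype.ext (PowerSeries.ext fun j => ?_)
  have h1 : ‖coeff j (f - g).1‖ ≤ 0 := by
    refine norm_coeff_le (fun s hs => ?_) j
    obtain ⟨a, ha, ha1⟩ := exists_norm_between (k := k) hs zero_lt_one le_rfl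
    refine ⟨a, ha, ha1, fun b hb _ => ?_⟩
    rw [map_sub, h b hb, sub_self, norm_zero]
  simpa using h1

/-- The expansion of analytic functions on the open unit disk at one of its points, as a
homomorphism to the ring of formal power series. It is multiplicative since analytic functions
are determined by their values. -/
noncomputable def expand [Fact (∃ c : k, c ≠ 0 ∧ ‖c‖ < 1)] {a : k} (ha : ‖a‖ < 1) :
    unitDisk k →+* PowerSeries k where
  toFun f := recenter a f.1
  map_one' := recenter_C a 1
  map_zero' := by rw [ZeroMemClass.coe_zero, ← map_zero (C (R := k)), recenter_C]
  map_mul' f g := by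
    have h : (⟨recenter a (f * g).1, recenter_mem ha (f * g)⟩ : unitDisk k) =
        ⟨recenter a f.1, recenter_mem ha f⟩ * ⟨recenter a g.1, recenter_mem ha g⟩ := by
      refine ext_eval fun b hb => ?_
      have hab := norm_add_lt_one ha hb
      rw [map_mul, eval_recenter ha hb hab, eval_recenter ha hb hab, eval_recenter ha hb hab,
        map_mul]
    exact congrArg Subtype.val h
  map_add' f g := by
    have h : (⟨recenter a (f + g).1, recenter_mem ha (f + g)⟩ : unitDisk k) =
        ⟨recenter a f.1, recenter_mem ha f⟩ + ⟨recenter a g.1, recenter_mem ha g⟩ := by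
      refine ext_eval fun b hb => ?_
      have hab := norm_add_lt_one ha hb
      rw [map_add, eval_recenter ha hb hab, eval_recenter ha hb hab, eval_recenter ha hb hab,
        map_add]
    exact congrArg Subtype.val h

section expand

variable [Fact (∃ c : k, c ≠ 0 ∧ ‖c‖ < 1)] {a : k} (ha : ‖a‖ < 1)

theorem expand_apply (f : unitDisk k) : expand ha f = recenter a f.1 := rfl

theorem constantCoeff_expand (f : unitDisk k) : constantCoeff (expand ha f) = eval ha f :=
  constantCoeff_recenter a f.1

theorem expand_T_sub_algebraMap (b : k) :
    expand ha (T - algebraMap k (unitDisk k) b) = X + C (a - b) := by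
  rw [map_sub, expand_apply, expand_apply, coe_T, recenter_X]
  have h : ((algebraMap k (unitDisk k) b : unitDisk k) : PowerSeries k) = C b := rfl
  rw [h, recenter_C, map_sub]
  ring

theorem expand_injective : Function.Injective (expand (k := k) ha) := by
  intro f g hfg
  refine ext_eval fun b hb => ?_
  have hba : ‖b - a‖ < 1 := by
    rw [sub_eq_add_neg]
    exact norm_add_lt_one hb (by rwa [norm_neg])
  have hab : ‖a + (b - a)‖ < 1 := by rwa [add_sub_cancel]
  have h1 := eval_recenter ha hba hab f
  have h2 := eval_recenter ha hba hab g
  have h3 : (⟨recenter a f.1, recenter_mem ha f⟩ : unitDisk k) =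
    ⟨recenter a g.1, recenter_mem ha g⟩ := Subtype.ext hfg
  rw [h3, h2] at h1
  simp only [add_sub_cancel] at h1
  exact h1.symm

theorem expand_deriv (f : unitDisk k) :
    expand ha (deriv f) = PowerSeries.derivation k (expand ha f) := by
  change expand ha (deriv f) = derivative k (expand ha f)
  ext n
  rw [expand_apply, expand_apply, coe_deriv, coeff_derivative, recenter, recenter, coeff_mk,
    coeff_mk, ← tsum_mul_right]
  refine tsum_congr fun m => ?_
  rw [coeff_derivative, show n + 1 + m = n + m + 1 by ring]
  have h : ((n + m + 1 : ℕ) : k) * ((n + m).choose n : k) =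
      ((n + m + 1).choose (n + 1) : k) * ((n + 1 : ℕ) : k) := by
    exact_mod_cast congrArg (Nat.cast (R := k)) (Nat.add_one_mul_choose_eq (n + m) n)
  push_cast at h ⊢
  linear_combination coeff (n + m + 1) f.1 * a ^ m * h

end expand

end unitDisk

end UnitDisk

/-! ### Zeros of analytic functions on the open unit disk -/

section Zeros

open PowerSeries

/-- A multiset of `n` elements with product `c` has a member of norm at most `‖c‖ ^ (1 / n)`. -/
theorem Multiset.exists_norm_pow_card_le {k : Type u} [NormedField k] (S : Multiset k)
    (hS : S ≠ 0) : ∃ w ∈ S, ‖w‖ ^ S.card ≤ ‖S.prod‖ := by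
  induction S using Multiset.induction_on with
  | empty => exact absurd rfl hS
  | cons x S ih =>
    rcases eq_or_ne S 0 with rfl | hS'
    · exact ⟨x, by simp, by simp⟩
    · obtain ⟨w, hw, hle⟩ := ih hS'
      rw [Multiset.card_cons, Multiset.prod_cons, norm_mul]
      rcases le_total ‖x‖ ‖w‖ with h | h
      · refine ⟨x, Multiset.mem_cons_self _ _, ?_⟩
        rw [pow_succ']
        gcongr
        exact le_trans (by gcongr) hle
      · refine ⟨w, Multiset.mem_cons_of_mem hw, ?_⟩
        rw [pow_succ']
        gcongr

theorem Polynomial.exists_root_norm_pow_mul_le {k : Type u} [NormedField k] [IsAlgClosed k]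
    (F : Polynomial k) (hF : F.natDegree ≠ 0) :
    ∃ w, F.IsRoot w ∧ ‖w‖ ^ F.natDegree * ‖F.leadingCoeff‖ ≤ ‖F.coeff 0‖ := by
  have hs := IsAlgClosed.splits F
  have hcard : F.roots.card = F.natDegree := hs.natDegree_eq_card_roots.symm
  have hne : F.roots ≠ 0 := by
    intro h
    rw [h, Multiset.card_zero] at hcard
    exact hF hcard.symm
  obtain ⟨w, hw, hle⟩ := Multiset.exists_norm_pow_card_le _ hne
  refine ⟨w, Polynomial.isRoot_of_mem_roots hw, ?_⟩
  rw [hs.coeff_zero_eq_leadingCoeff_mul_prod_roots, norm_mul, norm_mul, norm_pow, norm_neg,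
    norm_one, one_pow, one_mul, mul_comm, ← hcard]
  gcongr

variable {k : Type u} [NormedField k]

/-- `N` is the last index at which `‖fᵢ‖ sⁱ` attains its maximum. This is the number of zeros of
`f` in the closed disk of radius `s`. -/
def IsMaxIndex (s : ℝ) (f : PowerSeries k) (N : ℕ) : Prop :=
  (∀ i, ‖coeff i f‖ * s ^ i ≤ ‖coeff N f‖ * s ^ N) ∧
    ∀ i, N < i → ‖coeff i f‖ * s ^ i < ‖coeff N f‖ * s ^ N

theorem IsMaxIndex.unique {s : ℝ} {f : PowerSeries k} {N N' : ℕ} (h : IsMaxIndex s f N)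
    (h' : IsMaxIndex s f N') : N = N' := by
  rcases lt_trichotomy N N' with hlt | heq | hlt
  · exact absurd (h.2 _ hlt) (h'.1 _).not_gt
  · exact heq
  · exact absurd (h'.2 _ hlt) (h.1 _).not_gt

theorem exists_isMaxIndex {s : ℝ} (hs : 0 < s) {f : PowerSeries k} (hf : IsRestricted s f)
    (hf0 : f ≠ 0) : ∃ N, IsMaxIndex s f N := by
  obtain ⟨j, hj⟩ : ∃ j, coeff j f ≠ 0 := by
    by_contra! h
    exact hf0 (PowerSeries.ext fun n => by rw [h n, map_zero])
  have hpos : 0 < ‖coeff j f‖ * s ^ j := mul_pos (norm_pos_iff.mpr hj) (by positivity)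
  obtain ⟨N₀, hN₀⟩ := hf.exists_bound_tail (half_pos hpos)
  obtain ⟨N, hN, hmax⟩ := Finset.exists_max_image (Finset.range (max N₀ (j + 1)))
    (fun i => toLex (‖coeff i f‖ * s ^ i, i)) ⟨j, by simp⟩
  have hjN : ‖coeff j f‖ * s ^ j ≤ ‖coeff N f‖ * s ^ N := by
    rcases (Prod.Lex.toLex_le_toLex.mp (hmax j (by simp))) with h | h
    · exact h.le
    · exact h.1.le
  have hlt : ∀ i, N₀ ≤ i → ‖coeff i f‖ * s ^ i < ‖coeff N f‖ * s ^ N := fun i hi =>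
    (hN₀ i hi).trans_lt ((half_lt_self hpos).trans_le hjN)
  refine ⟨N, fun i => ?_, fun i hi => ?_⟩
  · rcases le_or_gt N₀ i with h | h
    · exact (hlt i h).le
    · rcases (Prod.Lex.toLex_le_toLex.mp (hmax i (by simp [h]))) with h | h
      · exact h.le
      · exact h.1.le
  · rcases le_or_gt N₀ i with h | h
    · exact hlt i h
    · rcases (Prod.Lex.toLex_le_toLex.mp (hmax i (by simp [h]))) with h | h
      · exact h
      · exact absurd h.2 (not_le.mpr hi)

theorem IsMaxIndex.pos {s : ℝ} (hs : 0 < s) {f : PowerSeries k} {N : ℕ}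
    (h : IsMaxIndex s f N) : 0 < ‖coeff N f‖ * s ^ N :=
  lt_of_le_of_lt (by positivity) (h.2 (N + 1) (by omega))

/-- The terms after the last maximal one stay away from the maximum. -/
theorem IsMaxIndex.exists_gap {s : ℝ} (hs : 0 < s) {f : PowerSeries k} (hf : IsRestricted s f)
    {N : ℕ} (h : IsMaxIndex s f N) : ∃ θ, 0 < θ ∧ θ < ‖coeff N f‖ * s ^ N ∧
      ∀ i, N < i → ‖coeff i f‖ * s ^ i ≤ θ := by
  have hpos := h.pos hs
  obtain ⟨N₀, hN₀⟩ := hf.exists_bound_tail (half_pos hpos)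
  obtain ⟨m, hmem, hm⟩ := Finset.exists_max_image (insert N (Finset.Ioo N N₀))
    (fun i => if i = N then 0 else ‖coeff i f‖ * s ^ i) ⟨N, by simp⟩
  refine ⟨max (‖coeff N f‖ * s ^ N / 2) (if m = N then 0 else ‖coeff m f‖ * s ^ m),
    lt_max_of_lt_left (half_pos hpos), max_lt (half_lt_self hpos) ?_, fun i hi => ?_⟩
  · split_ifs with hmN
    · exact hpos
    · rcases lt_or_ge N m with h1 | h1
      · exact h.2 m h1
      · rw [Finset.mem_insert, Finset.mem_Ioo] at hmem
        omega
  · rcases le_or_gt N₀ i with h1 | h1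
    · exact le_max_of_le_left (hN₀ i h1)
    · have := hm i (by simp [hi, h1])
      rw [if_neg hi.ne'] at this
      exact le_max_of_le_right this

variable [IsUltrametricDist k]

theorem norm_sub_le_max_of_ultrametric (a b : k) : ‖a - b‖ ≤ max ‖a‖ ‖b‖ := by
  rw [sub_eq_add_neg, ← norm_neg b]
  exact IsUltrametricDist.norm_add_le_max a (-b)

namespace unitDisk

theorem coe_T_sub_mul (a : k) (f : unitDisk k) :
    (((T - algebraMap k (unitDisk k) a) * f : unitDisk k) : PowerSeries k) =
      X * f.1 - C a * f.1 := by
  rw [sub_mul]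
  rfl

/-- A linear factor with its zero in the disk raises the number of zeros by one. -/
theorem isMaxIndex_mul {s : ℝ} (hs : 0 < s) {a : k} (ha : ‖a‖ ≤ s) {f : unitDisk k} {N : ℕ}
    (h : IsMaxIndex s f.1 N) :
    IsMaxIndex s ((T - algebraMap k (unitDisk k) a) * f : unitDisk k).1 (N + 1) := by
  rw [coe_T_sub_mul]
  have hpos := h.pos hs
  have hterm : ∀ i, ‖a * coeff i f.1‖ * s ^ i ≤ s * (‖coeff i f.1‖ * s ^ i) := fun i => by
    rw [norm_mul, mul_assoc]
    gcongr
  have hshift : ∀ i, ‖coeff i f.1‖ * s ^ (i + 1) = s * (‖coeff i f.1‖ * s ^ i) := fun i => by ring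
  have hmain : ‖coeff (N + 1) (X * f.1 - C a * f.1)‖ * s ^ (N + 1) =
      s * (‖coeff N f.1‖ * s ^ N) := by
    rw [map_sub, coeff_succ_X_mul, coeff_C_mul, ← hshift]
    congr 1
    have h1 : ‖a * coeff (N + 1) f.1‖ < ‖coeff N f.1‖ := by
      have h2 := (hterm (N + 1)).trans_lt ((mul_lt_mul_iff_right₀ hs).mpr (h.2 (N + 1) (by omega)))
      rw [← hshift] at h2
      exact lt_of_mul_lt_mul_right h2 (by positivity)
    rw [sub_eq_add_neg, IsUltrametricDist.norm_add_eq_max_of_norm_ne_norm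
      (by rw [norm_neg]; exact h1.ne'), norm_neg, max_eq_left h1.le]
  rw [IsMaxIndex, hmain]
  refine ⟨fun i => ?_, fun i hi => ?_⟩
  · match i with
    | 0 =>
      rw [map_sub, coeff_zero_X_mul, coeff_C_mul, zero_sub, norm_neg]
      exact (hterm 0).trans (mul_le_mul_of_nonneg_left (h.1 0) hs.le)
    | i + 1 =>
      rw [map_sub, coeff_succ_X_mul, coeff_C_mul]
      refine (mul_le_mul_of_nonneg_right (norm_sub_le_max_of_ultrametric _ _)
        (by positivity)).trans ?_
      rw [max_mul_of_nonneg _ _ (by positivity), hshift]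
      exact max_le (mul_le_mul_of_nonneg_left (h.1 i) hs.le)
        ((hterm (i + 1)).trans (mul_le_mul_of_nonneg_left (h.1 (i + 1)) hs.le))
  · match i with
    | 0 => omega
    | i + 1 =>
      rw [map_sub, coeff_succ_X_mul, coeff_C_mul]
      refine (mul_le_mul_of_nonneg_right (norm_sub_le_max_of_ultrametric _ _)
        (by positivity)).trans_lt ?_
      rw [max_mul_of_nonneg _ _ (by positivity), hshift]
      refine max_lt ((mul_lt_mul_iff_right₀ hs).mpr (h.2 i (by omega)))
        ((hterm (i + 1)).trans_lt ((mul_lt_mul_iff_right₀ hs).mpr (h.2 (i + 1) (by omega))))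

variable [CompleteSpace k]

theorem exists_eq_T_sub_mul {a : k} (ha : ‖a‖ < 1) {f : unitDisk k} (hf : eval ha f = 0) :
    ∃ g : unitDisk k, f = (T - algebraMap k (unitDisk k) a) * g := by
  have hsum : ∀ n, Summable fun m => coeff (n + m) f.1 * a ^ m := by
    intro n
    obtain ⟨s, hs0, hs1, has, -⟩ := exists_radius ha ha
    refine NonarchimedeanAddGroup.summable_of_tendsto_cofinite_zero ?_
    have h2 : Tendsto (fun m => ‖coeff (n + m) f.1‖ * s ^ (n + m) * (s ^ n)⁻¹) cofinite (𝓝 0) := by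
      rw [← zero_mul (s ^ n)⁻¹]
      exact (((isRestricted_iff s f.1).mp (f.2 s hs0.le hs1)).comp
        (add_right_injective n).tendsto_cofinite).mul_const _
    refine squeeze_zero_norm (fun m => ?_) h2
    rw [norm_mul, norm_pow, pow_add, mul_assoc, mul_comm (s ^ n), mul_assoc,
      mul_inv_cancel₀ (by positivity), mul_one]
    gcongr
  set g : PowerSeries k := PowerSeries.mk fun n => ∑' m, coeff (n + 1 + m) f.1 * a ^ m with hg
  have hgmem : g ∈ unitDisk k := by
    refine mem_unitDisk_of_pos fun s h0 h1 => ?_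
    obtain ⟨t, ht, ht1⟩ := exists_between (max_lt ha h1)
    have hst := (le_max_right _ _).trans_lt ht
    have hat := (le_max_left _ _).trans_lt ht
    have ht0 := h0.trans hst
    obtain ⟨M, hM0, hM⟩ := (f.2 t ht0.le ht1).exists_bound
    refine isRestricted_of_bound (M := M / t) h0.le hst fun n => ?_
    rw [← le_div_iff₀ (by positivity), hg, coeff_mk]
    refine IsUltrametricDist.norm_tsum_le_of_forall_le fun m => ?_
    rw [div_div, le_div_iff₀ (by positivity), norm_mul, norm_pow]
    calc ‖coeff (n + 1 + m) f.1‖ * ‖a‖ ^ m * (t * t ^ n)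
        ≤ ‖coeff (n + 1 + m) f.1‖ * t ^ m * (t * t ^ n) := by gcongr
      _ = ‖coeff (n + 1 + m) f.1‖ * t ^ (n + 1 + m) := by ring
      _ ≤ M := hM _
  have hrec : ∀ n, ∑' m, coeff (n + m) f.1 * a ^ m = coeff n f.1 + a * coeff n g := by
    intro n
    rw [(hsum n).tsum_eq_zero_add, hg, coeff_mk, ← tsum_mul_left]
    congr 1
    · simp
    · exact tsum_congr fun m => by rw [show n + (m + 1) = n + 1 + m by ring]; ring
  refine ⟨⟨g, hgmem⟩, Subtype.ext ?_⟩
  rw [coe_T_sub_mul]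
  ext n
  match n with
  | 0 =>
    have h1 := hrec 0
    simp only [zero_add] at h1
    rw [eval_apply, evalAt, h1] at hf
    rw [map_sub, coeff_zero_X_mul, coeff_C_mul, zero_sub]
    linear_combination hf
  | n + 1 =>
    have h1 := hrec (n + 1)
    rw [map_sub, coeff_succ_X_mul, coeff_C_mul]
    have h2 : coeff n g = coeff (n + 1) f.1 + a * coeff (n + 1) g := by
      rw [← h1, hg, coeff_mk]
    linear_combination -h2

/-- Analytic functions are Lipschitz continuous on smaller disks. -/
theorem exists_norm_eval_sub_le {a : k} (ha : ‖a‖ < 1) (f : unitDisk k) {s : ℝ} (hs0 : 0 ≤ s)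
    (hs1 : s < 1) : ∃ K, 0 ≤ K ∧ ∀ (b : k) (hb : ‖b‖ < 1), ‖b‖ ≤ s →
      ‖eval hb f - eval ha f‖ ≤ K * ‖b - a‖ := by
  obtain ⟨g, hg⟩ := exists_eq_T_sub_mul ha
    (f := f - algebraMap k (unitDisk k) (eval ha f)) (by simp)
  obtain ⟨K, hK0, hK⟩ := (g.2 s hs0 hs1).exists_bound
  refine ⟨K, hK0, fun b hb hbs => ?_⟩
  have h1 := congrArg (eval hb) hg
  rw [map_sub, map_mul, map_sub, AlgHom.commutes, AlgHom.commutes, eval_T] at h1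
  rw [Algebra.algebraMap_self_apply, Algebra.algebraMap_self_apply] at h1
  rw [h1, norm_mul, mul_comm]
  gcongr
  exact norm_evalAt_le hbs hK

/-- Each zero splits off a linear factor, and the number of zeros drops by one. -/
theorem finite_zeros {s : ℝ} (hs : 0 < s) (hs1 : s < 1) {f : unitDisk k} (hf : f ≠ 0) :
    {a : k | ‖a‖ ≤ s ∧ evalAt a f.1 = 0}.Finite := by
  obtain ⟨N, hN⟩ := exists_isMaxIndex hs (f.2 s hs.le hs1) fun h => hf (Subtype.ext h)
  induction N generalizing f with
  | zero =>
    refine Set.finite_empty.subset fun a ha => ?_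
    obtain ⟨g, hg⟩ := exists_eq_T_sub_mul (ha.1.trans_lt hs1) ha.2
    have hg0 : g ≠ 0 := by rintro rfl; exact hf (by rw [hg, mul_zero])
    obtain ⟨N', hN'⟩ := exists_isMaxIndex hs (g.2 s hs.le hs1) fun h => hg0 (Subtype.ext h)
    have := hN.unique (hg ▸ isMaxIndex_mul hs ha.1 hN')
    omega
  | succ N ih =>
    by_cases hex : ∃ a : k, ‖a‖ ≤ s ∧ evalAt a f.1 = 0
    · obtain ⟨a, ha, hfa⟩ := hex
      obtain ⟨g, hg⟩ := exists_eq_T_sub_mul (ha.trans_lt hs1) hfa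
      have hg0 : g ≠ 0 := by rintro rfl; exact hf (by rw [hg, mul_zero])
      obtain ⟨N', hN'⟩ := exists_isMaxIndex hs (g.2 s hs.le hs1) fun h => hg0 (Subtype.ext h)
      have hNN' := hN.unique (hg ▸ isMaxIndex_mul hs ha hN')
      obtain rfl : N = N' := by omega
      refine ((ih hg0 hN').insert a).subset fun b ⟨hbs, hb⟩ => ?_
      have h1 := congrArg (eval (hbs.trans_lt hs1)) hg
      rw [map_mul, map_sub, eval_T, AlgHom.commutes, eval_apply, hb] at h1
      rcases mul_eq_zero.mp h1.symm with h2 | h2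
      · exact Or.inl (sub_eq_zero.mp h2)
      · exact Or.inr ⟨hbs, h2⟩
    · refine Set.finite_empty.subset fun a ha => hex ⟨a, ha⟩

end unitDisk

end Zeros

/-! ### Existence of zeros and division of analytic functions -/

section Division

open PowerSeries

namespace unitDisk

variable {k : Type u} [NormedField k] [IsUltrametricDist k] [CompleteSpace k]

/-- The last maximal coefficient keeps its size under recentering, so recentering does not change
the number of zeros. -/
theorem IsMaxIndex.norm_coeff_recenter {s : ℝ} (hs : 0 < s) {a : k} (ha : ‖a‖ ≤ s)
    {f : PowerSeries k} (hf : IsRestricted s f) {N : ℕ} (h : IsMaxIndex s f N) :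
    ‖coeff N (recenter a f)‖ = ‖coeff N f‖ := by
  obtain ⟨θ, hθ0, hθ, hgap⟩ := h.exists_gap hs hf
  have hsum : Summable fun m : ℕ => ((N + m).choose N : k) * coeff (N + m) f * a ^ m := by
    refine NonarchimedeanAddGroup.summable_of_tendsto_cofinite_zero ?_
    have h2 : Tendsto (fun m => ‖coeff (N + m) f‖ * s ^ (N + m) * (s ^ N)⁻¹) cofinite (𝓝 0) := by
      rw [← zero_mul (s ^ N)⁻¹]
      exact (((isRestricted_iff s f).mp hf).comp
        (add_right_injective N).tendsto_cofinite).mul_const _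
    refine squeeze_zero_norm (fun m => ?_) h2
    rw [norm_mul, norm_mul, norm_pow, pow_add, mul_assoc ‖coeff (N + m) f‖, mul_comm (s ^ N),
      mul_assoc (s ^ m), mul_inv_cancel₀ (by positivity), mul_one]
    calc ‖((N + m).choose N : k)‖ * ‖coeff (N + m) f‖ * ‖a‖ ^ m
        ≤ 1 * ‖coeff (N + m) f‖ * s ^ m := by
          gcongr
          exact IsUltrametricDist.norm_natCast_le_one k _
      _ = _ := by rw [one_mul]
  have hdiff : ‖coeff N (recenter a f) + -coeff N f‖ * s ^ N ≤ θ := by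
    rw [recenter, coeff_mk, hsum.tsum_eq_zero_add]
    simp only [add_zero, Nat.choose_self, Nat.cast_one, one_mul, pow_zero, mul_one]
    rw [add_neg_cancel_comm, ← le_div_iff₀ (by positivity)]
    refine IsUltrametricDist.norm_tsum_le_of_forall_le fun m => ?_
    rw [le_div_iff₀ (by positivity), norm_mul, norm_mul, norm_pow]
    calc ‖((N + (m + 1)).choose N : k)‖ * ‖coeff (N + (m + 1)) f‖ * ‖a‖ ^ (m + 1) * s ^ N
        ≤ 1 * ‖coeff (N + (m + 1)) f‖ * s ^ (m + 1) * s ^ N := by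
          gcongr
          exact IsUltrametricDist.norm_natCast_le_one k _
      _ = ‖coeff (N + (m + 1)) f‖ * s ^ (N + (m + 1)) := by rw [pow_add]; ring
      _ ≤ θ := hgap _ (by omega)
  have hlt : ‖coeff N (recenter a f) + -coeff N f‖ < ‖coeff N f‖ :=
    lt_of_mul_lt_mul_right (hdiff.trans_lt hθ) (by positivity)
  have := IsUltrametricDist.norm_eq_of_add_norm_lt_max
    (hlt.trans_le ((norm_neg (coeff N f)).symm.le.trans (le_max_right _ _)))
  rwa [norm_neg] at this

variable [IsAlgClosed k]

/-- One step of the approximation of a zero: move from `a` to the smallest zero of the expansion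
of `f` at `a`, truncated after the last maximal term. -/
theorem IsMaxIndex.exists_step {s : ℝ} (hs : 0 < s) {f : PowerSeries k} (hf : IsRestricted s f)
    {N : ℕ} (h : IsMaxIndex s f N) (hN : N ≠ 0) {θ : ℝ}
    (hgap : ∀ i, N < i → ‖coeff i f‖ * s ^ i ≤ θ) {a : k} (ha : ‖a‖ ≤ s) :
    ∃ a' : k, ‖a'‖ ≤ s ∧ ‖evalAt a' f‖ ≤ θ * (‖evalAt a f‖ / (‖coeff N f‖ * s ^ N)) ∧
      ‖a' - a‖ ^ N ≤ s ^ N * (‖evalAt a f‖ / (‖coeff N f‖ * s ^ N)) := by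
  have hpos := h.pos hs
  have hcN : 0 < ‖coeff N f‖ := pos_of_mul_pos_left hpos (by positivity)
  set b := recenter a f with hb
  have hbN : ‖coeff N b‖ = ‖coeff N f‖ := IsMaxIndex.norm_coeff_recenter hs ha hf h
  have hb0 : constantCoeff b = evalAt a f := constantCoeff_recenter a f
  have hbr : IsRestricted s b := IsRestricted.recenter hs ha hf
  set F : Polynomial k := trunc (N + 1) b with hF
  have hFN : F.coeff N = coeff N b := by rw [hF, coeff_trunc, if_pos (by omega)]
  have hF0 : F.coeff 0 = evalAt a f := by
    rw [hF, coeff_trunc, if_pos (by omega), coeff_zero_eq_constantCoeff_apply, hb0]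
  have hdeg : F.natDegree = N := by
    refine le_antisymm (Nat.lt_succ_iff.mp (natDegree_trunc_lt b N)) ?_
    refine Polynomial.le_natDegree_of_ne_zero ?_
    rw [hFN, ← norm_pos_iff, hbN]
    exact hcN
  obtain ⟨w, hw, hwle⟩ := Polynomial.exists_root_norm_pow_mul_le F (by rwa [hdeg])
  rw [Polynomial.leadingCoeff, hdeg, hFN, hbN, hF0] at hwle
  have hwN : ‖w‖ ^ N ≤ s ^ N * (‖evalAt a f‖ / (‖coeff N f‖ * s ^ N)) := by
    rw [mul_div_assoc', le_div_iff₀ hpos]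
    calc ‖w‖ ^ N * (‖coeff N f‖ * s ^ N) = s ^ N * (‖w‖ ^ N * ‖coeff N f‖) := by ring
      _ ≤ _ := by gcongr
  have hws : ‖w‖ ≤ s := by
    refine le_of_pow_le_pow_left₀ hN hs.le (hwN.trans ?_)
    refine mul_le_of_le_one_right (by positivity) ((div_le_one hpos).mpr ?_)
    exact norm_evalAt_le ha h.1
  refine ⟨a + w, (IsUltrametricDist.norm_add_le_max a w).trans (max_le ha hws), ?_,
    by rwa [add_sub_cancel_left]⟩
  have hθ0 : 0 ≤ θ := le_trans (by positivity) (hgap (N + 1) (by omega))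
  rw [← evalAt_recenter ha hws hf, evalAt, ← (hbr.summable_term hws).sum_add_tsum_nat_add (N + 1)]
  have h1 : ∑ i ∈ Finset.range (N + 1), coeff i b * w ^ i = 0 := by
    rw [← hw.eq_zero, Polynomial.eval, eval₂_trunc_eq_sum_range]
    rfl
  rw [h1, zero_add]
  refine IsUltrametricDist.norm_tsum_le_of_forall_le fun i => ?_
  have h2 : ‖coeff (i + (N + 1)) b‖ * s ^ (i + (N + 1)) ≤ θ :=
    norm_coeff_recenter_mul_pow_le hs ha fun m hm => hgap m (by omega)
  have h3 : (‖w‖ / s) ^ (i + (N + 1)) ≤ (‖w‖ / s) ^ N :=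
    pow_le_pow_of_le_one (by positivity) ((div_le_one hs).mpr hws) (by omega)
  calc ‖coeff (i + (N + 1)) b * w ^ (i + (N + 1))‖
      = (‖coeff (i + (N + 1)) b‖ * s ^ (i + (N + 1))) * (‖w‖ / s) ^ (i + (N + 1)) := by
        rw [norm_mul, norm_pow, div_pow]
        field_simp
    _ ≤ θ * (‖w‖ / s) ^ N := by gcongr
    _ ≤ _ := by
        gcongr
        rw [div_pow, div_le_iff₀ (by positivity), mul_comm]
        exact hwN

/-- A function whose last maximal term on the disk of radius `s` is not the constant term has a
zero in this disk. -/
theorem exists_zero {s : ℝ} (hs : 0 < s) (hs1 : s < 1) {f : unitDisk k} {N : ℕ}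
    (h : IsMaxIndex s f.1 N) (hN : N ≠ 0) : ∃ a : k, ‖a‖ ≤ s ∧ evalAt a f.1 = 0 := by
  have hf := f.2 s hs.le hs1
  obtain ⟨θ, hθ0, hθ, hgap⟩ := h.exists_gap hs hf
  set M := ‖coeff N f.1‖ * s ^ N with hM
  have hpos : 0 < M := h.pos hs
  choose! φ hφ1 hφ2 hφ3 using
    fun (a : k) (ha : ‖a‖ ≤ s) => IsMaxIndex.exists_step hs hf h hN hgap ha
  set z : ℕ → k := fun n => φ^[n] 0 with hz
  have hzs : ∀ n, ‖z n‖ ≤ s := by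
    intro n
    induction n with
    | zero => simpa [hz] using hs.le
    | succ n ih =>
      rw [hz]
      simp only [Function.iterate_succ_apply']
      exact hφ1 _ ih
  have hsucc : ∀ n, z (n + 1) = φ (z n) := fun n => Function.iterate_succ_apply' φ n 0
  have hκ0 : 0 ≤ θ / M := by positivity
  have hκ1 : θ / M < 1 := (div_lt_one hpos).mpr hθ
  have hval : ∀ n, ‖evalAt (z n) f.1‖ ≤ M * (θ / M) ^ n := by
    intro n
    induction n with
    | zero =>
      rw [pow_zero, mul_one]
      exact norm_evalAt_le (hzs 0) h.1
    | succ n ih =>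
      rw [hsucc]
      refine (hφ2 _ (hzs n)).trans ?_
      calc θ * (‖evalAt (z n) f.1‖ / M) ≤ θ * (M * (θ / M) ^ n / M) := by gcongr
        _ = M * (θ / M) ^ (n + 1) := by rw [pow_succ]; field_simp
  have hpow : Tendsto (fun n => (θ / M) ^ n) atTop (𝓝 0) :=
    tendsto_pow_atTop_nhds_zero_of_lt_one hκ0 hκ1
  have hstep : Tendsto (fun n => z (n + 1) - z n) atTop (𝓝 0) := by
    rw [Metric.tendsto_atTop]
    intro ε hε
    have h1 : Tendsto (fun n => s ^ N * (θ / M) ^ n) atTop (𝓝 0) := by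
      rw [← mul_zero (s ^ N)]
      exact hpow.const_mul _
    obtain ⟨n₀, hn₀⟩ := eventually_atTop.mp (h1.eventually_lt_const (pow_pos hε N))
    refine ⟨n₀, fun n hn => ?_⟩
    rw [dist_zero_right]
    refine lt_of_pow_lt_pow_left₀ N hε.le (lt_of_le_of_lt ?_ (hn₀ n hn))
    rw [hsucc]
    refine (hφ3 _ (hzs n)).trans ?_
    gcongr
    rw [div_le_iff₀ hpos, mul_comm]
    exact hval n
  obtain ⟨a, ha⟩ := cauchySeq_tendsto_of_complete
    (NonarchimedeanAddGroup.cauchySeq_of_tendsto_sub_nhds_zero hstep)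
  have has : ‖a‖ ≤ s := le_of_tendsto ha.norm (Eventually.of_forall hzs)
  refine ⟨a, has, ?_⟩
  obtain ⟨K, -, hK⟩ := exists_norm_eval_sub_le (has.trans_lt hs1) f hs.le hs1
  have hlim1 : Tendsto (fun n => evalAt (z n) f.1) atTop (𝓝 (evalAt a f.1)) := by
    rw [tendsto_iff_norm_sub_tendsto_zero]
    refine squeeze_zero (fun n => norm_nonneg _)
      (fun n => hK (z n) ((hzs n).trans_lt hs1) (hzs n)) ?_
    rw [← mul_zero K]
    exact (tendsto_iff_norm_sub_tendsto_zero.mp ha).const_mul K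
  have hlim2 : Tendsto (fun n => evalAt (z n) f.1) atTop (𝓝 0) := by
    refine squeeze_zero_norm hval ?_
    rw [← mul_zero M]
    exact hpow.const_mul M
  exact tendsto_nhds_unique hlim1 hlim2

variable [Fact (∃ c : k, c ≠ 0 ∧ ‖c‖ < 1)]

theorem expand_T_sub_ne_zero {a : k} (ha : ‖a‖ < 1) (b : k) :
    expand ha (T - algebraMap k (unitDisk k) b) ≠ 0 := by
  rw [expand_T_sub_algebraMap]
  intro h
  have := congrArg (coeff 1) h
  rw [map_add, coeff_one_X, coeff_C, if_neg one_ne_zero, add_zero, map_zero] at this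
  exact one_ne_zero this

theorem dvd_of_expand_mul_dvd {a b : k} (ha : ‖a‖ < 1) {f g : unitDisk k}
    (h : expand ha ((T - algebraMap k (unitDisk k) b) * f) ∣
      expand ha ((T - algebraMap k (unitDisk k) b) * g)) : expand ha f ∣ expand ha g := by
  rw [map_mul, map_mul] at h
  exact (mul_dvd_mul_iff_left (expand_T_sub_ne_zero ha b)).mp h

/-- Divide `f` and `g` by a common zero as long as `g` has one; in the end the constant term of `g`
dominates, and the coefficients of the quotient are bounded recursively. -/
theorem exists_bound_of_dvd {s : ℝ} (hs : 0 < s) (hs1 : s < 1) {f g : unitDisk k} (hg : g ≠ 0)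
    {h : PowerSeries k} (hfg : f.1 = g.1 * h)
    (hdvd : ∀ (a : k) (ha : ‖a‖ < 1), expand ha g ∣ expand ha f) :
    ∃ M, ∀ n, ‖coeff n h‖ * s ^ n ≤ M := by
  obtain ⟨N, hN⟩ := exists_isMaxIndex hs (g.2 s hs.le hs1) fun h => hg (Subtype.ext h)
  induction N generalizing f g with
  | zero =>
    obtain ⟨M, hM0, hM⟩ := (f.2 s hs.le hs1).exists_bound
    have hg0 : 0 < ‖coeff 0 g.1‖ := by simpa using hN.pos hs
    have hgle : ∀ i, ‖coeff i g.1‖ * s ^ i ≤ ‖coeff 0 g.1‖ := by simpa using hN.1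
    refine ⟨M / ‖coeff 0 g.1‖, fun n => ?_⟩
    induction n using Nat.strong_induction_on with
    | _ n ih =>
      have h1 : coeff 0 g.1 * coeff n h = coeff n f.1 -
          ∑ i ∈ Finset.range n, coeff (i + 1) g.1 * coeff (n - (i + 1)) h := by
        rw [hfg, coeff_mul, Finset.Nat.sum_antidiagonal_eq_sum_range_succ_mk,
          Finset.sum_range_succ', Nat.sub_zero, add_sub_cancel_left]
      rw [le_div_iff₀ hg0]
      calc ‖coeff n h‖ * s ^ n * ‖coeff 0 g.1‖ = ‖coeff 0 g.1 * coeff n h‖ * s ^ n := by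
            rw [norm_mul]; ring
        _ ≤ max ‖coeff n f.1‖ (M / s ^ n) * s ^ n := by
            gcongr
            rw [h1]
            refine (norm_sub_le_max_of_ultrametric _ _).trans (max_le_max le_rfl ?_)
            refine IsUltrametricDist.norm_sum_le_of_forall_le_of_nonneg (by positivity) ?_
            intro i hi
            have hin : i + 1 ≤ n := Finset.mem_range.mp hi
            rw [le_div_iff₀ (by positivity), norm_mul]
            calc ‖coeff (i + 1) g.1‖ * ‖coeff (n - (i + 1)) h‖ * s ^ n
                = (‖coeff (i + 1) g.1‖ * s ^ (i + 1)) *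
                    (‖coeff (n - (i + 1)) h‖ * s ^ (n - (i + 1))) := by
                  rw [← Nat.add_sub_cancel' hin, pow_add, Nat.add_sub_cancel_left]; ring
              _ ≤ ‖coeff 0 g.1‖ * (M / ‖coeff 0 g.1‖) := by
                  gcongr
                  · exact hgle _
                  · exact ih _ (by omega)
              _ = M := by field_simp
        _ ≤ M := by
            rw [max_mul_of_nonneg _ _ (by positivity)]
            refine max_le (hM n) (le_of_eq ?_)
            field_simp
  | succ N ih =>
    obtain ⟨a, has, hga⟩ := exists_zero hs hs1 hN (Nat.succ_ne_zero N)
    have ha := has.trans_lt hs1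
    have hfa : eval ha f = 0 := by
      obtain ⟨q, hq⟩ := hdvd a ha
      rw [← constantCoeff_expand, hq, map_mul, constantCoeff_expand, eval_apply, hga, zero_mul]
    obtain ⟨g', rfl⟩ := exists_eq_T_sub_mul ha hga
    obtain ⟨f', rfl⟩ := exists_eq_T_sub_mul ha hfa
    have hg'0 : g' ≠ 0 := by rintro rfl; exact hg (mul_zero _)
    obtain ⟨N', hN'⟩ := exists_isMaxIndex hs (g'.2 s hs.le hs1) fun h => hg'0 (Subtype.ext h)
    have hNN' := hN.unique (isMaxIndex_mul hs has hN')
    obtain rfl : N = N' := by omega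
    refine ih hg'0 ?_ (fun b hb => dvd_of_expand_mul_dvd hb (hdvd b hb)) hN'
    have hne : (T - algebraMap k (unitDisk k) a : unitDisk k).1 ≠ 0 := by
      intro h0
      refine expand_T_sub_ne_zero ha a ?_
      rw [show (T - algebraMap k (unitDisk k) a : unitDisk k) = 0 from Subtype.ext h0, map_zero]
    refine mul_left_cancel₀ hne ?_
    rw [← mul_assoc]
    exact hfg

/-- A function which is divisible by `g` locally, at every point of the open unit disk, is
divisible by `g`. -/
theorem dvd_of_forall_expand_dvd {f g : unitDisk k} (hg : g ≠ 0)
    (hdvd : ∀ (a : k) (ha : ‖a‖ < 1), expand ha g ∣ expand ha f) : g ∣ f := by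
  obtain ⟨h, hh⟩ := hdvd 0 (by simp)
  rw [expand_apply, expand_apply, recenter_zero, recenter_zero] at hh
  refine ⟨⟨h, mem_unitDisk_of_pos fun s hs hs1 => ?_⟩, Subtype.ext hh⟩
  obtain ⟨t, hst, ht⟩ := exists_between hs1
  obtain ⟨M, hM⟩ := exists_bound_of_dvd (hs.trans hst) ht hg hh hdvd
  exact isRestricted_of_bound hs.le hst hM

/-- A quotient which is bounded near a point is analytic there. -/
theorem expand_dvd_of_bounded {f g : unitDisk k} (hg : g ≠ 0) {a : k} (ha : ‖a‖ < 1) {M δ : ℝ}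
    (hδ : 0 < δ) (h : ∀ (b : k) (hb : ‖b‖ < 1), b ≠ a → ‖b - a‖ < δ →
      ‖eval hb f‖ ≤ M * ‖eval hb g‖) : expand ha g ∣ expand ha f := by
  obtain ⟨s, hs, hs1, has, -⟩ := exists_radius ha ha
  obtain ⟨N, hN⟩ := exists_isMaxIndex hs (g.2 s hs.le hs1) fun h => hg (Subtype.ext h)
  induction N using Nat.strong_induction_on generalizing f g with
  | _ N ih =>
    by_cases hga : eval ha g = 0
    · have hfa : eval ha f = 0 := by
        obtain ⟨K, hK0, hK⟩ := exists_norm_eval_sub_le ha f hs.le hs1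
        obtain ⟨L, hL0, hL⟩ := exists_norm_eval_sub_le ha g hs.le hs1
        by_contra hne
        have hpos : 0 < ‖eval ha f‖ := norm_pos_iff.mpr hne
        set B := |M| * L + K with hB
        have hB0 : 0 ≤ B := by positivity
        obtain ⟨e, he0, he⟩ := exists_norm_between (k := k) (s := 0)
          (t := min (min δ s) (‖eval ha f‖ / (B + 1))) (by positivity) (by positivity)
          ((min_le_left _ _).trans ((min_le_right _ _).trans hs1.le))
        have heδ := he.trans_le ((min_le_left _ _).trans (min_le_left _ _))
        have hes := he.trans_le ((min_le_left _ _).trans (min_le_right _ _))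
        have heB := he.trans_le (min_le_right _ _)
        have hbs : ‖a + e‖ ≤ s :=
          (IsUltrametricDist.norm_add_le_max a e).trans (max_le has hes.le)
        have hb := hbs.trans_lt hs1
        have h1 := h (a + e) hb (by simpa using norm_pos_iff.mp he0) (by simpa using heδ)
        have h2 := hK (a + e) hb hbs
        have h3 := hL (a + e) hb hbs
        rw [hga, sub_zero, add_sub_cancel_left] at h3
        rw [add_sub_cancel_left] at h2
        rw [lt_div_iff₀ (by positivity)] at heB
        have h4 : ‖eval ha f‖ ≤ B * ‖e‖ := by
          calc ‖eval ha f‖ ≤ ‖eval hb f‖ + ‖eval hb f - eval ha f‖ := norm_le_insert _ _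
            _ ≤ |M| * ‖eval hb g‖ + K * ‖e‖ :=
                add_le_add (h1.trans (by gcongr; exact le_abs_self M)) h2
            _ ≤ |M| * (L * ‖e‖) + K * ‖e‖ := by gcongr
            _ = B * ‖e‖ := by rw [hB]; ring
        nlinarith
      obtain ⟨g', rfl⟩ := exists_eq_T_sub_mul ha hga
      obtain ⟨f', rfl⟩ := exists_eq_T_sub_mul ha hfa
      have hg'0 : g' ≠ 0 := by rintro rfl; exact hg (mul_zero _)
      obtain ⟨N', hN'⟩ := exists_isMaxIndex hs (g'.2 s hs.le hs1) fun h => hg'0 (Subtype.ext h)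
      have hNN' := hN.unique (isMaxIndex_mul hs has hN')
      rw [map_mul, map_mul]
      refine mul_dvd_mul_left _ (ih N' (by omega) hg'0 (fun b hb hba hbδ => ?_) hN')
      have h1 := h b hb hba hbδ
      rw [map_mul, map_mul, norm_mul, norm_mul, mul_left_comm] at h1
      refine le_of_mul_le_mul_left h1 (norm_pos_iff.mpr ?_)
      rw [map_sub, eval_T, AlgHom.commutes]
      exact sub_ne_zero.mpr hba
    · have h1 : IsUnit (expand ha g) := by
        rw [PowerSeries.isUnit_iff_constantCoeff, constantCoeff_expand]
        exact isUnit_iff_ne_zero.mpr hga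
      exact h1.dvd

end unitDisk

end Division

/-! ### The derivation of formal Laurent series -/

section Laurent

namespace LaurentSeries

variable {k : Type u} [Field k]

theorem derivative_ofPowerSeries (f : PowerSeries k) :
    derivative k (HahnSeries.ofPowerSeries ℤ k f) =
      HahnSeries.ofPowerSeries ℤ k (PowerSeries.derivative k f) := by
  ext n
  rw [derivative_apply, hasseDeriv_coeff]
  rcases lt_or_ge n 0 with hn | hn
  · have h1 : (HahnSeries.ofPowerSeries ℤ k (PowerSeries.derivative k f)).coeff n = 0 := by
      rw [PowerSeries.coeff_coe, if_pos hn]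
    rw [h1]
    rcases eq_or_ne n (-1) with rfl | hn1
    · simp
    · rw [PowerSeries.coeff_coe, if_pos (by push_cast; omega), smul_zero]
  · lift n to ℕ using hn
    rw [coeff_coe_powerSeries, ← Nat.cast_add, coeff_coe_powerSeries,
      PowerSeries.coeff_derivative]
    simp [mul_comm]

theorem derivative_single_mul (a : ℤ) (f : LaurentSeries k) :
    derivative k (HahnSeries.single a (1 : k) * f) =
      HahnSeries.single (a - 1) (a : k) * f + HahnSeries.single a (1 : k) * derivative k f := by
  ext n
  rw [derivative_apply, hasseDeriv_coeff, HahnSeries.coeff_add, HahnSeries.coeff_single_mul,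
    HahnSeries.coeff_single_mul, HahnSeries.coeff_single_mul, derivative_apply, hasseDeriv_coeff]
  simp only [Nat.cast_one, Ring.choose_one_right, one_mul, zsmul_eq_mul]
  rw [show n - (a - 1) = n + 1 - a by ring, show n - a + 1 = n + 1 - a by ring]
  push_cast
  ring

theorem derivative_mul (f g : LaurentSeries k) :
    derivative k (f * g) = f * derivative k g + g * derivative k f := by
  rw [← f.single_order_mul_powerSeriesPart, ← g.single_order_mul_powerSeriesPart]
  generalize f.order = a, g.order = b, f.powerSeriesPart = F, g.powerSeriesPart = G
  have h : HahnSeries.single a (1 : k) * HahnSeries.ofPowerSeries ℤ k F *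
      (HahnSeries.single b (1 : k) * HahnSeries.ofPowerSeries ℤ k G) =
      HahnSeries.single (a + b) (1 : k) * HahnSeries.ofPowerSeries ℤ k (F * G) := by
    rw [mul_mul_mul_comm, HahnSeries.single_mul_single, one_mul, map_mul]
  have h1 : HahnSeries.single (a + b - 1) ((a + b : ℤ) : k) =
      HahnSeries.single a (1 : k) * HahnSeries.single (b - 1) (b : k) +
        HahnSeries.single b (1 : k) * HahnSeries.single (a - 1) (a : k) := by
    rw [HahnSeries.single_mul_single, HahnSeries.single_mul_single, one_mul, one_mul,
      show a + (b - 1) = a + b - 1 by ring, show b + (a - 1) = a + b - 1 by ring,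
      ← HahnSeries.single_add, add_comm a b]
    push_cast
    rw [add_comm (b : k)]
  have h2 : HahnSeries.single (a + b) (1 : k) =
      HahnSeries.single a (1 : k) * HahnSeries.single b (1 : k) := by
    rw [HahnSeries.single_mul_single, one_mul]
  rw [h, derivative_single_mul, derivative_single_mul, derivative_single_mul,
    derivative_ofPowerSeries, derivative_ofPowerSeries, derivative_ofPowerSeries,
    (PowerSeries.derivative k).leibniz, smul_eq_mul, smul_eq_mul, map_add, map_mul, map_mul,
    map_mul, h1, h2]
  ring

/-- The derivation `d / dX` of the field of Laurent series. -/
noncomputable def derivation (k : Type u) [Field k] : RingDerivation (LaurentSeries k) :=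
  .ofLeibniz (derivative k).toAddMonoidHom fun f g => derivative_mul f g

theorem derivation_apply (f : LaurentSeries k) : derivation k f = derivative k f := rfl

theorem derivation_ofPowerSeries (f : PowerSeries k) :
    derivation k (HahnSeries.ofPowerSeries ℤ k f) =
      HahnSeries.ofPowerSeries ℤ k (PowerSeries.derivative k f) :=
  derivative_ofPowerSeries f

/-- The ring of formal power series inside the field of Laurent series. -/
noncomputable def integers (k : Type u) [Field k] : Subring (LaurentSeries k) :=
  (HahnSeries.ofPowerSeries ℤ k).range

theorem ofPowerSeries_mem_integers (f : PowerSeries k) :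
    HahnSeries.ofPowerSeries ℤ k f ∈ integers k := ⟨f, rfl⟩

theorem derivation_iterate_mem_integers {f : LaurentSeries k} (hf : f ∈ integers k) (m : ℕ) :
    (derivation k)^[m] f ∈ integers k := by
  induction m with
  | zero => exact hf
  | succ m ih =>
    obtain ⟨g, hg⟩ := ih
    rw [Function.iterate_succ_apply', ← hg, derivation_ofPowerSeries]
    exact ofPowerSeries_mem_integers _

theorem derivation_iterate_ofPowerSeries (f : PowerSeries k) (m : ℕ) :
    (derivation k)^[m] (HahnSeries.ofPowerSeries ℤ k f) =
      HahnSeries.ofPowerSeries ℤ k ((PowerSeries.derivative k)^[m] f) := by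
  induction m with
  | zero => rfl
  | succ m ih =>
    rw [Function.iterate_succ_apply', Function.iterate_succ_apply', ih, derivation_ofPowerSeries]

/-- Laurent series have finitely many polar terms. -/
theorem exists_X_pow_mul_mem_integers (f : LaurentSeries k) :
    ∃ N : ℕ, ∀ m, N ≤ m → HahnSeries.ofPowerSeries ℤ k (PowerSeries.X ^ m) * f ∈ integers k := by
  refine ⟨(-f.order).toNat, fun m hm => ?_⟩
  obtain ⟨j, hj⟩ : ∃ j : ℕ, (m : ℤ) = -f.order + j :=
    ⟨((m : ℤ) + f.order).toNat, by omega⟩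
  rw [HahnSeries.ofPowerSeries_X_pow, hj]
  have h : HahnSeries.single (-f.order + (j : ℤ)) (1 : k) =
      HahnSeries.ofPowerSeries ℤ k (PowerSeries.X ^ j) * HahnSeries.single (-f.order) (1 : k) := by
    rw [HahnSeries.ofPowerSeries_X_pow, HahnSeries.single_mul_single, one_mul, add_comm]
  rw [h, mul_assoc, ← f.ofPowerSeries_powerSeriesPart]
  exact mul_mem (ofPowerSeries_mem_integers _) (ofPowerSeries_mem_integers _)

theorem exists_X_pow_mul_mem_integers_of_finite {ι : Type*} [Finite ι] (f : ι → LaurentSeries k) :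
    ∃ N : ℕ, ∀ m, N ≤ m → ∀ i,
      HahnSeries.ofPowerSeries ℤ k (PowerSeries.X ^ m) * f i ∈ integers k := by
  choose N hN using fun i => exists_X_pow_mul_mem_integers (f i)
  obtain ⟨M, hM⟩ := (Set.finite_range N).bddAbove
  exact ⟨M, fun m hm i => hN i m ((hM ⟨i, rfl⟩).trans hm)⟩

end LaurentSeries

/-- A coefficient of the product of a fixed Laurent series with a power series is bounded in terms
of the coefficients of the power series. -/
theorem LaurentSeries.exists_norm_coeff_mul_le {k : Type u} [NormedField k] [IsUltrametricDist k]
    (w : LaurentSeries k) : ∃ K : ℝ, 0 ≤ K ∧ ∀ (h : PowerSeries k) (M : ℝ), 0 ≤ M →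
      (∀ j, ‖PowerSeries.coeff j h‖ ≤ M) →
        ‖(HahnSeries.ofPowerSeries ℤ k h * w).coeff 0‖ ≤ K * M := by
  obtain ⟨N, hN⟩ := exists_X_pow_mul_mem_integers w
  obtain ⟨g, hg⟩ := hN N le_rfl
  refine ⟨∑ i ∈ Finset.range (N + 1), ‖PowerSeries.coeff i g‖,
    Finset.sum_nonneg fun i _ => norm_nonneg _, fun h M hM0 hM => ?_⟩
  have h1 : (HahnSeries.ofPowerSeries ℤ k h * w).coeff 0 = PowerSeries.coeff N (h * g) := by
    have h2 : HahnSeries.ofPowerSeries ℤ k (h * g) =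
        HahnSeries.single (N : ℤ) 1 * (HahnSeries.ofPowerSeries ℤ k h * w) := by
      rw [map_mul, hg, HahnSeries.ofPowerSeries_X_pow]
      ring
    rw [← coeff_coe_powerSeries, h2, HahnSeries.coeff_single_mul, sub_self, one_mul]
  rw [h1, PowerSeries.coeff_mul]
  have hK0 : 0 ≤ ∑ i ∈ Finset.range (N + 1), ‖PowerSeries.coeff i g‖ :=
    Finset.sum_nonneg fun i _ => norm_nonneg _
  refine IsUltrametricDist.norm_sum_le_of_forall_le_of_nonneg (by positivity) fun ij hij => ?_
  rw [norm_mul, mul_comm]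
  have hij' : ij.2 ≤ N := Finset.HasAntidiagonal.antidiagonal.snd_le hij
  gcongr
  · exact Finset.single_le_sum (f := fun i => ‖PowerSeries.coeff i g‖)
      (fun i _ => norm_nonneg _) (Finset.mem_range.mpr (by omega))
  · exact hM _

end Laurent

/-! ### Differential systems over a differential ring -/

section System

theorem RingDerivation.iterate_leibniz {S : Type*} [CommRing S] (D : RingDerivation S) (f g : S)
    (m : ℕ) : D^[m] (f * g) = ∑ ij ∈ Finset.HasAntidiagonal.antidiagonal m,
      m.choose ij.1 • (D^[ij.1] f * D^[ij.2] g) := by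
  induction m with
  | zero => simp
  | succ m ih =>
    rw [Function.iterate_succ_apply', ih, map_sum,
      Finset.sum_antidiagonal_choose_succ_nsmul (fun i j => D^[i] f * D^[j] g) m,
      ← Finset.sum_add_distrib]
    refine Finset.sum_congr rfl fun ij hij => ?_
    have h : m.choose ij.2 = m.choose ij.1 :=
      Nat.choose_symm_of_eq_add
        ((Finset.HasAntidiagonal.mem_antidiagonal.mp hij).symm.trans (add_comm _ _))
    rw [map_nsmul, D.leibniz, h, Function.iterate_succ_apply', Function.iterate_succ_apply',
      smul_eq_mul, smul_eq_mul, ← nsmul_add, mul_comm (D^[ij.2] g)]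

variable {S : Type*} [CommRing S] {ι : Type*} [Fintype ι]
  [DecidableEq ι]

/-- The numerator `Bₘ` in the formula `v⁽ᵐ⁾ = (Bₘ / dᵐ) v` for the derivatives of a solution of the
system `v' = (A / d) v`. -/
def systemNum (D : RingDerivation S) (d : S) (A : Matrix ι ι S) : ℕ → Matrix ι ι S
  | 0 => 1
  | m + 1 => d • (systemNum D d A m).map D + systemNum D d A m * A
      - ((m : S) * D d) • systemNum D d A m

/-- The numerator `Pₘ` in the formula `(qv)⁽ᵐ⁾ = (Pₘ / (q dᵐ)) v` for a solution of the system
`v' = (A / d) v`. -/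
def gaugeNum (D : RingDerivation S) (d : S) (A : Matrix ι ι S) (q : S) (m : ℕ) : Matrix ι ι S :=
  q • ∑ ij ∈ Finset.HasAntidiagonal.antidiagonal m,
    (m.choose ij.1 • (D^[ij.1] q * d ^ ij.1)) • systemNum D d A ij.2

theorem systemNum_map {S' : Type*} [CommRing S']
    (D : RingDerivation S) (D' : RingDerivation S') (φ : S →+* S')
    (hφ : ∀ f, φ (D f) = D' (φ f)) (d : S) (A : Matrix ι ι S) (m : ℕ) :
    (systemNum D d A m).map φ = systemNum D' (φ d) (A.map φ) m := by
  induction m with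
  | zero => exact Matrix.map_one _ (map_zero φ) (map_one φ)
  | succ m ih =>
    rw [systemNum, systemNum, ← ih]
    ext i j
    simp [Matrix.mul_apply, hφ, map_sum]

theorem gaugeNum_map {S' : Type*} [CommRing S']
    (D : RingDerivation S) (D' : RingDerivation S') (φ : S →+* S')
    (hφ : ∀ f, φ (D f) = D' (φ f)) (d : S) (A : Matrix ι ι S) (q : S) (m : ℕ) :
    (gaugeNum D d A q m).map φ = gaugeNum D' (φ d) (A.map φ) (φ q) m := by
  have hiter : ∀ (i : ℕ) (f : S), φ (D^[i] f) = D'^[i] (φ f) := by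
    intro i f
    induction i with
    | zero => rfl
    | succ i ih => rw [Function.iterate_succ_apply', Function.iterate_succ_apply', hφ, ih]
  ext i j
  simp only [gaugeNum, Matrix.map_apply, Matrix.smul_apply, Matrix.sum_apply, smul_eq_mul,
    map_mul, map_sum, map_nsmul, map_pow, hiter, ← systemNum_map D D' φ hφ]

theorem map_gaugeNum_apply {S' : Type*} [CommRing S']
    (D : RingDerivation S) (D' : RingDerivation S') (φ : S →+* S')
    (hφ : ∀ f, φ (D f) = D' (φ f)) (d : S) (A : Matrix ι ι S) (q : S) (m : ℕ) (i j : ι) :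
    φ (gaugeNum D d A q m i j) = gaugeNum D' (φ d) (A.map φ) (φ q) m i j := by
  rw [← gaugeNum_map D D' φ hφ, Matrix.map_apply]

theorem systemNum_mulVec (D : RingDerivation S) (d : S) (A : Matrix ι ι S) (v : ι → S)
    (hv : ∀ i, d * D (v i) = ∑ j, A i j * v j) (m : ℕ) (i : ι) :
    ∑ j, systemNum D d A m i j * v j = d ^ m * D^[m] (v i) := by
  induction m generalizing i with
  | zero => simp [systemNum, Matrix.one_apply]
  | succ m ih =>
    have h1 := congrArg D (ih i)
    rw [map_sum, D.leibniz, smul_eq_mul, smul_eq_mul, D.leibniz_pow] at h1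
    simp only [D.leibniz, smul_eq_mul, nsmul_eq_mul, Finset.sum_add_distrib] at h1
    have h2 : ∑ j, (systemNum D d A m * A) i j * v j =
        d * ∑ j, systemNum D d A m i j * D (v j) := by
      simp only [Matrix.mul_apply, Finset.sum_mul, Finset.mul_sum]
      rw [Finset.sum_comm]
      refine Finset.sum_congr rfl fun l _ => ?_
      rw [mul_left_comm, hv, Finset.mul_sum]
      exact Finset.sum_congr rfl fun j _ => by ring
    have h3 : ∑ j, systemNum D d A (m + 1) i j * v j =
        d * (∑ j, v j * D (systemNum D d A m i j)) + d * ∑ j, systemNum D d A m i j * D (v j)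
          - (m : S) * D d * ∑ j, systemNum D d A m i j * v j := by
      rw [← h2, Finset.mul_sum, Finset.mul_sum, ← Finset.sum_add_distrib, ← Finset.sum_sub_distrib]
      refine Finset.sum_congr rfl fun j _ => ?_
      simp only [systemNum, Matrix.sub_apply, Matrix.add_apply, Matrix.smul_apply,
        Matrix.map_apply, smul_eq_mul]
      ring
    rw [h3, ih i, Function.iterate_succ_apply', ← mul_add, add_comm, h1, mul_add]
    rcases m with _ | m
    · simp
    · rw [Nat.add_sub_cancel]
      push_cast
      ring

theorem gaugeNum_mulVec (D : RingDerivation S) (d : S) (A : Matrix ι ι S) (q : S) (v : ι → S)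
    (hv : ∀ i, d * D (v i) = ∑ j, A i j * v j) (m : ℕ) (i : ι) :
    ∑ j, gaugeNum D d A q m i j * v j = q * (d ^ m * D^[m] (q * v i)) := by
  have h1 : ∑ j, gaugeNum D d A q m i j * v j =
      q * ∑ ab ∈ Finset.HasAntidiagonal.antidiagonal m, (m.choose ab.1 • (D^[ab.1] q * d ^ ab.1)) *
        ∑ j, systemNum D d A ab.2 i j * v j := by
    simp only [gaugeNum, Matrix.smul_apply, Matrix.sum_apply, smul_eq_mul, Finset.mul_sum,
      Finset.sum_mul]
    rw [Finset.sum_comm]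
    exact Finset.sum_congr rfl fun _ _ => Finset.sum_congr rfl fun _ _ => by ring
  rw [h1, RingDerivation.iterate_leibniz, Finset.mul_sum (a := d ^ m)]
  congr 1
  refine Finset.sum_congr rfl fun ab hab => ?_
  rw [systemNum_mulVec D d A v hv, ← Finset.HasAntidiagonal.mem_antidiagonal.mp hab, pow_add]
  simp only [nsmul_eq_mul]
  ring

/-- If `A / d` is integral, then so is `Bₘ / dᵐ`. -/
theorem pow_dvd_systemNum (D : RingDerivation S) (d : S) (A : Matrix ι ι S)
    (h : ∀ i j, d ∣ A i j) (m : ℕ) (i j : ι) : d ^ m ∣ systemNum D d A m i j := by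
  choose C hC using h
  have key : ∃ E : Matrix ι ι S, systemNum D d A m = d ^ m • E := by
    clear i j
    induction m with
    | zero => exact ⟨1, by simp [systemNum]⟩
    | succ m ih =>
      obtain ⟨E, hE⟩ := ih
      refine ⟨E.map D + E * Matrix.of C, ?_⟩
      ext i j
      have h1 : ∑ l, d ^ m * E i l * (d * C l j) = d ^ (m + 1) * ∑ l, E i l * C l j := by
        rw [Finset.mul_sum]
        exact Finset.sum_congr rfl fun l _ => by ring
      simp only [systemNum, hE, Matrix.sub_apply, Matrix.add_apply, Matrix.smul_apply,
        Matrix.map_apply, Matrix.mul_apply, smul_eq_mul, hC, D.leibniz, D.leibniz_pow,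
        nsmul_eq_mul, Matrix.of_apply, h1]
      rcases m with _ | m
      · simp [mul_add]
      · rw [Nat.add_sub_cancel]
        push_cast
        ring
  obtain ⟨E, hE⟩ := key
  exact ⟨E i j, by rw [hE, Matrix.smul_apply, smul_eq_mul]⟩

theorem pow_dvd_gaugeNum (D : RingDerivation S) (d : S) (A : Matrix ι ι S)
    (h : ∀ i j, d ∣ A i j) (q : S) (m : ℕ) (i j : ι) : d ^ m ∣ gaugeNum D d A q m i j := by
  simp only [gaugeNum, Matrix.smul_apply, Matrix.sum_apply, smul_eq_mul]
  refine Dvd.dvd.mul_left (Finset.dvd_sum fun ab hab => ?_) q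
  rw [← Finset.HasAntidiagonal.mem_antidiagonal.mp hab, pow_add]
  refine mul_dvd_mul ?_ (pow_dvd_systemNum D d A h _ i j)
  rw [nsmul_eq_mul]
  exact (dvd_mul_left _ _).mul_left _

/-- If `Φ` is a fundamental matrix such that `qΦ` and `qΦ⁻¹` are integral with respect to a subring
`O` stable under `D`, then `Pₘ / dᵐ = (qΦ)⁽ᵐ⁾ (qΦ⁻¹)` is integral, for all `m`. -/
theorem exists_gaugeNum_eq (D : RingDerivation S) (d : S) (A : Matrix ι ι S) (q : S)
    (O : Subring S) (hO : ∀ f ∈ O, ∀ m, D^[m] f ∈ O) (Φ : (Matrix ι ι S)ˣ)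
    (hΦ : ∀ i j, d * D (Φ.1 i j) = ∑ l, A i l * Φ.1 l j)
    (h1 : ∀ i j, q * Φ.1 i j ∈ O) (h2 : ∀ i j, q * Φ.2 i j ∈ O) (m : ℕ) (i j : ι) :
    ∃ f ∈ O, gaugeNum D d A q m i j = d ^ m * f := by
  refine ⟨∑ l, D^[m] (q * Φ.1 i l) * (q * Φ.2 l j),
    sum_mem fun l _ => mul_mem (hO _ (h1 i l) m) (h2 l j), ?_⟩
  have h3 : gaugeNum D d A q m = gaugeNum D d A q m * Φ.1 * Φ.2 := by
    rw [mul_assoc, Φ.3, mul_one]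
  rw [h3, Matrix.mul_apply, Finset.mul_sum]
  refine Finset.sum_congr rfl fun l _ => ?_
  rw [Matrix.mul_apply, gaugeNum_mulVec D d A q (fun i => Φ.1 i l) (fun i => hΦ i l)]
  ring

end System

/-! ### Systems with apparent singularities on the open unit disk -/

section ApparentSingularities

open PowerSeries

variable {k : Type u} [NormedField k]

/-- The filter of the points of the open unit disk which tend to its boundary and avoid the zeros
of `d`. -/
def nearBoundary (d : PowerSeries k) : Filter k :=
  comap (fun b => ‖b‖) (𝓝[<] 1) ⊓ 𝓟 {b | evalAt b d ≠ 0}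

theorem eventually_nearBoundary {d : PowerSeries k} {P : k → Prop} :
    (∀ᶠ b in nearBoundary d, P b) ↔
      ∃ s < (1 : ℝ), ∀ b : k, s < ‖b‖ → ‖b‖ < 1 → evalAt b d ≠ 0 → P b := by
  rw [nearBoundary, eventually_inf_principal, eventually_comap]
  constructor
  · intro h
    obtain ⟨s, hs, hsub⟩ := (mem_nhdsLT_iff_exists_Ioo_subset (α := ℝ)).mp h
    exact ⟨s, hs, fun b hb hb1 hd => hsub ⟨hb, hb1⟩ b rfl hd⟩
  · rintro ⟨s, hs, h⟩
    filter_upwards [Ioo_mem_nhdsLT hs] with t ht b hbt hd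
    exact h b (hbt ▸ ht.1) (hbt ▸ ht.2) hd

variable [IsUltrametricDist k]

/-- The functions bounded by one on the open unit disk form a ring. -/
theorem unitDisk.norm_coeff_mul_le_one {f g : unitDisk k} (hf : ∀ j, ‖coeff j f.1‖ ≤ 1)
    (hg : ∀ j, ‖coeff j g.1‖ ≤ 1) (j : ℕ) : ‖coeff j (f * g).1‖ ≤ 1 := by
  change ‖coeff j (f.1 * g.1)‖ ≤ 1
  rw [coeff_mul]
  refine IsUltrametricDist.norm_sum_le_of_forall_le_of_nonneg zero_le_one fun ij _ => ?_
  rw [norm_mul]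
  exact mul_le_one₀ (hf _) (norm_nonneg _) (hg _)

/-- The `i`-th derivative is `i!` times a divided derivative, which has integral coefficients if the
function has. -/
theorem unitDisk.norm_evalAt_iterate_deriv_le {q : unitDisk k} (hq : ∀ j, ‖coeff j q.1‖ ≤ 1) (i : ℕ)
    {b : k} (hb : ‖b‖ < 1) : ‖evalAt b (unitDisk.deriv^[i] q).1‖ ≤ ‖(i.factorial : k)‖ := by
  have h1 : (unitDisk.deriv^[i] q).1 = (PowerSeries.derivative k)^[i] q.1 := by
    induction i with
    | zero => rfl
    | succ i ih => rw [Function.iterate_succ_apply', Function.iterate_succ_apply', ← ih]; rfl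
  refine norm_evalAt_le hb.le fun n => ?_
  rw [one_pow, mul_one, h1, coeff_iterate_derivative, Nat.ascFactorial_eq_factorial_mul_choose]
  push_cast
  rw [norm_mul, norm_mul]
  exact (mul_le_of_le_one_right (by positivity) (hq _)).trans
    (mul_le_of_le_one_right (norm_nonneg _) (IsUltrametricDist.norm_natCast_le_one k _))

variable [CompleteSpace k] [IsAlgClosed k]
  [Fact (∃ c : k, c ≠ 0 ∧ ‖c‖ < 1)]

namespace unitDisk

/-- There are circles of radius arbitrarily close to one without zeros of `d`. -/
theorem exists_circle {d : unitDisk k} (hd : d ≠ 0) {s : ℝ} (hs : s < 1) :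
    ∃ a : k, s < ‖a‖ ∧ ‖a‖ < 1 ∧ ∀ b : k, ‖b‖ = ‖a‖ → evalAt b d.1 ≠ 0 := by
  obtain ⟨t, ht, ht1⟩ := exists_between (max_lt hs zero_lt_one)
  have hst := (le_max_left _ _).trans_lt ht
  have ht0 := (le_max_right _ _).trans_lt ht
  set F : Set ℝ := insert s (((fun a : k => ‖a‖) '' {a : k | ‖a‖ ≤ t ∧ evalAt a d.1 = 0}) ∩
    Set.Iio t) with hF
  have hfin : F.Finite := (((finite_zeros ht0 ht1 hd).image _).inter_of_left _).insert s
  obtain ⟨u, hu, hmax⟩ := Set.exists_max_image F id hfin ⟨s, Set.mem_insert _ _⟩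
  have hut : u < t := by
    rcases hu with rfl | hu
    · exact hst
    · exact hu.2
  obtain ⟨a, hua, hat⟩ := exists_norm_between (k := k) hut ht0 ht1.le
  refine ⟨a, (hmax s (Set.mem_insert _ _)).trans_lt hua, hat.trans ht1, fun b hb hdb => ?_⟩
  refine (hmax ‖b‖ (Set.mem_insert_of_mem _ ⟨⟨b, ⟨hb.trans_le hat.le, hdb⟩, rfl⟩, ?_⟩)).not_gt ?_
  · exact hb.trans_lt hat
  · exact hua.trans_le hb.ge

theorem norm_coeff_le_of_nearBoundary {d : unitDisk k} (hd : d ≠ 0) {f : unitDisk k} {M : ℝ}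
    (h : ∀ᶠ b in nearBoundary d.1, ‖evalAt b f.1‖ ≤ M) (j : ℕ) : ‖coeff j f.1‖ ≤ M := by
  obtain ⟨s₀, hs₀, h⟩ := eventually_nearBoundary.mp h
  refine norm_coeff_le (fun s hs => ?_) j
  obtain ⟨a, ha, ha1, hda⟩ := exists_circle hd (max_lt hs hs₀)
  exact ⟨a, (le_max_left _ _).trans_lt ha, ha1, fun b hb hba =>
    h b (hba ▸ (le_max_right _ _).trans_lt ha) hb (hda b hba)⟩

/-- The zeros of `d` are isolated, so a bound off these zeros holds in punctured neighbourhoods. -/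
theorem expand_dvd_of_nearBoundary {f g : unitDisk k} (hg : g ≠ 0) {s₀ M : ℝ} (hs₀ : 0 ≤ s₀)
    (h : ∀ b : k, s₀ < ‖b‖ → ‖b‖ < 1 → evalAt b g.1 ≠ 0 →
      ‖evalAt b f.1‖ ≤ M * ‖evalAt b g.1‖) {a : k} (hsa : s₀ < ‖a‖) (ha : ‖a‖ < 1) :
    expand ha g ∣ expand ha f := by
  set Z : Set k := {b : k | ‖b‖ ≤ ‖a‖ ∧ evalAt b g.1 = 0} \ {a} with hZ
  have ha0 : 0 < ‖a‖ := hs₀.trans_lt hsa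
  have hfin : Z.Finite := (finite_zeros ha0 ha hg).sdiff
  have hmem : Zᶜ ∈ 𝓝 a := hfin.isClosed.isOpen_compl.mem_nhds fun h => h.2 rfl
  obtain ⟨δ, hδ, hball⟩ := Metric.mem_nhds_iff.mp hmem
  refine expand_dvd_of_bounded hg ha (M := M) (lt_min hδ ha0) fun b hb hba hbδ => ?_
  have hnorm : ‖b‖ = ‖a‖ := by
    refine IsUltrametricDist.norm_eq_of_add_norm_lt_max (y := -a) ?_ |>.trans (norm_neg a)
    rw [← sub_eq_add_neg, norm_neg]
    exact (hbδ.trans_le (min_le_right _ _)).trans_le (le_max_right _ _)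
  have hbZ := hball (mem_ball_iff_norm.mpr (hbδ.trans_le (min_le_left _ _)))
  exact h b (hsa.trans_le hnorm.ge) hb fun h0 => hbZ ⟨⟨hnorm.le, h0⟩, hba⟩

/-- The Laurent expansion of analytic functions on the open unit disk at one of its points. -/
noncomputable def laurent {a : k} (ha : ‖a‖ < 1) : unitDisk k →+* LaurentSeries k :=
  (HahnSeries.ofPowerSeries ℤ k).comp (expand ha)

theorem laurent_ne_zero {a : k} (ha : ‖a‖ < 1) {f : unitDisk k} (hf : f ≠ 0) :
    laurent ha f ≠ 0 := by
  intro h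
  refine hf (expand_injective ha ?_)
  rw [map_zero]
  refine HahnSeries.ofPowerSeries_injective (Γ := ℤ) (R := k) ?_
  rw [map_zero]
  exact h

theorem laurent_deriv {a : k} (ha : ‖a‖ < 1) (f : unitDisk k) :
    laurent ha (deriv f) = LaurentSeries.derivation k (laurent ha f) := by
  change HahnSeries.ofPowerSeries ℤ k (expand ha (deriv f)) = _
  rw [expand_deriv]
  exact (LaurentSeries.derivation_ofPowerSeries (expand ha f)).symm

theorem laurent_mul_mem_integers {a : k} (ha : ‖a‖ < 1) {N : ℕ} {q : unitDisk k}
    (hq : (T - algebraMap k (unitDisk k) a) ^ N ∣ q) {f : LaurentSeries k}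
    (hf : HahnSeries.ofPowerSeries ℤ k (X ^ N) * f ∈ LaurentSeries.integers k) :
    laurent ha q * f ∈ LaurentSeries.integers k := by
  obtain ⟨q', rfl⟩ := hq
  have h : laurent ha ((T - algebraMap k (unitDisk k) a) ^ N) =
      HahnSeries.ofPowerSeries ℤ k (X ^ N) := by
    change HahnSeries.ofPowerSeries ℤ k (expand ha _) = _
    rw [map_pow (expand ha), expand_T_sub_algebraMap, sub_self, map_zero, add_zero]
  rw [map_mul, h, mul_comm (HahnSeries.ofPowerSeries ℤ k (X ^ N)), mul_assoc]
  exact mul_mem (LaurentSeries.ofPowerSeries_mem_integers _) hf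

variable {ι : Type*} [Fintype ι] [DecidableEq ι]

theorem expand_gaugeNum {a : k} (ha : ‖a‖ < 1) (d : unitDisk k) (A : Matrix ι ι (unitDisk k))
    (q : unitDisk k) (m : ℕ) (i j : ι) :
    expand ha (gaugeNum deriv d A q m i j) = gaugeNum (PowerSeries.derivation k) (expand ha d)
      (A.map (expand ha)) (expand ha q) m i j := by
  refine map_gaugeNum_apply (S := unitDisk k) (S' := PowerSeries k) deriv
    (PowerSeries.derivation k) (expand ha) ?_ d A q m i j
  exact expand_deriv ha

theorem laurent_gaugeNum {a : k} (ha : ‖a‖ < 1) (d : unitDisk k) (A : Matrix ι ι (unitDisk k))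
    (q : unitDisk k) (m : ℕ) (i j : ι) :
    laurent ha (gaugeNum deriv d A q m i j) = gaugeNum (LaurentSeries.derivation k) (laurent ha d)
      (A.map (laurent ha)) (laurent ha q) m i j := by
  refine map_gaugeNum_apply (S := unitDisk k) (S' := LaurentSeries k) deriv
    (LaurentSeries.derivation k) (laurent ha) ?_ d A q m i j
  exact laurent_deriv ha

theorem expand_pow_dvd_gaugeNum {a : k} (ha : ‖a‖ < 1) {d : unitDisk k}
    {A : Matrix ι ι (unitDisk k)} (h : ∀ i j, expand ha d ∣ expand ha (A i j)) (q : unitDisk k)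
    (m : ℕ) (i j : ι) : expand ha (d ^ m) ∣ expand ha (gaugeNum deriv d A q m i j) := by
  rw [map_pow, expand_gaugeNum]
  refine pow_dvd_gaugeNum _ _ _ ?_ _ _ _ _
  exact h

theorem expand_pow_dvd_gaugeNum_of_fundamental {a : k} (ha : ‖a‖ < 1) {d : unitDisk k}
    {A : Matrix ι ι (unitDisk k)} {q : unitDisk k} (Φ : (Matrix ι ι (LaurentSeries k))ˣ)
    (hΦ : ∀ i j, laurent ha d * LaurentSeries.derivation k (Φ.1 i j) =
      ∑ l, laurent ha (A i l) * Φ.1 l j)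
    (h1 : ∀ i j, laurent ha q * Φ.1 i j ∈ LaurentSeries.integers k)
    (h2 : ∀ i j, laurent ha q * Φ.2 i j ∈ LaurentSeries.integers k)
    (m : ℕ) (i j : ι) : expand ha (d ^ m) ∣ expand ha (gaugeNum deriv d A q m i j) := by
  obtain ⟨f, ⟨g, rfl⟩, hg⟩ := exists_gaugeNum_eq (LaurentSeries.derivation k) (laurent ha d)
    (A.map (laurent ha)) (laurent ha q) (LaurentSeries.integers k)
    (fun f hf m => LaurentSeries.derivation_iterate_mem_integers hf m) Φ hΦ h1 h2 m i j
  have h3 := laurent_gaugeNum ha d A q m i j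
  rw [hg] at h3
  refine ⟨g, HahnSeries.ofPowerSeries_injective (Γ := ℤ) (R := k) ?_⟩
  rw [map_mul, map_pow, map_pow]
  exact h3

/-- Apparent singularities can be removed by a scalar factor: there is a function `q`, a product of
powers of linear factors, such that `q y` and the matrices of the derivatives of `q Φ`, for the
fundamental matrices `Φ`, have no poles. The poles of the system are zeros of `d` away from the
boundary, hence finite in number. -/
theorem exists_gauge {d : unitDisk k} (hd : d ≠ 0) {A : Matrix ι ι (unitDisk k)}
    (hsing : ∀ (a : k) (ha : ‖a‖ < 1), ∃ Φ : (Matrix ι ι (LaurentSeries k))ˣ,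
      ∀ i j, laurent ha d * LaurentSeries.derivation k (Φ.1 i j) =
        ∑ l, laurent ha (A i l) * Φ.1 l j)
    {M : ℝ} (hbd : ∀ᶠ b in nearBoundary d.1, ∀ i j,
      ‖evalAt b (A i j).1‖ ≤ M * ‖evalAt b d.1‖)
    {x : k} (hx : ‖x‖ < 1) (y : ι → LaurentSeries k) :
    ∃ q : unitDisk k, q ≠ 0 ∧ (∀ j, ‖coeff j q.1‖ ≤ 1) ∧
      (∀ i, laurent hx q * y i ∈ LaurentSeries.integers k) ∧
      ∀ m i j, d ^ m ∣ gaugeNum deriv d A q m i j := by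
  obtain ⟨s₁, hs₁, hbd⟩ := eventually_nearBoundary.mp hbd
  obtain ⟨s₀, hs, hs₀⟩ := exists_between (max_lt hs₁ zero_lt_one)
  have hs₁₀ := (le_max_left _ _).trans_lt hs
  have hpos := (le_max_right _ _).trans_lt hs
  have hfin := finite_zeros hpos hs₀ hd
  set S : Finset k := hfin.toFinset with hS
  have hS1 : ∀ a ∈ S, ‖a‖ < 1 := fun a haS => ((hfin.mem_toFinset.mp haS).1).trans_lt hs₀
  have hN : ∀ a : k, ∃ N : ℕ, ∀ ha : ‖a‖ < 1, ∃ Φ : (Matrix ι ι (LaurentSeries k))ˣ,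
      (∀ i j, laurent ha d * LaurentSeries.derivation k (Φ.1 i j) =
        ∑ l, laurent ha (A i l) * Φ.1 l j) ∧
      (∀ i j, HahnSeries.ofPowerSeries ℤ k (X ^ N) * Φ.1 i j ∈ LaurentSeries.integers k) ∧
      (∀ i j, HahnSeries.ofPowerSeries ℤ k (X ^ N) * Φ.2 i j ∈ LaurentSeries.integers k) := by
    intro a
    by_cases ha : ‖a‖ < 1
    · obtain ⟨Φ, hΦ⟩ := hsing a ha
      obtain ⟨N₁, hN₁⟩ := LaurentSeries.exists_X_pow_mul_mem_integers_of_finite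
        (fun ij : ι × ι => Φ.1 ij.1 ij.2)
      obtain ⟨N₂, hN₂⟩ := LaurentSeries.exists_X_pow_mul_mem_integers_of_finite
        (fun ij : ι × ι => Φ.2 ij.1 ij.2)
      exact ⟨max N₁ N₂, fun _ => ⟨Φ, hΦ, fun i j => hN₁ _ (le_max_left _ _) (i, j),
        fun i j => hN₂ _ (le_max_right _ _) (i, j)⟩⟩
    · exact ⟨0, fun h => absurd h ha⟩
  choose N hN using hN
  obtain ⟨Ny, hNy⟩ := LaurentSeries.exists_X_pow_mul_mem_integers_of_finite y
  set lin : k → unitDisk k := fun a => T - algebraMap k (unitDisk k) a with hlin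
  have hlin0 : ∀ a, lin a ≠ 0 := by
    intro a h
    refine expand_T_sub_ne_zero (k := k) hx a ?_
    change expand hx (lin a) = 0
    rw [h, map_zero]
  have hlin1 : ∀ a, ‖a‖ < 1 → ∀ j, ‖coeff j (lin a).1‖ ≤ 1 := by
    intro a ha j
    change ‖coeff j (X - C a)‖ ≤ 1
    rw [map_sub]
    refine (norm_sub_le_max_of_ultrametric _ _).trans (max_le ?_ ?_)
    · rw [coeff_X]
      split_ifs <;> simp
    · rw [coeff_C]
      split_ifs
      · exact ha.le
      · simp
  have hpow1 : ∀ a, ‖a‖ < 1 → ∀ n j, ‖coeff j (lin a ^ n).1‖ ≤ 1 := by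
    intro a ha n
    induction n with
    | zero =>
      intro j
      change ‖coeff j (1 : PowerSeries k)‖ ≤ 1
      rw [coeff_one]
      split_ifs <;> simp
    | succ n ih =>
      rw [pow_succ]
      exact norm_coeff_mul_le_one ih (hlin1 a ha)
  refine ⟨(∏ a ∈ S, lin a ^ N a) * lin x ^ Ny,
    mul_ne_zero (Finset.prod_ne_zero_iff.mpr fun a _ => pow_ne_zero _ (hlin0 a))
      (pow_ne_zero _ (hlin0 x)), norm_coeff_mul_le_one ?_ (hpow1 x hx Ny), fun i => ?_,
    fun m i j => ?_⟩
  · refine Finset.prod_induction _ (fun f : unitDisk k => ∀ j, ‖coeff j f.1‖ ≤ 1)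
      (fun f g hf hg => norm_coeff_mul_le_one hf hg) (hpow1 0 (by simp) 0)
      fun a ha => hpow1 a (hS1 a ha) _
  · exact laurent_mul_mem_integers hx (dvd_mul_left _ _) (hNy Ny le_rfl i)
  · refine dvd_of_forall_expand_dvd (pow_ne_zero m hd) fun a ha => ?_
    by_cases haS : a ∈ S
    · obtain ⟨Φ, hΦ, h1, h2⟩ := hN a ha
      have hdvd : lin a ^ N a ∣ (∏ a ∈ S, lin a ^ N a) * lin x ^ Ny :=
        (Finset.dvd_prod_of_mem (fun a => lin a ^ N a) haS).mul_right _
      exact expand_pow_dvd_gaugeNum_of_fundamental ha Φ hΦ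
        (fun i j => laurent_mul_mem_integers ha hdvd (h1 i j))
        (fun i j => laurent_mul_mem_integers ha hdvd (h2 i j)) m i j
    · refine expand_pow_dvd_gaugeNum ha (fun i j => ?_) _ m i j
      rcases le_or_gt ‖a‖ s₀ with has | has
      · have hda : eval ha d ≠ 0 := fun h0 => haS (hfin.mem_toFinset.mpr ⟨has, h0⟩)
        have h1 : IsUnit (expand ha d) := by
          rw [PowerSeries.isUnit_iff_constantCoeff, constantCoeff_expand]
          exact isUnit_iff_ne_zero.mpr hda
        exact h1.dvd
      · exact expand_dvd_of_nearBoundary hd hpos.le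
          (fun b hb hb1 hdb => hbd b (hs₁₀.trans hb) hb1 hdb i j) has ha

variable [CharZero k]

/-- The transfer principle. Let `y` be a solution at `x` and `q` a gauge factor as above. Then
`(qy)⁽ᵐ⁾ = (H / q) y` for a matrix `H = Pₘ / dᵐ` of analytic functions on the whole disk. By the
maximum principle the entries of `H` are bounded, even at `x`, by their values near the boundary,
where `H` is controlled by the matrices `Bₗ / (l! dˡ)` with `l ≤ m`. -/
theorem exists_norm_coeff_le {d : unitDisk k} (hd : d ≠ 0) {A : Matrix ι ι (unitDisk k)}
    {x : k} (hx : ‖x‖ < 1) {y : ι → LaurentSeries k}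
    (hy : ∀ i, laurent hx d * LaurentSeries.derivation k (y i) = ∑ j, laurent hx (A i j) * y j)
    {q : unitDisk k} (hq0 : q ≠ 0) (hq : ∀ j, ‖coeff j q.1‖ ≤ 1)
    (hdvd : ∀ m i j, d ^ m ∣ gaugeNum deriv d A q m i j) {z : ι → PowerSeries k}
    (hz : ∀ i, HahnSeries.ofPowerSeries ℤ k (z i) = laurent hx q * y i) :
    ∃ K : ℝ, 0 ≤ K ∧ ∀ (m : ℕ) (β : ℝ), 0 ≤ β → (∀ l ≤ m, ∀ᶠ b in nearBoundary d.1, ∀ i j,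
        ‖evalAt b (systemNum deriv d A l i j).1‖ ≤
          β * ‖(l.factorial : k)‖ * ‖evalAt b d.1‖ ^ l) →
      ∀ i, ‖coeff m (z i)‖ ≤ K * β := by
  have hq0' := laurent_ne_zero hx hq0
  choose K hK0 hK using fun j : ι => ((laurent hx q)⁻¹ * y j).exists_norm_coeff_mul_le
  refine ⟨∑ j, K j, Finset.sum_nonneg fun j _ => hK0 j, fun m β hβ hbd i => ?_⟩
  choose H hH using fun i j => hdvd m i j
  have hfac : (m.factorial : k) ≠ 0 := Nat.cast_ne_zero.mpr m.factorial_ne_zero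
  have hfac' : 0 < ‖(m.factorial : k)‖ := norm_pos_iff.mpr hfac
  -- By the maximum principle `H = P / dᵐ` is bounded by its values near the boundary.
  have hHbd : ∀ j n, ‖coeff n (H i j).1‖ ≤ β * ‖(m.factorial : k)‖ := by
    intro j
    refine norm_coeff_le_of_nearBoundary hd ?_
    have h1 : ∀ᶠ b in nearBoundary d.1, ∀ l ∈ Finset.range (m + 1), ∀ i j,
        ‖evalAt b (systemNum deriv d A l i j).1‖ ≤
          β * ‖(l.factorial : k)‖ * ‖evalAt b d.1‖ ^ l := by
      rw [eventually_all_finset]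
      exact fun l hl => hbd l (Nat.lt_succ_iff.mp (Finset.mem_range.mp hl))
    have h2 : ∀ᶠ b in nearBoundary d.1, ‖b‖ < 1 ∧ evalAt b d.1 ≠ 0 :=
      eventually_nearBoundary.mpr ⟨0, zero_lt_one, fun b _ hb hdb => ⟨hb, hdb⟩⟩
    filter_upwards [h1, h2] with b hb ⟨hb1, hdb⟩
    have hdpos : 0 < ‖evalAt b d.1‖ ^ m := pow_pos (norm_pos_iff.mpr hdb) m
    have h3 := congrArg (fun f : unitDisk k => ‖eval hb1 f‖) (hH i j)
    simp only [map_mul, map_pow, norm_mul, norm_pow] at h3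
    refine le_of_mul_le_mul_left ?_ hdpos
    refine h3.symm.le.trans ?_
    simp only [gaugeNum, Matrix.smul_apply, Matrix.sum_apply, smul_eq_mul, map_mul, map_sum,
      map_natCast, map_pow, nsmul_eq_mul, norm_mul]
    refine (mul_le_of_le_one_left (norm_nonneg _) ?_).trans ?_
    · exact norm_evalAt_le hb1.le fun n => by rw [one_pow, mul_one]; exact hq n
    refine IsUltrametricDist.norm_sum_le_of_forall_le_of_nonneg (by positivity) fun ab hab => ?_
    have hab' := Finset.HasAntidiagonal.mem_antidiagonal.mp hab
    rw [norm_mul, norm_mul, norm_mul, norm_pow]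
    have h4 := norm_evalAt_iterate_deriv_le hq ab.1 hb1
    have h5 := hb ab.2 (Finset.mem_range.mpr (by omega)) i j
    have h6 : ‖(m.choose ab.1 : k)‖ * ‖(ab.1.factorial : k)‖ * ‖(ab.2.factorial : k)‖ =
        ‖(m.factorial : k)‖ := by
      rw [← norm_mul, ← norm_mul, ← hab']
      exact_mod_cast congrArg (fun n : ℕ => ‖(n : k)‖)
        (Nat.choose_symm_add (a := ab.1) (b := ab.2) ▸
          Nat.add_choose_mul_factorial_mul_factorial ab.1 ab.2)
    calc ‖(m.choose ab.1 : k)‖ * (‖eval hb1 (deriv^[ab.1] q)‖ * ‖eval hb1 d‖ ^ ab.1) *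
          ‖eval hb1 (systemNum deriv d A ab.2 i j)‖
        ≤ ‖(m.choose ab.1 : k)‖ * (‖(ab.1.factorial : k)‖ * ‖evalAt b d.1‖ ^ ab.1) *
          (β * ‖(ab.2.factorial : k)‖ * ‖evalAt b d.1‖ ^ ab.2) := by
          gcongr
          · exact h4
          · exact le_rfl
          · exact h5
      _ = ‖evalAt b d.1‖ ^ m * (β * ‖(m.factorial : k)‖) := by
          rw [← h6, ← hab', pow_add]
          ring
  have hHx : ∀ j n, ‖coeff n (expand hx (H i j))‖ ≤ β * ‖(m.factorial : k)‖ := by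
    intro j n
    have := norm_coeff_recenter_mul_pow_le zero_lt_one hx.le (f := (H i j).1) (n := n)
      (M := β * ‖(m.factorial : k)‖) fun l _ => by rw [one_pow, mul_one]; exact hHbd j l
    rwa [one_pow, mul_one] at this
  -- The derivatives of the solution `z = q y` are `H y / q`.
  have hsol := gaugeNum_mulVec (LaurentSeries.derivation k) (laurent hx d) (A.map (laurent hx))
    (laurent hx q) y hy m i
  have hiter : (LaurentSeries.derivation k)^[m] (laurent hx q * y i) =
      ∑ j, laurent hx (H i j) * ((laurent hx q)⁻¹ * y j) := by
    refine mul_left_cancel₀ hq0' (mul_left_cancel₀ (pow_ne_zero m (laurent_ne_zero hx hd)) ?_)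
    rw [mul_left_comm, ← hsol, Finset.mul_sum, Finset.mul_sum]
    refine Finset.sum_congr rfl fun j _ => ?_
    rw [← laurent_gaugeNum, hH, map_mul, map_pow]
    field_simp
  rw [← hz, LaurentSeries.derivation_iterate_ofPowerSeries] at hiter
  have hcoeff := congrArg (fun f : LaurentSeries k => f.coeff ((0 : ℕ) : ℤ)) hiter
  simp only [LaurentSeries.coeff_coe_powerSeries, coeff_zero_eq_constantCoeff_apply,
    constantCoeff_iterate_derivative] at hcoeff
  refine le_of_mul_le_mul_left ?_ hfac'
  rw [← norm_mul, hcoeff, HahnSeries.coeff_sum]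
  have hKs : 0 ≤ ∑ j, K j := Finset.sum_nonneg fun j _ => hK0 j
  refine IsUltrametricDist.norm_sum_le_of_forall_le_of_nonneg (by positivity) fun j _ => ?_
  refine (hK j (expand hx (H i j)) _ (by positivity) (hHx j)).trans ?_
  calc K j * (β * ‖(m.factorial : k)‖) ≤ (∑ j, K j) * (β * ‖(m.factorial : k)‖) := by
        gcongr
        exact Finset.single_le_sum (fun j _ => hK0 j) (Finset.mem_univ j)
    _ = _ := by ring

end unitDisk

end ApparentSingularities

/-! ### Fundamental solutions -/

section Fundamental

open PowerSeries

variable {ι : Type*} [Fintype ι] [DecidableEq ι]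

/-- The Taylor coefficients of the fundamental matrix of the system `v' = Γ v` which is the identity
at the origin, for `Γ = ∑ γₘ Xᵐ`. -/
noncomputable def fundamentalCoeff {F : Type*} [Field F] (γ : ℕ → Matrix ι ι F) :
    ℕ → Matrix ι ι F
  | 0 => 1
  | m + 1 => ((m + 1 : F)⁻¹) • ∑ l : Fin (m + 1), γ (m - l) * fundamentalCoeff γ l
termination_by m => m
decreasing_by exact l.2

theorem fundamentalCoeff_zero {F : Type*} [Field F] (γ : ℕ → Matrix ι ι F) :
    fundamentalCoeff γ 0 = 1 := by
  rw [fundamentalCoeff]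

theorem fundamentalCoeff_succ {F : Type*} [Field F] (γ : ℕ → Matrix ι ι F) (m : ℕ) :
    fundamentalCoeff γ (m + 1) =
      ((m + 1 : F)⁻¹) • ∑ l ∈ Finset.range (m + 1), γ (m - l) * fundamentalCoeff γ l := by
  rw [fundamentalCoeff, Finset.sum_range]

theorem fundamentalCoeff_isSolution {F : Type*} [Field F] [CharZero F]
    (Γ : Matrix ι ι (PowerSeries F)) (i j : ι) :
    PowerSeries.derivative F
        (PowerSeries.mk fun m => fundamentalCoeff (fun l => Γ.map (coeff l)) m i j) =
      ∑ a, Γ i a * PowerSeries.mk fun m => fundamentalCoeff (fun l => Γ.map (coeff l)) m a j := by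
  ext m
  rw [coeff_derivative, coeff_mk, fundamentalCoeff_succ, map_sum]
  have hm : (m + 1 : F) ≠ 0 := by exact_mod_cast Nat.succ_ne_zero m
  simp only [coeff_mul, coeff_mk, Matrix.smul_apply, Matrix.sum_apply, Matrix.mul_apply,
    Matrix.map_apply, smul_eq_mul]
  rw [mul_comm, mul_inv_cancel_left₀ hm, Finset.sum_comm]
  refine Finset.sum_congr rfl fun a _ => ?_
  rw [Finset.Nat.sum_antidiagonal_eq_sum_range_succ_mk, ← Finset.sum_range_reflect]
  refine Finset.sum_congr rfl fun l hl => ?_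
  have hl' : l ≤ m := Nat.lt_succ_iff.mp (Finset.mem_range.mp hl)
  simp only [Nat.add_sub_cancel]
  rw [Nat.sub_sub_self hl']

end Fundamental

/-! ### Meromorphic functions on the open unit disk -/

section Meromorphic

open PowerSeries

namespace UnitDiskMeromorphic

variable {k : Type u} [NormedField k] [IsUltrametricDist k] (g : UnitDiskMeromorphic k)

/-- The numerator, as an analytic function on the open unit disk. -/
def numerator : unitDisk k := ⟨g.num, g.num_converges⟩

/-- The denominator, as an analytic function on the open unit disk. -/
def denominator : unitDisk k := ⟨g.den, g.den_converges⟩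

theorem denominator_ne_zero : g.denominator ≠ 0 := fun h => g.den_ne_zero (congrArg Subtype.val h)

theorem hasseNum_mem (m : ℕ) : g.hasseNum m ∈ unitDisk k := by
  have hC : ∀ c : k, C c ∈ unitDisk k := fun c => (unitDisk k).algebraMap_mem c
  induction m with
  | zero => exact g.num_converges
  | succ m ih =>
    rw [hasseNum]
    exact mul_mem (hC _) (sub_mem (mul_mem (unitDisk.derivative_mem ih) g.den_converges)
      (mul_mem (hC _) (mul_mem ih (unitDisk.derivative_mem g.den_converges))))

/-- The numerators `Nₘ` of the divided derivatives, as analytic functions. -/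
noncomputable def hasseNumerator (m : ℕ) : unitDisk k := ⟨g.hasseNum m, g.hasseNum_mem m⟩

variable [CharZero k]

theorem hasseNumerator_succ (m : ℕ) :
    ((m + 1 : ℕ) : unitDisk k) * g.hasseNumerator (m + 1) =
      unitDisk.deriv (g.hasseNumerator m) * g.denominator -
        ((m + 1 : ℕ) : unitDisk k) * (g.hasseNumerator m * unitDisk.deriv g.denominator) := by
  have hm : (m + 1 : k) ≠ 0 := by exact_mod_cast Nat.succ_ne_zero m
  refine Subtype.ext ?_
  have h1 : (C (m + 1 : k) : PowerSeries k) = ((m + 1 : ℕ) : PowerSeries k) := by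
    rw [map_add, map_natCast, map_one]
    push_cast
    rfl
  have h2 : ((m + 1 : ℕ) : PowerSeries k) * g.hasseNum (m + 1) =
      PowerSeries.derivative k (g.hasseNum m) * g.den -
        ((m + 1 : ℕ) : PowerSeries k) * (g.hasseNum m * PowerSeries.derivative k g.den) := by
    rw [hasseNum, ← h1, ← mul_assoc, ← map_mul, mul_inv_cancel₀ hm, map_one, one_mul]
  exact h2

variable [CompleteSpace k] [IsAlgClosed k] [Fact (∃ c : k, c ≠ 0 ∧ ‖c‖ < 1)]

/-- The value at `b` of the divided derivative `(1 / m!) dᵐg / dTᵐ`. -/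
noncomputable def taylorCoeff (m : ℕ) (b : k) : k :=
  evalAt b (g.hasseNum m) / evalAt b (g.den ^ (m + 1))

/-- The values of the divided derivatives are the coefficients of the Taylor expansion. -/
theorem expand_denominator_mul {b : k} (hb : ‖b‖ < 1) (hd : evalAt b g.den ≠ 0) :
    unitDisk.expand hb g.denominator * PowerSeries.mk (fun m => g.taylorCoeff m b) =
      unitDisk.expand hb g.numerator := by
  set δ := unitDisk.expand hb g.denominator with hδ
  have hδ0 : constantCoeff δ = evalAt b g.den := unitDisk.constantCoeff_expand hb _
  have hδi : δ * δ⁻¹ = 1 := PowerSeries.mul_inv_cancel δ (by rwa [hδ0])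
  set h := δ⁻¹ * unitDisk.expand hb g.numerator with hh
  have key : ∀ m, (PowerSeries.derivation k)^[m] h * δ ^ (m + 1) =
      (m.factorial : PowerSeries k) * unitDisk.expand hb (g.hasseNumerator m) := by
    intro m
    induction m with
    | zero =>
      rw [Function.iterate_zero_apply, Nat.factorial_zero, Nat.cast_one, one_mul, zero_add, pow_one,
        hh, mul_right_comm, mul_comm δ⁻¹, hδi, one_mul]
      rfl
    | succ m ih =>
      have h1 := congrArg (fun f => PowerSeries.derivation k f * δ) ih
      simp only [Derivation.leibniz, Derivation.leibniz_pow, smul_eq_mul, nsmul_eq_mul,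
        Nat.add_sub_cancel, Derivation.map_natCast, mul_zero, add_zero] at h1
      have h2 := congrArg (unitDisk.expand hb) (g.hasseNumerator_succ m)
      rw [map_mul, map_sub, map_mul, map_mul, map_mul, unitDisk.expand_deriv,
        unitDisk.expand_deriv, map_natCast] at h2
      rw [Function.iterate_succ_apply', Nat.factorial_succ]
      push_cast at h1 h2 ⊢
      linear_combination h1 - (m.factorial : PowerSeries k) * h2 -
        ((m : PowerSeries k) + 1) * PowerSeries.derivation k δ * ih
  have hcoeff : PowerSeries.mk (fun m => g.taylorCoeff m b) = h := by
    ext m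
    have h1 := congrArg constantCoeff (key m)
    have h2 : (PowerSeries.derivation k)^[m] h = (PowerSeries.derivative k)^[m] h := rfl
    have hfac : (m.factorial : k) ≠ 0 := Nat.cast_ne_zero.mpr m.factorial_ne_zero
    rw [map_mul, map_mul, map_pow, hδ0, h2, constantCoeff_iterate_derivative, map_natCast,
      unitDisk.constantCoeff_expand, mul_assoc] at h1
    have h3 := mul_left_cancel₀ hfac h1
    have h4 : evalAt b (g.den ^ (m + 1)) = evalAt b g.den ^ (m + 1) :=
      map_pow (unitDisk.eval hb) g.denominator (m + 1)
    rw [coeff_mk, taylorCoeff, h4, div_eq_iff (pow_ne_zero _ hd), h3]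
    rfl
  rw [hcoeff, hh, ← mul_assoc, hδi, one_mul]

end UnitDiskMeromorphic

variable {k : Type u} [NormedField k] [IsUltrametricDist k] {n : ℕ}
  (G : Matrix (Fin n) (Fin n) (UnitDiskMeromorphic k))

/-- A common denominator of the entries of a matrix of meromorphic functions. -/
noncomputable def commonDen : unitDisk k := ∏ ij : Fin n × Fin n, (G ij.1 ij.2).denominator

theorem commonDen_ne_zero : commonDen G ≠ 0 :=
  Finset.prod_ne_zero_iff.mpr fun ij _ => (G ij.1 ij.2).denominator_ne_zero

/-- The cofactor of the denominator of an entry in the common denominator. -/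
noncomputable def cofactor (i j : Fin n) : unitDisk k :=
  (Finset.dvd_prod_of_mem (fun ij : Fin n × Fin n => (G ij.1 ij.2).denominator)
    (Finset.mem_univ (i, j))).choose

theorem commonDen_eq (i j : Fin n) :
    commonDen G = (G i j).denominator * cofactor G i j :=
  (Finset.dvd_prod_of_mem (fun ij : Fin n × Fin n => (G ij.1 ij.2).denominator)
    (Finset.mem_univ (i, j))).choose_spec

/-- The numerators of the entries with respect to the common denominator. -/
noncomputable def commonNum : Matrix (Fin n) (Fin n) (unitDisk k) :=
  Matrix.of fun i j => (G i j).numerator * cofactor G i j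

theorem commonNum_apply (i j : Fin n) :
    commonNum G i j = (G i j).numerator * cofactor G i j := rfl

variable [CompleteSpace k]

theorem evalAt_den_ne_zero {b : k} (hb : ‖b‖ < 1) (hd : evalAt b (commonDen G).1 ≠ 0)
    (i j : Fin n) : evalAt b (G i j).den ≠ 0 := by
  intro h0
  refine hd ?_
  have h1 := congrArg (unitDisk.eval hb) (commonDen_eq G i j)
  rw [map_mul] at h1
  refine h1.trans ?_
  rw [show unitDisk.eval hb (G i j).denominator = 0 from h0, zero_mul]

variable [IsAlgClosed k] [Fact (∃ c : k, c ≠ 0 ∧ ‖c‖ < 1)]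

theorem laurent_commonDen_mul_laurentAt {a : k} (ha : ‖a‖ < 1) (i j : Fin n) :
    unitDisk.laurent ha (commonDen G) * (G i j).laurentAt a =
      unitDisk.laurent ha (commonNum G i j) := by
  have h : (G i j).laurentAt a =
      unitDisk.laurent ha (G i j).numerator / unitDisk.laurent ha (G i j).denominator := rfl
  have h0 := unitDisk.laurent_ne_zero ha (G i j).denominator_ne_zero
  rw [h, commonDen_eq G i j, commonNum_apply, map_mul, map_mul]
  field_simp

theorem IsSolutionAt.commonDen {G : Matrix (Fin n) (Fin n) (UnitDiskMeromorphic k)} {a : k}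
    (ha : ‖a‖ < 1) {y : Fin n → LaurentSeries k} (hy : IsSolutionAt G a y) (i : Fin n) :
    unitDisk.laurent ha (commonDen G) * LaurentSeries.derivation k (y i) =
      ∑ j, unitDisk.laurent ha (commonNum G i j) * y j := by
  rw [LaurentSeries.derivation_apply, hy i, Finset.mul_sum]
  exact Finset.sum_congr rfl fun j _ => by rw [← mul_assoc, laurent_commonDen_mul_laurentAt]

variable [CharZero k]

/-- The value at `b` of `Bₘ / (m! dᵐ)` is the `m`-th Taylor coefficient of the fundamental matrix
at `b`. -/
theorem evalAt_systemNum {b : k} (hb : ‖b‖ < 1) (hd : evalAt b (commonDen G).1 ≠ 0) (m : ℕ)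
    (i j : Fin n) :
    evalAt b (systemNum unitDisk.deriv (commonDen G) (commonNum G) m i j).1 =
      evalAt b (commonDen G).1 ^ m * ((m.factorial : k) *
        fundamentalCoeff (fun l => Matrix.of fun i j => (G i j).taylorCoeff l b) m i j) := by
  set Γ : Matrix (Fin n) (Fin n) (PowerSeries k) :=
    Matrix.of fun i j => PowerSeries.mk fun l => (G i j).taylorCoeff l b with hΓ
  have hΓc : (fun l => Γ.map (coeff l)) =
      fun l => Matrix.of fun i j => (G i j).taylorCoeff l b := by
    funext l
    ext i j
    simp [hΓ]
  have hdΓ : ∀ i j, unitDisk.expand hb (commonDen G) * Γ i j =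
      unitDisk.expand hb (commonNum G i j) := by
    intro i j
    rw [commonDen_eq G i j, commonNum_apply, map_mul, map_mul, mul_right_comm]
    exact congrArg (· * _) ((G i j).expand_denominator_mul hb (evalAt_den_ne_zero G hb hd i j))
  rw [← hΓc]
  set v : Fin n → Fin n → PowerSeries k := fun i j =>
    PowerSeries.mk fun m => fundamentalCoeff (fun l => Γ.map (coeff l)) m i j with hv
  have hsol : ∀ i, unitDisk.expand hb (commonDen G) * PowerSeries.derivation k (v i j) =
      ∑ l, (commonNum G).map (unitDisk.expand hb) i l * v l j := by
    intro i
    have h1 : PowerSeries.derivation k (v i j) = ∑ l, Γ i l * v l j :=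
      fundamentalCoeff_isSolution Γ i j
    rw [h1, Finset.mul_sum]
    exact Finset.sum_congr rfl fun l _ => by rw [← mul_assoc, hdΓ, Matrix.map_apply]
  have hmain := systemNum_mulVec (PowerSeries.derivation k) (unitDisk.expand hb (commonDen G))
    ((commonNum G).map (unitDisk.expand hb)) (fun i => v i j) hsol m i
  have hmap := systemNum_map (S := unitDisk k) (S' := PowerSeries k) unitDisk.deriv
    (PowerSeries.derivation k) (unitDisk.expand hb) (unitDisk.expand_deriv hb) (commonDen G)
    (commonNum G) m
  rw [← hmap] at hmain
  have hconst := congrArg constantCoeff hmain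
  have hv0 : ∀ l, constantCoeff (v l j) = (1 : Matrix (Fin n) (Fin n) k) l j := by
    intro l
    rw [hv, ← coeff_zero_eq_constantCoeff_apply, coeff_mk, fundamentalCoeff_zero]
  have hiter : (PowerSeries.derivation k)^[m] (v i j) = (PowerSeries.derivative k)^[m] (v i j) :=
    rfl
  rw [map_sum, map_mul, map_pow, unitDisk.constantCoeff_expand, hiter,
    constantCoeff_iterate_derivative] at hconst
  simp only [map_mul, hv0, Matrix.map_apply, unitDisk.constantCoeff_expand, Matrix.one_apply,
    mul_ite, mul_one, mul_zero, Finset.sum_ite_eq', Finset.mem_univ, if_true] at hconst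
  rw [hv] at hconst
  simp only [coeff_mk] at hconst
  exact hconst

end Meromorphic

/-! ### Fractions in the completed residue field -/

namespace MulRingSeminorm

variable {A : Type u} [CommRing A] (s : MulRingSeminorm A)

/-- The residue field inside its completion. -/
noncomputable def toCompletion : s.ker.ResidueField →+* s.CompletedResidueField :=
  (UniformSpace.Completion.coeRingHom (α := WithAbs s.residueAbs)).comp
    (WithAbs.equiv s.residueAbs).symm.toRingHom

theorem fracValue_eq (a b : A) : s.fracValue a b =
    s.toCompletion (algebraMap A _ a) / s.toCompletion (algebraMap A _ b) := by
  rw [← map_div₀]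
  rfl

theorem norm_fracValue (a : A) {b : A} (hb : s b ≠ 0) : ‖s.fracValue a b‖ = s a / s b := by
  rw [fracValue, UniformSpace.Completion.norm_coe, ← s.residueValue_div a b hb]
  rfl

theorem toCompletion_algebraMap_ne_zero {b : A} (hb : s b ≠ 0) :
    s.toCompletion (algebraMap A _ b) ≠ 0 := by
  rw [map_ne_zero]
  exact fun h => hb (Ideal.algebraMap_residueField_eq_zero.mp h)

theorem fracValue_add (a c : A) {b d : A} (hb : s b ≠ 0) (hd : s d ≠ 0) :
    s.fracValue (a * d + c * b) (b * d) = s.fracValue a b + s.fracValue c d := by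
  have hb' := s.toCompletion_algebraMap_ne_zero hb
  have hd' := s.toCompletion_algebraMap_ne_zero hd
  simp only [fracValue_eq, map_add, map_mul]
  field_simp

theorem fracValue_mul (a b c d : A) :
    s.fracValue (a * c) (b * d) = s.fracValue a b * s.fracValue c d := by
  simp only [fracValue_eq, map_mul]
  rw [div_mul_div_comm]

theorem map_mul_sub_mul_le (x y u w : A) :
    s (x * y - u * w) ≤ s x * s (y - w) + s w * s (x - u) := by
  rw [← map_mul, ← map_mul]
  refine le_of_eq_of_le (congrArg s ?_) (map_add_le_add s _ _)
  ring

end MulRingSeminorm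

/-! ### Absolute values of sections -/

namespace StrictAnalyticSpace

variable {k : Type u} [NormedField k] [IsUltrametricDist k] {Y : StrictAnalyticSpace k}

theorem exists_net_subset {U : Set Y.carrier} (hU : IsOpen U) {x : Y.carrier} (hx : x ∈ U)
    (W : Y.net) (hxW : x ∈ W.1) : ∃ V : Y.net, x ∈ V.1 ∧ V.1 ⊆ U ∧ V.1 ⊆ W.1 := by
  obtain ⟨V, hV, hVW, hVU, hxV⟩ :=
    Y.net_dense W x hxW U (mem_nhdsWithin_of_mem_nhds (hU.mem_nhds hx))
  exact ⟨⟨V, hV⟩, mem_of_mem_nhdsWithin hxW hxV, hVU, hVW⟩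

namespace Sections

/-- The absolute value of a section may be computed in any affinoid domain. -/
theorem point_val_eq {U : Set Y.carrier} (f : Y.Sections U) (x : Y.carrier) {V W : Y.net}
    (hxV : x ∈ V.1) (hxW : x ∈ W.1) (hV : V.1 ⊆ U) (hW : W.1 ⊆ U) :
    (Y.point V ⟨x, hxV⟩).1 (f.val V hV) = (Y.point W ⟨x, hxW⟩).1 (f.val W hW) := by
  obtain ⟨F, -, hFnet, hF, hn⟩ := Y.net_inter V W x ⟨hxV, hxW⟩
  obtain ⟨Z, hZ, hxZ⟩ := mem_of_mem_nhdsWithin (show x ∈ V.1 ∩ W.1 from ⟨hxV, hxW⟩) hn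
  have hZV : Z ⊆ V.1 := fun _ h => ((hF Z hZ).2 h).1
  have hZW : Z ⊆ W.1 := fun _ h => ((hF Z hZ).2 h).2
  have h1 := Y.point_res (V := ⟨Z, hFnet hZ⟩) (W := V) hZV x hxZ (f.val V hV)
  have h2 := Y.point_res (V := ⟨Z, hFnet hZ⟩) (W := W) hZW x hxZ (f.val W hW)
  rw [f.compat] at h1 h2
  rw [← h1, ← h2]

theorem absAt_eq {U : Set Y.carrier} (f : Y.Sections U) (x : Y.carrier) {V : Y.net}
    (hxV : x ∈ V.1) (hV : V.1 ⊆ U) : f.absAt x = (Y.point V ⟨x, hxV⟩).1 (f.val V hV) := by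
  have h : ∃ V : Y.net, x ∈ V.1 ∧ V.1 ⊆ U := ⟨V, hxV, hV⟩
  rw [absAt, dif_pos h]
  exact f.point_val_eq x _ _ _ _

/-- The members of the net through `x` cover a neighbourhood of `x`; within each of them the
absolute value of a section is an evaluation, which is continuous on the spectrum. -/
theorem continuousAt_absAt {U : Set Y.carrier} (hU : IsOpen U) (f : Y.Sections U) {x : Y.carrier}
    (hx : x ∈ U) : ContinuousAt f.absAt x := by
  obtain ⟨F, hFfin, hFnet, hF, hn⟩ := Y.net_cover x
  rw [ContinuousAt, ← nhdsWithin_eq_nhds.mpr hn, nhdsWithin_sUnion hFfin]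
  refine tendsto_iSup.mpr fun V => tendsto_iSup.mpr fun hV => ?_
  obtain ⟨W, hWnet, hWV, hWU, hxW⟩ := Y.net_dense ⟨V, hFnet hV⟩ x (hF V hV) U
    (mem_nhdsWithin_of_mem_nhds (hU.mem_nhds hx))
  have hcont : ContinuousOn f.absAt W := by
    rw [continuousOn_iff_continuous_domRestrict]
    have h1 : Set.domRestrict W f.absAt = fun y : W =>
        (Y.point ⟨W, hWnet⟩ y).1 (f.val ⟨W, hWnet⟩ hWU) := by
      funext y
      exact f.absAt_eq y.1 (V := ⟨W, hWnet⟩) y.2 hWU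
    rw [h1]
    have h2 : Continuous fun z : BerkovichSpectrum k (Y.Alg ⟨W, hWnet⟩) =>
        (fun f : Y.Alg ⟨W, hWnet⟩ => z.1 f) := continuous_induced_dom
    exact ((continuous_apply (f.val ⟨W, hWnet⟩ hWU)).comp h2).comp (Y.point ⟨W, hWnet⟩).continuous
  exact (hcont x (mem_of_mem_nhdsWithin (hF V hV) hxW)).mono_left (nhdsWithin_le_of_mem hxW)

/-- The restriction of a section to a smaller set. -/
def restrict {U U' : Set Y.carrier} (h : U' ⊆ U) (f : Y.Sections U) : Y.Sections U' where
  val V hV := f.val V (hV.trans h)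
  compat _ _ hVW hW := f.compat _ _ hVW (hW.trans h)

variable {U : Set Y.carrier}

instance : Add (Y.Sections U) where
  add f g :=
    { val := fun V hV => f.val V hV + g.val V hV
      compat := fun V W h hW => by rw [map_add, f.compat, g.compat] }

instance : Mul (Y.Sections U) where
  mul f g :=
    { val := fun V hV => f.val V hV * g.val V hV
      compat := fun V W h hW => by rw [map_mul, f.compat, g.compat] }

variable (U) in
/-- The constant section. -/
def const (c : k) : Y.Sections U where
  val V _ := algebraMap k (Y.Alg V) c
  compat _ _ h _ := (Y.res h).commutes c

theorem add_val (f g : Y.Sections U) (V : Y.net) (hV : V.1 ⊆ U) :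
    (f + g).val V hV = f.val V hV + g.val V hV := rfl

theorem const_val (c : k) (V : Y.net) (hV : V.1 ⊆ U) :
    (const U c : Y.Sections U).val V hV = algebraMap k (Y.Alg V) c := rfl

end Sections

end StrictAnalyticSpace

/-! ### Rational points of a coordinate disk -/

section RationalPoint

open PowerSeries

variable {k : Type u} [NormedField k]

namespace TateAlgebra

/-- Power series in the variables indexed by `Fin 1` as power series in a single variable. -/
noncomputable def toPowerSeries : MvPowerSeries (Fin 1) k ≃ₐ[k] PowerSeries k :=
  MvPowerSeries.renameEquiv k (Equiv.ofUnique (Fin 1) Unit)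

theorem coeff_toPowerSeries (f : MvPowerSeries (Fin 1) k) (n : ℕ) :
    PowerSeries.coeff n (toPowerSeries f) = MvPowerSeries.coeff (Finsupp.single 0 n) f := by
  have h := MvPowerSeries.coeff_embDomain_rename (Equiv.ofUnique (Fin 1) Unit).toEmbedding f
    (Finsupp.single 0 n)
  rw [Finsupp.embDomain_single] at h
  exact h

variable [IsUltrametricDist k]

theorem prod_one_pow (t : Fin 1 →₀ ℕ) : t.prod ((fun _ : Fin 1 => (1 : ℝ)) · ^ ·) = 1 :=
  Finset.prod_eq_one fun _ _ => one_pow _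

theorem eq_single (t : Fin 1 →₀ ℕ) : t = Finsupp.single 0 (t 0) := by
  refine Finsupp.ext fun i => ?_
  rw [Subsingleton.elim i 0, Finsupp.single_eq_same]

theorem tendsto_coeff (f : TateAlgebra k 1) :
    Tendsto (fun n => ‖PowerSeries.coeff n (toPowerSeries f.1)‖) atTop (𝓝 0) := by
  have h : Tendsto (fun t : Fin 1 →₀ ℕ => ‖MvPowerSeries.coeff t f.1‖ *
      t.prod ((fun _ : Fin 1 => (1 : ℝ)) · ^ ·)) cofinite (𝓝 0) := f.2
  rw [← Nat.cofinite_eq_atTop]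
  refine (h.comp (Finsupp.single_injective (0 : Fin 1)).tendsto_cofinite).congr fun n => ?_
  rw [Function.comp_apply, prod_one_pow, mul_one, coeff_toPowerSeries]

theorem norm_coeff_le (f : TateAlgebra k 1) (n : ℕ) :
    ‖PowerSeries.coeff n (toPowerSeries f.1)‖ ≤ tateNorm k f := by
  obtain ⟨M, hM⟩ := (tendsto_coeff f).bddAbove_range
  have hbdd : MvPowerSeries.HasGaussNorm (fun c : k => ‖c‖) (fun _ : Fin 1 => (1 : ℝ)) f.1 := by
    refine ⟨M, ?_⟩
    rintro _ ⟨t, rfl⟩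
    refine le_of_eq_of_le ?_ (hM ⟨t 0, rfl⟩)
    change ‖_‖ * t.prod ((fun _ : Fin 1 => (1 : ℝ)) · ^ ·) = ‖_‖
    rw [prod_one_pow, mul_one, coeff_toPowerSeries, ← eq_single]
  have h := MvPowerSeries.le_gaussNorm _ _ f.1 hbdd (Finsupp.single 0 n)
  rw [prod_one_pow, mul_one, ← coeff_toPowerSeries] at h
  exact h

theorem mem_of_tendsto {f : MvPowerSeries (Fin 1) k}
    (h : Tendsto (fun n => ‖PowerSeries.coeff n (toPowerSeries f)‖) atTop (𝓝 0)) :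
    f ∈ TateAlgebra k 1 := by
  change Tendsto (fun t : Fin 1 →₀ ℕ => ‖MvPowerSeries.coeff t f‖ *
      t.prod ((fun _ : Fin 1 => (1 : ℝ)) · ^ ·)) cofinite (𝓝 0)
  rw [← Nat.cofinite_eq_atTop] at h
  have hinj : Function.Injective fun t : Fin 1 →₀ ℕ => t 0 := fun t t' htt => by
    rw [eq_single t, eq_single t', show t 0 = t' 0 from htt]
  refine (h.comp hinj.tendsto_cofinite).congr fun t => ?_
  rw [Function.comp_apply, prod_one_pow, mul_one, coeff_toPowerSeries, ← eq_single]

end TateAlgebra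

variable [IsUltrametricDist k]

namespace ClosedDiskAlgebra

theorem mem_iff {s : ℝ} {f : PowerSeries k} :
    f ∈ ClosedDiskAlgebra k s ↔
      Tendsto (fun n => ‖PowerSeries.coeff n f‖ * s ^ n) atTop (𝓝 0) :=
  PowerSeries.isRestricted_iff' _ _

theorem mem_of_convergesOnDisk {s : ℝ} (hs0 : 0 ≤ s) (hs1 : s < 1) {f : PowerSeries k}
    (hf : ConvergesOnDisk 1 f) : f ∈ ClosedDiskAlgebra k s := hf s hs0 hs1

/-- The presentation `k⟨S⟩ → k⟨T / |a|⟩`, `S ↦ T / a`. -/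
noncomputable def presentation {a : k} (ha : a ≠ 0) :
    TateAlgebra k 1 →ₐ[k] ClosedDiskAlgebra k ‖a‖ :=
  (((PowerSeries.rescaleAlgHom a⁻¹).comp TateAlgebra.toPowerSeries.toAlgHom).comp
    (TateAlgebra k 1).val).codRestrict _ fun f => by
      have h : (((PowerSeries.rescaleAlgHom a⁻¹).comp TateAlgebra.toPowerSeries.toAlgHom).comp
          (TateAlgebra k 1).val) f = PowerSeries.rescale a⁻¹ (TateAlgebra.toPowerSeries f.1) := by
        rw [← PowerSeries.coe_rescaleAlgHom]
        rfl
      rw [h, mem_iff]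
      refine (TateAlgebra.tendsto_coeff f).congr fun n => ?_
      rw [PowerSeries.coeff_rescale, norm_mul, norm_pow, norm_inv, mul_right_comm, ← mul_pow,
        inv_mul_cancel₀ (norm_ne_zero_iff.mpr ha), one_pow, one_mul]

theorem presentation_val {a : k} (ha : a ≠ 0) (f : TateAlgebra k 1) :
    (presentation ha f).1 = PowerSeries.rescale a⁻¹ (TateAlgebra.toPowerSeries f.1) := by
  rw [← PowerSeries.coe_rescaleAlgHom]
  rfl

theorem presentation_surjective {a : k} (ha : a ≠ 0) :
    Function.Surjective (presentation ha) := by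
  intro g
  have hmem : TateAlgebra.toPowerSeries.symm (PowerSeries.rescale a g.1) ∈ TateAlgebra k 1 := by
    refine TateAlgebra.mem_of_tendsto ((mem_iff.mp g.2).congr fun n => ?_)
    rw [AlgEquiv.apply_symm_apply, PowerSeries.coeff_rescale, norm_mul, norm_pow, mul_comm]
  refine ⟨⟨_, hmem⟩, Subtype.ext ?_⟩
  rw [presentation_val, AlgEquiv.apply_symm_apply, PowerSeries.rescale_rescale, mul_inv_cancel₀ ha]
  ext n
  rw [PowerSeries.coeff_rescale, one_pow, one_mul]

variable [CompleteSpace k]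

/-- Evaluation of functions on the closed disk of radius `|a|` at the point `a`. -/
noncomputable def eval (a : k) : ClosedDiskAlgebra k ‖a‖ →ₐ[k] k where
  toFun f := evalAt a f.1
  map_one' := by
    have h := evalAt_C a (1 : k)
    rwa [map_one] at h
  map_mul' f g := evalAt_mul f.2 g.2 le_rfl
  map_zero' := by
    have h := evalAt_C a (0 : k)
    rwa [map_zero] at h
  map_add' f g := evalAt_add f.2 g.2 le_rfl
  commutes' c := evalAt_C a c

theorem eval_apply (a : k) (f : ClosedDiskAlgebra k ‖a‖) : eval a f = evalAt a f.1 := rfl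

theorem norm_eval_presentation_le {a : k} (ha : a ≠ 0) (f : TateAlgebra k 1) :
    ‖eval a (presentation ha f)‖ ≤ tateNorm k f := by
  rw [eval_apply, presentation_val]
  refine norm_evalAt_le le_rfl fun n => ?_
  rw [PowerSeries.coeff_rescale, norm_mul, norm_pow, norm_inv, mul_right_comm, ← mul_pow,
    inv_mul_cancel₀ (norm_ne_zero_iff.mpr ha), one_pow, one_mul]
  exact TateAlgebra.norm_coeff_le f n

end ClosedDiskAlgebra

/-- The multiplicative seminorm `f ↦ |ψ(f)|` of a character `ψ`. -/
def characterSeminorm {A : Type u} [CommRing A] (ψ : A →+* k) : MulRingSeminorm A where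
  toFun f := ‖ψ f‖
  map_zero' := by rw [map_zero, norm_zero]
  add_le' f g := by rw [map_add]; exact norm_add_le _ _
  neg' f := by rw [map_neg, norm_neg]
  map_one' := by rw [map_one, norm_one]
  map_mul' f g := by rw [map_mul, norm_mul]

namespace CoordinateDisk

open StrictAnalyticSpace

variable [CompleteSpace k] {Y : StrictAnalyticSpace k} (D : CoordinateDisk Y)

/-- The point `T = a` of the spectrum of the algebra of the closed disk `|T| ≤ |a|`. -/
noncomputable def spectrumPoint (a : k) (h0 : a ≠ 0) (h1 : ‖a‖ < 1) :
    BerkovichSpectrum k (Y.Alg (D.closedDisk a h0 h1)) :=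
  ⟨characterSeminorm ((ClosedDiskAlgebra.eval a).comp
      (D.equiv a h0 h1).symm.toAlgHom : Y.Alg (D.closedDisk a h0 h1) →ₐ[k] k).toRingHom, by
    refine ⟨fun c => congrArg norm (AlgHom.commutes ((ClosedDiskAlgebra.eval a).comp
      (D.equiv a h0 h1).symm.toAlgHom : Y.Alg (D.closedDisk a h0 h1) →ₐ[k] k) c), 1,
      (D.equiv a h0 h1).toAlgHom.comp (ClosedDiskAlgebra.presentation h0),
      (D.equiv a h0 h1).surjective.comp (ClosedDiskAlgebra.presentation_surjective h0),
      fun f => ?_⟩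
    change ‖ClosedDiskAlgebra.eval a ((D.equiv a h0 h1).symm
      (D.equiv a h0 h1 (ClosedDiskAlgebra.presentation h0 f)))‖ ≤ _
    rw [AlgEquiv.symm_apply_apply]
    exact ClosedDiskAlgebra.norm_eval_presentation_le h0 f⟩

open scoped Classical in
/-- The point `T = a` of the disk, for `0 < |a| < 1`; elsewhere the junk value `ζ`. -/
noncomputable def rationalPoint (ζ : Y.carrier) (a : k) : Y.carrier :=
  if h : a ≠ 0 ∧ ‖a‖ < 1 then
    ((Y.point (D.closedDisk a h.1 h.2)).symm (D.spectrumPoint a h.1 h.2)).1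
  else ζ

variable (ζ : Y.carrier)

theorem rationalPoint_mem_closedDisk {a : k} (h0 : a ≠ 0) (h1 : ‖a‖ < 1) :
    D.rationalPoint ζ a ∈ (D.closedDisk a h0 h1).1 := by
  rw [rationalPoint, dif_pos ⟨h0, h1⟩]
  exact ((Y.point (D.closedDisk a h0 h1)).symm (D.spectrumPoint a h0 h1)).2

theorem point_rationalPoint {a : k} (h0 : a ≠ 0) (h1 : ‖a‖ < 1)
    (f : PowerSeries k) (hf : f ∈ ClosedDiskAlgebra k ‖a‖) :
    (Y.point (D.closedDisk a h0 h1) ⟨_, D.rationalPoint_mem_closedDisk ζ h0 h1⟩).1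
      (D.equiv a h0 h1 ⟨f, hf⟩) = ‖evalAt a f‖ := by
  have h : Y.point (D.closedDisk a h0 h1) ⟨_, D.rationalPoint_mem_closedDisk ζ h0 h1⟩ =
      D.spectrumPoint a h0 h1 := by
    rw [← (Y.point (D.closedDisk a h0 h1)).apply_symm_apply (D.spectrumPoint a h0 h1)]
    congr 1
    refine Subtype.ext ?_
    change D.rationalPoint ζ a = _
    rw [rationalPoint, dif_pos ⟨h0, h1⟩]
  rw [h]
  change ‖ClosedDiskAlgebra.eval a ((D.equiv a h0 h1).symm (D.equiv a h0 h1 ⟨f, hf⟩))‖ = _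
  rw [AlgEquiv.symm_apply_apply]
  rfl

theorem rationalPoint_mem {a : k} (h0 : a ≠ 0) (h1 : ‖a‖ < 1) : D.rationalPoint ζ a ∈ D.carrier :=
  (D.rationalPoint_mem_closedDisk ζ h0 h1).1

theorem absAt_T_rationalPoint {a : k} (h0 : a ≠ 0) (h1 : ‖a‖ < 1) :
    D.T.absAt (D.rationalPoint ζ a) = ‖a‖ := by
  rw [D.T.absAt_eq _ (V := D.closedDisk a h0 h1) (D.rationalPoint_mem_closedDisk ζ h0 h1)
    fun _ hx => D.closure_subset (subset_closure hx.1)]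
  have h := D.point_rationalPoint ζ h0 h1 _ (ClosedDiskAlgebra.X k ‖a‖).2
  have h2 := D.equiv_X a h0 h1
  rw [show (⟨_, (ClosedDiskAlgebra.X k ‖a‖).2⟩ : ClosedDiskAlgebra k ‖a‖) =
    ClosedDiskAlgebra.X k ‖a‖ from rfl, h2] at h
  refine h.trans ?_
  exact congrArg norm (evalAt_X a)

/-- The rational points with `|a| → 1` leave every compact part of the disk, and the closure of
the disk is compact, so they accumulate at the boundary, which is a single point. -/
theorem tendsto_rationalPoint (hζ : frontier D.carrier = {ζ}) (d : PowerSeries k) :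
    Tendsto (D.rationalPoint ζ) (nearBoundary d) (𝓝 ζ) := by
  have hev : ∀ s < (1 : ℝ), ∀ᶠ a in nearBoundary d, s < ‖a‖ ∧ ‖a‖ < 1 ∧ a ≠ 0 := by
    intro s hs
    refine eventually_nearBoundary.mpr ⟨max s 0, max_lt hs one_pos, fun b hb hb1 _ => ?_⟩
    exact ⟨(le_max_left _ _).trans_lt hb, hb1, norm_pos_iff.mp ((le_max_right _ _).trans_lt hb)⟩
  refine D.isCompact_closure.le_nhds_of_unique_clusterPt ?_ fun x hx hcl => ?_
  · refine mem_map.mpr ?_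
    filter_upwards [hev 0 one_pos] with a ha
    exact subset_closure (D.rationalPoint_mem ζ ha.2.2 ha.2.1)
  · by_contra hne
    have hxD : x ∈ D.carrier := by
      by_contra hxD
      have : x ∈ frontier D.carrier := by
        rw [D.isOpen_carrier.frontier_eq]
        exact ⟨hx, hxD⟩
      rw [hζ] at this
      exact hne this
    obtain ⟨s, hxs, hs⟩ := exists_between (D.abs_lt_one x hxD)
    have hcont := D.T.continuousAt_absAt D.isOpen_domain (D.closure_subset hx)
    have h1 := hcont.eventually_lt_const hxs
    refine hcl.frequently h1 (eventually_map.mpr ?_)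
    filter_upwards [hev s hs] with a ha
    rw [D.absAt_T_rationalPoint ζ ha.2.2 ha.2.1]
    exact not_lt.mpr ha.1.le

theorem mem_closure_annulus [Fact (∃ c : k, c ≠ 0 ∧ ‖c‖ < 1)] [IsAlgClosed k]
    (hζ : frontier D.carrier = {ζ}) {r : ℝ} (hr1 : r < 1) : ζ ∈ closure (D.annulus r) := by
  have hone : ∀ b : k, evalAt b (1 : PowerSeries k) = 1 := fun b => by
    have h := evalAt_C b (1 : k)
    rwa [map_one] at h
  have hne : (nearBoundary (1 : PowerSeries k)).NeBot := by
    rw [neBot_iff]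
    intro hbot
    have h : ∀ᶠ b in nearBoundary (1 : PowerSeries k), False := by rw [hbot]; exact eventually_bot
    obtain ⟨s, hs, h⟩ := eventually_nearBoundary.mp h
    obtain ⟨b, hb, hb1⟩ := unitDisk.exists_norm_between (k := k) hs one_pos le_rfl
    exact h b hb hb1 (by rw [hone]; exact one_ne_zero)
  refine mem_closure_of_tendsto (D.tendsto_rationalPoint ζ hζ 1) ?_
  refine eventually_nearBoundary.mpr ⟨max r 0, max_lt hr1 one_pos, fun b hb hb1 _ => ?_⟩
  have hb0 : b ≠ 0 := norm_pos_iff.mp ((le_max_right _ _).trans_lt hb)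
  refine ⟨D.rationalPoint_mem ζ hb0 hb1, ?_⟩
  rw [D.absAt_T_rationalPoint ζ hb0 hb1]
  exact (le_max_left _ _).trans_lt hb

end CoordinateDisk

end RationalPoint

/-! ### Values at a boundary point as limits -/

section LimitValue

open StrictAnalyticSpace

variable {k : Type u} [NormedField k] [IsUltrametricDist k] {Y : StrictAnalyticSpace k}

namespace StrictAnalyticSpace

/-- The constants in the completed residue field of a point. -/
noncomputable def constValue (ζ : Y.carrier) : k →+* ResidueFieldAt ζ :=
  (seminormAt ζ).toCompletion.comp
    ((algebraMap (Y.Alg (chart ζ)) _).comp (algebraMap k (Y.Alg (chart ζ))))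

theorem fracValue_algebraMap_one (ζ : Y.carrier) (c : k) :
    (seminormAt ζ).fracValue (algebraMap k _ c) 1 = constValue ζ c := by
  rw [MulRingSeminorm.fracValue_eq, map_one, map_one, div_one]
  rfl

theorem point_res_chart {ζ : Y.carrier} {V : Y.net} (hζ : ζ ∈ V.1) (hV : V.1 ⊆ (chart ζ).1)
    (b : Y.Alg (chart ζ)) : (Y.point V ⟨ζ, hζ⟩).1 (Y.res hV b) = seminormAt ζ b :=
  Y.point_res hV ζ hζ b

theorem point_algebraMap (V : Y.net) (x : V.1) (c : k) :
    (Y.point V x).1 (algebraMap k _ c) = ‖c‖ := (Y.point V x).2.1 c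

/-- Points `pt a` tend to `ζ` along the filter `l`. The function `φ` with values in `k` has the
limit value `v ∈ ℋ(ζ)` if it is approximated arbitrarily well by the values at the points `pt a`
of a section defined near `ζ` whose value at `ζ` is close to `v`. This is the relation between the
values of an analytic element at rational points and its value at the boundary point; unlike the
analytic elements it can be manipulated without reference to functions on the disk. -/
def HasLimitValue {α : Type*} (l : Filter α) (pt : α → Y.carrier) (ζ : Y.carrier) (φ : α → k)
    (v : ResidueFieldAt ζ) : Prop :=
  ∀ ε > 0, ∃ (U : Set Y.carrier) (f : Y.Sections U), IsOpen U ∧ ζ ∈ U ∧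
    (∀ᶠ a in l, ∀ (V : Y.net) (hV : pt a ∈ V.1) (hU : V.1 ⊆ U),
      (Y.point V ⟨pt a, hV⟩).1 (f.val V hU - algebraMap k _ (φ a)) ≤ ε) ∧
    ∃ a b : Y.Alg (chart ζ), seminormAt ζ b ≠ 0 ∧
      (∀ (V : Y.net) (hζ : ζ ∈ V.1) (hU : V.1 ⊆ U) (hV : V.1 ⊆ (chart ζ).1),
        (Y.point V ⟨ζ, hζ⟩).1 (Y.res hV b * f.val V hU - Y.res hV a) ≤ ε * seminormAt ζ b) ∧
      ‖(seminormAt ζ).fracValue a b - v‖ ≤ ε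

/-- A function of an affinoid algebra as a section over the affinoid domain. -/
def Sections.ofAlg {W : Y.net} (b : Y.Alg W) : Y.Sections W.1 where
  val _ hV := Y.res hV b
  compat _ _ h hW := Y.res_res h hW b

/-- The inequality in the definition of the value of a section need only be checked in one affinoid
domain. -/
theorem Sections.point_frac_eq {U : Set Y.carrier} (f : Y.Sections U) {ζ : Y.carrier}
    (a b : Y.Alg (chart ζ)) {V W : Y.net} (hζV : ζ ∈ V.1) (hζW : ζ ∈ W.1) (hVU : V.1 ⊆ U)
    (hWU : W.1 ⊆ U) (hV : V.1 ⊆ (chart ζ).1) (hW : W.1 ⊆ (chart ζ).1) :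
    (Y.point V ⟨ζ, hζV⟩).1 (Y.res hV b * f.val V hVU - Y.res hV a) =
      (Y.point W ⟨ζ, hζW⟩).1 (Y.res hW b * f.val W hWU - Y.res hW a) := by
  have h := (((Sections.ofAlg b).restrict Set.inter_subset_right) *
    f.restrict Set.inter_subset_left + ((Sections.ofAlg (-a)).restrict Set.inter_subset_right) :
      Y.Sections (U ∩ (chart ζ).1)).point_val_eq ζ hζV hζW (Set.subset_inter hVU hV)
      (Set.subset_inter hWU hW)
  have hval : ∀ (Z : Y.net) (hZU : Z.1 ⊆ U) (hZ : Z.1 ⊆ (chart ζ).1),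
      (((Sections.ofAlg b).restrict Set.inter_subset_right) *
        f.restrict Set.inter_subset_left + ((Sections.ofAlg (-a)).restrict Set.inter_subset_right) :
      Y.Sections (U ∩ (chart ζ).1)).val Z (Set.subset_inter hZU hZ) =
      Y.res hZ b * f.val Z hZU - Y.res hZ a := by
    intro Z hZU hZ
    change Y.res hZ b * f.val Z hZU + Y.res hZ (-a) = _
    rw [map_neg, sub_eq_add_neg]
  rw [hval V hVU hV, hval W hWU hW] at h
  exact h

namespace HasLimitValue

variable {α : Type*} {l : Filter α} {pt : α → Y.carrier} {ζ : Y.carrier} {φ ψ : α → k}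
  {v w : ResidueFieldAt ζ}

theorem const (c : k) : HasLimitValue l pt ζ (fun _ => c) (constValue ζ c) := by
  intro ε hε
  refine ⟨Set.univ, Sections.const _ c, isOpen_univ, Set.mem_univ _, Eventually.of_forall ?_,
    algebraMap k _ c, 1, ?_, ?_, ?_⟩
  · intro a V hV hU
    rw [Sections.const_val, sub_self, map_zero]
    exact hε.le
  · rw [map_one]
    exact one_ne_zero
  · intro V hζ hU hV
    rw [Sections.const_val, map_one, one_mul, AlgHom.commutes, sub_self, map_zero, map_one, mul_one]
    exact hε.le
  · rw [fracValue_algebraMap_one, sub_self, norm_zero]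
    exact hε.le

theorem add (hφ : HasLimitValue l pt ζ φ v) (hψ : HasLimitValue l pt ζ ψ w) :
    HasLimitValue l pt ζ (fun a => φ a + ψ a) (v + w) := by
  intro ε hε
  obtain ⟨U₁, f₁, hU₁, hζ₁, hev₁, a₁, b₁, hb₁, hval₁, hv₁⟩ := hφ (ε / 2) (half_pos hε)
  obtain ⟨U₂, f₂, hU₂, hζ₂, hev₂, a₂, b₂, hb₂, hval₂, hv₂⟩ := hψ (ε / 2) (half_pos hε)
  refine ⟨U₁ ∩ U₂, f₁.restrict Set.inter_subset_left + f₂.restrict Set.inter_subset_right,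
    hU₁.inter hU₂, ⟨hζ₁, hζ₂⟩, ?_, a₁ * b₂ + a₂ * b₁, b₁ * b₂, ?_, ?_, ?_⟩
  · filter_upwards [hev₁, hev₂] with a h₁ h₂ V hV hU
    have e₁ := h₁ V hV (hU.trans Set.inter_subset_left)
    have e₂ := h₂ V hV (hU.trans Set.inter_subset_right)
    have h3 := map_add_le_add (Y.point V ⟨pt a, hV⟩).1
      (f₁.val V (hU.trans Set.inter_subset_left) - algebraMap k _ (φ a))
      (f₂.val V (hU.trans Set.inter_subset_right) - algebraMap k _ (ψ a))
    rw [sub_add_sub_comm, ← map_add] at h3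
    exact h3.trans ((add_le_add e₁ e₂).trans_eq (add_halves ε))
  · rw [map_mul]
    exact mul_ne_zero hb₁ hb₂
  · intro V hζ hU hV
    have e₁ := hval₁ V hζ (hU.trans Set.inter_subset_left) hV
    have e₂ := hval₂ V hζ (hU.trans Set.inter_subset_right) hV
    set F₁ := f₁.val V (hU.trans Set.inter_subset_left)
    set F₂ := f₂.val V (hU.trans Set.inter_subset_right)
    set P := (Y.point V ⟨ζ, hζ⟩).1
    have h3 := map_add_le_add P (Y.res hV b₂ * (Y.res hV b₁ * F₁ - Y.res hV a₁))
      (Y.res hV b₁ * (Y.res hV b₂ * F₂ - Y.res hV a₂))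
    rw [map_mul, map_mul, point_res_chart, point_res_chart] at h3
    have h4 : Y.res hV (b₁ * b₂) * (F₁ + F₂) - Y.res hV (a₁ * b₂ + a₂ * b₁) =
        Y.res hV b₂ * (Y.res hV b₁ * F₁ - Y.res hV a₁) +
          Y.res hV b₁ * (Y.res hV b₂ * F₂ - Y.res hV a₂) := by
      simp only [map_mul, map_add]
      ring
    change P (Y.res hV (b₁ * b₂) * (F₁ + F₂) - Y.res hV (a₁ * b₂ + a₂ * b₁)) ≤ _
    rw [h4, map_mul]
    refine h3.trans ((add_le_add (mul_le_mul_of_nonneg_left e₁ (apply_nonneg _ _))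
      (mul_le_mul_of_nonneg_left e₂ (apply_nonneg _ _))).trans_eq ?_)
    ring
  · rw [MulRingSeminorm.fracValue_add _ _ _ hb₁ hb₂, add_sub_add_comm]
    exact (norm_add_le _ _).trans ((add_le_add hv₁ hv₂).trans_eq (add_halves ε))

/-- A section whose value at `ζ` is close to `v` has an absolute value close to `|v|` at the points
near `ζ`. -/
theorem eventually_absAt_lt (hpt : Tendsto pt l (𝓝 ζ)) {U : Set Y.carrier} (hU : IsOpen U)
    (hζU : ζ ∈ U) (f : Y.Sections U) {δ : ℝ} (hδ : 0 < δ) {a b : Y.Alg (chart ζ)}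
    (hb : seminormAt ζ b ≠ 0)
    (hval : ∀ (V : Y.net) (hζ : ζ ∈ V.1) (hU : V.1 ⊆ U) (hV : V.1 ⊆ (chart ζ).1),
      (Y.point V ⟨ζ, hζ⟩).1 (Y.res hV b * f.val V hU - Y.res hV a) ≤ δ * seminormAt ζ b)
    (hv : ‖(seminormAt ζ).fracValue a b - v‖ ≤ δ) :
    f.absAt ζ < ‖v‖ + 3 * δ ∧ ∀ᶠ a in l, pt a ∈ U ∧ f.absAt (pt a) < ‖v‖ + 3 * δ := by
  have hbpos : 0 < seminormAt ζ b := lt_of_le_of_ne (apply_nonneg _ _) hb.symm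
  have hζ : f.absAt ζ < ‖v‖ + 3 * δ := by
    obtain ⟨V, hζV, hVU, hV⟩ := exists_net_subset hU hζU (chart ζ) (mem_chart ζ)
    rw [f.absAt_eq ζ hζV hVU]
    have h1 := hval V hζV hVU hV
    have h2 := map_add_le_add (Y.point V ⟨ζ, hζV⟩).1
      (Y.res hV b * f.val V hVU - Y.res hV a) (Y.res hV a)
    rw [sub_add_cancel, map_mul, point_res_chart, point_res_chart] at h2
    have h3 : seminormAt ζ a ≤ (‖v‖ + δ) * seminormAt ζ b := by
      rw [← div_le_iff₀ hbpos, ← MulRingSeminorm.norm_fracValue _ a hb]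
      have := norm_add_le v ((seminormAt ζ).fracValue a b - v)
      rw [add_sub_cancel] at this
      linarith
    have h4 : seminormAt ζ b * (Y.point V ⟨ζ, hζV⟩).1 (f.val V hVU) ≤
        seminormAt ζ b * (‖v‖ + 2 * δ) := by linarith
    linarith [le_of_mul_le_mul_left h4 hbpos]
  refine ⟨hζ, ?_⟩
  filter_upwards [hpt.eventually (hU.mem_nhds hζU),
    ((f.continuousAt_absAt hU hζU).tendsto.comp hpt).eventually_lt_const hζ] with a h1 h2
  exact ⟨h1, h2⟩

theorem mul (hpt : Tendsto pt l (𝓝 ζ)) (hφ : HasLimitValue l pt ζ φ v)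
    (hψ : HasLimitValue l pt ζ ψ w) : HasLimitValue l pt ζ (fun a => φ a * ψ a) (v * w) := by
  intro ε hε
  have hv0 := norm_nonneg v
  have hw0 := norm_nonneg w
  obtain ⟨δ, hδ, hδ1, hδε⟩ : ∃ δ : ℝ, 0 < δ ∧ δ ≤ 1 ∧ (‖v‖ + ‖w‖ + 7) * δ ≤ ε := by
    have hC : 0 < ‖v‖ + ‖w‖ + 7 := by positivity
    refine ⟨min 1 (ε / (‖v‖ + ‖w‖ + 7)), lt_min one_pos (div_pos hε hC), min_le_left _ _, ?_⟩
    rw [mul_comm, ← le_div_iff₀ hC]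
    exact min_le_right _ _
  obtain ⟨U₁, f₁, hU₁, hζ₁, hev₁, a₁, b₁, hb₁, hval₁, hv₁⟩ := hφ δ hδ
  obtain ⟨U₂, f₂, hU₂, hζ₂, hev₂, a₂, b₂, hb₂, hval₂, hv₂⟩ := hψ δ hδ
  obtain ⟨hf₁, hlt₁⟩ := eventually_absAt_lt hpt hU₁ hζ₁ f₁ hδ hb₁ hval₁ hv₁
  obtain ⟨-, hlt₂⟩ := eventually_absAt_lt hpt hU₂ hζ₂ f₂ hδ hb₂ hval₂ hv₂
  refine ⟨U₁ ∩ U₂, f₁.restrict Set.inter_subset_left * f₂.restrict Set.inter_subset_right,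
    hU₁.inter hU₂, ⟨hζ₁, hζ₂⟩, ?_, a₁ * a₂, b₁ * b₂, ?_, ?_, ?_⟩
  · filter_upwards [hev₁, hev₂, hlt₁, hlt₂] with a h₁ h₂ h₃ h₄ V hV hU
    have e₁ := h₁ V hV (hU.trans Set.inter_subset_left)
    have e₂ := h₂ V hV (hU.trans Set.inter_subset_right)
    have e₃ := h₃.2
    have e₄ := h₄.2
    rw [f₁.absAt_eq _ hV (hU.trans Set.inter_subset_left)] at e₃
    rw [f₂.absAt_eq _ hV (hU.trans Set.inter_subset_right)] at e₄
    set F₁ := f₁.val V (hU.trans Set.inter_subset_left)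
    set F₂ := f₂.val V (hU.trans Set.inter_subset_right)
    set P := (Y.point V ⟨pt a, hV⟩).1 with hP
    have h5 : P (algebraMap k _ (ψ a)) ≤ ‖w‖ + 4 := by
      have := map_sub_le_add P F₂ (F₂ - algebraMap k _ (ψ a))
      rw [sub_sub_cancel] at this
      linarith
    have h6 := P.map_mul_sub_mul_le F₁ F₂ (algebraMap k _ (φ a)) (algebraMap k _ (ψ a))
    change P (F₁ * F₂ - algebraMap k _ (φ a * ψ a)) ≤ ε
    rw [map_mul]
    have h7 : P F₁ * P (F₂ - algebraMap k _ (ψ a)) ≤ (‖v‖ + 3) * δ :=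
      mul_le_mul (by linarith) e₂ (apply_nonneg _ _) (by positivity)
    have h8 : P (algebraMap k _ (ψ a)) * P (F₁ - algebraMap k _ (φ a)) ≤ (‖w‖ + 4) * δ :=
      mul_le_mul h5 e₁ (apply_nonneg _ _) (by positivity)
    linarith
  · rw [map_mul]
    exact mul_ne_zero hb₁ hb₂
  · intro V hζ hU hV
    have e₁ := hval₁ V hζ (hU.trans Set.inter_subset_left) hV
    have e₂ := hval₂ V hζ (hU.trans Set.inter_subset_right) hV
    rw [f₁.absAt_eq _ hζ (hU.trans Set.inter_subset_left)] at hf₁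
    set F₁ := f₁.val V (hU.trans Set.inter_subset_left)
    set F₂ := f₂.val V (hU.trans Set.inter_subset_right)
    set P := (Y.point V ⟨ζ, hζ⟩).1 with hP
    have hB₁ : 0 ≤ seminormAt ζ b₁ := apply_nonneg _ _
    have hB₂ : 0 ≤ seminormAt ζ b₂ := apply_nonneg _ _
    have hB₂' : 0 < seminormAt ζ b₂ := lt_of_le_of_ne hB₂ hb₂.symm
    have h3 : P (Y.res hV a₂) ≤ (‖w‖ + 1) * seminormAt ζ b₂ := by
      rw [point_res_chart, ← div_le_iff₀ hB₂', ← MulRingSeminorm.norm_fracValue _ a₂ hb₂]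
      have := norm_add_le w ((seminormAt ζ).fracValue a₂ b₂ - w)
      rw [add_sub_cancel] at this
      linarith
    have h6 := P.map_mul_sub_mul_le (Y.res hV b₁ * F₁) (Y.res hV b₂ * F₂) (Y.res hV a₁)
      (Y.res hV a₂)
    rw [map_mul P (Y.res hV b₁), point_res_chart] at h6
    have h4 : Y.res hV (b₁ * b₂) * (F₁ * F₂) - Y.res hV (a₁ * a₂) =
        Y.res hV b₁ * F₁ * (Y.res hV b₂ * F₂) - Y.res hV a₁ * Y.res hV a₂ := by
      simp only [map_mul]
      ring
    change P (Y.res hV (b₁ * b₂) * (F₁ * F₂) - Y.res hV (a₁ * a₂)) ≤ _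
    rw [h4, map_mul]
    have h7 : seminormAt ζ b₁ * P F₁ * P (Y.res hV b₂ * F₂ - Y.res hV a₂) ≤
        seminormAt ζ b₁ * (‖v‖ + 3) * (δ * seminormAt ζ b₂) :=
      mul_le_mul (mul_le_mul_of_nonneg_left (by linarith) hB₁) e₂ (apply_nonneg _ _) (by positivity)
    have h8 : P (Y.res hV a₂) * P (Y.res hV b₁ * F₁ - Y.res hV a₁) ≤
        (‖w‖ + 1) * seminormAt ζ b₂ * (δ * seminormAt ζ b₁) :=
      mul_le_mul h3 e₁ (apply_nonneg _ _) (by positivity)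
    refine h6.trans ((add_le_add h7 h8).trans ?_)
    have h9 : (‖v‖ + ‖w‖ + 4) * δ ≤ ε := by nlinarith
    have h10 := mul_le_mul_of_nonneg_right h9 (mul_nonneg hB₁ hB₂)
    linarith
  · rw [MulRingSeminorm.fracValue_mul]
    set x₁ := (seminormAt ζ).fracValue a₁ b₁
    set x₂ := (seminormAt ζ).fracValue a₂ b₂
    have h1 : x₁ * x₂ - v * w = (x₁ - v) * x₂ + v * (x₂ - w) := by ring
    have h2 : ‖x₂‖ ≤ ‖w‖ + 1 := by
      have := norm_add_le w (x₂ - w)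
      rw [add_sub_cancel] at this
      linarith
    rw [h1]
    refine (norm_add_le _ _).trans ?_
    rw [norm_mul, norm_mul]
    have h3 : ‖x₁ - v‖ * ‖x₂‖ ≤ δ * (‖w‖ + 1) := mul_le_mul hv₁ h2 (norm_nonneg _) hδ.le
    have h4 : ‖v‖ * ‖x₂ - w‖ ≤ ‖v‖ * δ := mul_le_mul_of_nonneg_left hv₂ hv0
    nlinarith

theorem sum {σ : Type*} {φ : σ → α → k} {v : σ → ResidueFieldAt ζ} (t : Finset σ)
    (h : ∀ i ∈ t, HasLimitValue l pt ζ (φ i) (v i)) :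
    HasLimitValue l pt ζ (fun a => ∑ i ∈ t, φ i a) (∑ i ∈ t, v i) := by
  classical
  induction t using Finset.induction_on with
  | empty =>
    have h0 := const (l := l) (pt := pt) (ζ := ζ) (0 : k)
    rw [map_zero] at h0
    exact h0
  | insert i t hi ih =>
    simp only [Finset.sum_insert hi]
    exact (h i (Finset.mem_insert_self i t)).add
      (ih fun j hj => h j (Finset.mem_insert_of_mem hj))

/-- The coefficients of the fundamental matrix are polynomials in the coefficients of the system. -/
theorem fundamentalCoeff {ι : Type*} [Fintype ι] [DecidableEq ι] (hpt : Tendsto pt l (𝓝 ζ))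
    {γ : α → ℕ → Matrix ι ι k} {Γ : ℕ → Matrix ι ι (ResidueFieldAt ζ)}
    (h : ∀ m i j, HasLimitValue l pt ζ (fun a => γ a m i j) (Γ m i j)) (m : ℕ) (i j : ι) :
    HasLimitValue l pt ζ (fun a => _root_.fundamentalCoeff (γ a) m i j)
      (_root_.fundamentalCoeff Γ m i j) := by
  induction m using Nat.strong_induction_on generalizing i j with
  | _ m ih =>
    cases m with
    | zero =>
      simp only [fundamentalCoeff_zero]
      have h1 := const (l := l) (pt := pt) (ζ := ζ) ((1 : Matrix ι ι k) i j)
      have h2 : constValue ζ ((1 : Matrix ι ι k) i j) =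
          (1 : Matrix ι ι (ResidueFieldAt ζ)) i j := by
        rw [Matrix.one_apply, Matrix.one_apply]
        split_ifs
        · exact map_one _
        · exact map_zero _
      rw [h2] at h1
      exact h1
    | succ m =>
      simp only [fundamentalCoeff_succ, Matrix.smul_apply, Matrix.sum_apply, Matrix.mul_apply,
        smul_eq_mul]
      have h1 := const (l := l) (pt := pt) (ζ := ζ) ((m + 1 : k)⁻¹)
      rw [map_inv₀, map_add, map_natCast, map_one] at h1
      refine h1.mul hpt (sum _ fun s hs => sum _ fun a _ => (h _ i a).mul hpt
        (ih s (Finset.mem_range.mp hs) a j))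

theorem eventually_norm_le (hpt : Tendsto pt l (𝓝 ζ)) (hφ : HasLimitValue l pt ζ φ v) {ε : ℝ}
    (hε : 0 < ε) : ∀ᶠ a in l, ‖φ a‖ ≤ ‖v‖ + ε := by
  obtain ⟨U, f, hU, hζ, hev, a, b, hb, hval, hv⟩ := hφ (ε / 4) (by positivity)
  obtain ⟨-, hlt⟩ := eventually_absAt_lt hpt hU hζ f (by positivity) hb hval hv
  filter_upwards [hev, hlt] with z h1 h2
  obtain ⟨V, hzV, hVU, -⟩ := exists_net_subset hU h2.1 (chart (pt z)) (mem_chart _)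
  have h3 := h1 V hzV hVU
  have h4 := h2.2
  rw [f.absAt_eq _ hzV hVU] at h4
  have h5 := map_sub_le_add (Y.point V ⟨pt z, hzV⟩).1 (f.val V hVU)
    (f.val V hVU - algebraMap k _ (φ z))
  rw [sub_sub_cancel, point_algebraMap] at h5
  linarith

end HasLimitValue

end StrictAnalyticSpace

open PowerSeries in
/-- The value of an analytic element at the boundary point is the limit value of its values at the
rational points near the boundary. -/
theorem CoordinateDisk.HasBoundaryValue.hasLimitValue [CompleteSpace k]
    [Fact (∃ c : k, c ≠ 0 ∧ ‖c‖ < 1)] [IsAlgClosed k] {D : CoordinateDisk Y} {ζ : Y.carrier}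
    (hζ : frontier D.carrier = {ζ}) {r : ℝ} (hr1 : r < 1) {p q d : PowerSeries k}
    (hp : ConvergesOnDisk 1 p) (hq : ConvergesOnDisk 1 q)
    (hd : ∀ b : k, ‖b‖ < 1 → evalAt b d ≠ 0 → evalAt b q ≠ 0) {v : ResidueFieldAt ζ}
    (h : D.HasBoundaryValue ζ r p q v) :
    HasLimitValue (nearBoundary d) (D.rationalPoint ζ) ζ (fun b => evalAt b p / evalAt b q) v := by
  intro ε hε
  obtain ⟨U, f, w, hU, hcl, hdist, hw, hwv⟩ := h (ε / 2) (half_pos hε)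
  have hζU : ζ ∈ U := hcl (D.mem_closure_annulus ζ hζ hr1)
  refine ⟨U, f, hU, hζU, ?_, ?_⟩
  · refine eventually_nearBoundary.mpr ⟨max r 0, max_lt hr1 one_pos,
      fun b hb hb1 hdb V hV hVU => ?_⟩
    have hb0 : b ≠ 0 := norm_pos_iff.mp ((le_max_right _ _).trans_lt hb)
    have hqb := hd b hb1 hdb
    have hann : D.rationalPoint ζ b ∈ D.annulus r := by
      refine ⟨D.rationalPoint_mem ζ hb0 hb1, ?_⟩
      rw [D.absAt_T_rationalPoint ζ hb0 hb1]
      exact (le_max_left _ _).trans_lt hb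
    obtain ⟨W, hxW, hWU, hWD⟩ := exists_net_subset hU (hcl (subset_closure hann))
      (D.closedDisk b hb0 hb1) (D.rationalPoint_mem_closedDisk ζ hb0 hb1)
    have hpb := ClosedDiskAlgebra.mem_of_convergesOnDisk (norm_nonneg b) hb1 hp
    have hqb' := ClosedDiskAlgebra.mem_of_convergesOnDisk (norm_nonneg b) hb1 hq
    -- The inequality does not depend on the affinoid domain; take one inside the closed disk.
    have hind := (f + Sections.const U (-(evalAt b p / evalAt b q))).point_val_eq _ hV hxW hVU hWU
    simp only [Sections.add_val, Sections.const_val, map_neg, ← sub_eq_add_neg] at hind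
    rw [hind]
    have h1 := hdist b hb0 hb1 hpb hqb' W hWU hWD _ hxW hann
    have hpt : ∀ (g : PowerSeries k) (hg : g ∈ ClosedDiskAlgebra k ‖b‖),
        (Y.point W ⟨_, hxW⟩).1 (Y.res hWD (D.equiv b hb0 hb1 ⟨g, hg⟩)) = ‖evalAt b g‖ :=
      fun g hg => (Y.point_res hWD _ hxW _).trans (D.point_rationalPoint ζ hb0 hb1 g hg)
    have hC : ∀ c : k, C c ∈ ClosedDiskAlgebra k ‖b‖ := fun c =>
      (ClosedDiskAlgebra k ‖b‖).algebraMap_mem c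
    let Θ : ClosedDiskAlgebra k ‖b‖ →ₐ[k] Y.Alg W :=
      AlgHom.comp (B := Y.Alg (D.closedDisk b hb0 hb1)) (Y.res hWD) (D.equiv b hb0 hb1).toAlgHom
    have hzero : ∀ (g : PowerSeries k) (hg : g ∈ ClosedDiskAlgebra k ‖b‖),
        (Y.point W ⟨_, hxW⟩).1 (Y.res hWD (D.equiv b hb0 hb1 ⟨g, hg⟩) -
          algebraMap k _ (evalAt b g)) = 0 := by
      intro g hg
      have h2 := hpt (g - C (evalAt b g)) (sub_mem hg (hC _))
      have h3 : Y.res hWD (D.equiv b hb0 hb1 ⟨g - C (evalAt b g), sub_mem hg (hC _)⟩) =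
          Y.res hWD (D.equiv b hb0 hb1 ⟨g, hg⟩) - algebraMap k _ (evalAt b g) :=
        (map_sub Θ ⟨g, hg⟩ ⟨C (evalAt b g), hC _⟩).trans
          (congrArg (Θ ⟨g, hg⟩ - ·) (Θ.commutes (evalAt b g)))
      rw [h3] at h2
      have h4 : evalAt b (g - C (evalAt b g)) = 0 := by
        have h5 := map_sub (ClosedDiskAlgebra.eval b) ⟨g, hg⟩ ⟨C (evalAt b g), hC _⟩
        rw [ClosedDiskAlgebra.eval_apply, ClosedDiskAlgebra.eval_apply,
          ClosedDiskAlgebra.eval_apply, evalAt_C, sub_self] at h5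
        exact h5
      rw [h2, h4, norm_zero]
    have hp0 := hzero p hpb
    have hq0 := hzero q hqb'
    rw [hpt q hqb'] at h1
    set P := (Y.point W ⟨D.rationalPoint ζ b, hxW⟩).1 with hP
    set F := f.val W hWU
    set p' := Y.res hWD (D.equiv b hb0 hb1 ⟨p, hpb⟩)
    set q' := Y.res hWD (D.equiv b hb0 hb1 ⟨q, hqb'⟩)
    have h2 : algebraMap k _ (evalAt b q) * (F - algebraMap k _ (evalAt b p / evalAt b q)) =
        (q' * F - p') + ((p' - algebraMap k _ (evalAt b p)) -
          (q' - algebraMap k _ (evalAt b q)) * F) := by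
      rw [mul_sub, ← map_mul, mul_div_cancel₀ _ hqb]
      ring
    have h3 := map_add_le_add P (q' * F - p') ((p' - algebraMap k _ (evalAt b p)) -
          (q' - algebraMap k _ (evalAt b q)) * F)
    have h4 := map_sub_le_add P (p' - algebraMap k _ (evalAt b p))
      ((q' - algebraMap k _ (evalAt b q)) * F)
    rw [map_mul, hp0, hq0, zero_mul, add_zero] at h4
    rw [← h2, map_mul, hP, point_algebraMap, ← hP] at h3
    have hpos : 0 < ‖evalAt b q‖ := norm_pos_iff.mpr hqb
    have h5 : ‖evalAt b q‖ * P (F - algebraMap k _ (evalAt b p / evalAt b q)) ≤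
        ‖evalAt b q‖ * ε := by nlinarith
    exact le_of_mul_le_mul_left h5 hpos
  · obtain ⟨a, b, V, hζV, hVU, hV, hb, hab, hfrac⟩ := hw (ε / 2) (half_pos hε)
    refine ⟨a, b, hb, fun W hζW hWU hW => ?_, ?_⟩
    · rw [f.point_frac_eq a b hζW hζV hWU hVU hW hV]
      refine hab.trans (mul_le_mul_of_nonneg_right ?_ (apply_nonneg _ _))
      linarith
    · rw [← sub_add_sub_cancel _ w v]
      exact (norm_add_le _ _).trans ((add_le_add hfrac hwv).trans_eq (add_halves ε))

end LimitValue

/-! ### Transfer from the boundary point to the disk -/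

section Transfer

open PowerSeries StrictAnalyticSpace

variable {k : Type u} [NormedField k] [IsUltrametricDist k] [CompleteSpace k] {n : ℕ}

theorem exists_num_bound_of_taylorCoeff_bound (G : Matrix (Fin n) (Fin n) (UnitDiskMeromorphic k))
    {M : ℝ} (h : ∀ᶠ b in nearBoundary (commonDen G).1, ∀ i j, ‖(G i j).taylorCoeff 0 b‖ ≤ M) :
    ∀ᶠ b in nearBoundary (commonDen G).1, ∀ i j,
      ‖evalAt b (commonNum G i j).1‖ ≤ M * ‖evalAt b (commonDen G).1‖ := by
  obtain ⟨s, hs, h⟩ := eventually_nearBoundary.mp h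
  refine eventually_nearBoundary.mpr ⟨s, hs, fun b hb hb1 hdb i j => ?_⟩
  have h1 := h b hb hb1 hdb i j
  have hden := evalAt_den_ne_zero G hb1 hdb i j
  have h2 : evalAt b (commonNum G i j).1 = evalAt b (G i j).num * evalAt b (cofactor G i j).1 :=
    map_mul (unitDisk.eval hb1) (G i j).numerator (cofactor G i j)
  have h3 : evalAt b (commonDen G).1 = evalAt b (G i j).den * evalAt b (cofactor G i j).1 := by
    rw [commonDen_eq G i j]
    exact map_mul (unitDisk.eval hb1) (G i j).denominator (cofactor G i j)
  have h4 : evalAt b (G i j).num = (G i j).taylorCoeff 0 b * evalAt b (G i j).den := by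
    rw [UnitDiskMeromorphic.taylorCoeff, zero_add, pow_one, div_mul_cancel₀ _ hden]
    rfl
  rw [h2, h3, h4, norm_mul, norm_mul, norm_mul, mul_assoc]
  exact mul_le_mul_of_nonneg_right h1 (by positivity)

variable [IsAlgClosed k] [Fact (∃ c : k, c ≠ 0 ∧ ‖c‖ < 1)]
  {Y : StrictAnalyticSpace k} {D : CoordinateDisk Y} {ζ : Y.carrier} {r : ℝ}
  {G : Matrix (Fin n) (Fin n) (UnitDiskMeromorphic k)}

theorem CoordinateDisk.IsTaylorExpansion.hasLimitValue (hζ : frontier D.carrier = {ζ}) (hr1 : r < 1)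
    {i j : Fin n} {γ : PowerSeries (ResidueFieldAt ζ)} (h : D.IsTaylorExpansion ζ r (G i j) γ)
    (m : ℕ) : HasLimitValue (nearBoundary (commonDen G).1) (D.rationalPoint ζ) ζ
      (fun b => (G i j).taylorCoeff m b) (coeff m γ) := by
  refine CoordinateDisk.HasBoundaryValue.hasLimitValue hζ hr1 ((G i j).hasseNum_mem m)
    (pow_mem (G i j).den_converges (m + 1) : (G i j).den ^ (m + 1) ∈ unitDisk k) ?_ (h m)
  intro b hb hdb
  have h1 : evalAt b ((G i j).den ^ (m + 1)) = evalAt b (G i j).den ^ (m + 1) :=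
    map_pow (unitDisk.eval hb) (G i j).denominator (m + 1)
  rw [h1]
  exact pow_ne_zero _ (evalAt_den_ne_zero G hb hdb i j)

variable [CharZero k]

/-- If all solutions at the generic point converge on the disk of radius `ρ`, then the Taylor
coefficients of the fundamental matrices at the rational points satisfy the corresponding Cauchy
estimates, each of them near enough to the boundary. -/
theorem exists_systemNum_bound (hζ : frontier D.carrier = {ζ}) (hr1 : r < 1)
    {Γ : Matrix (Fin n) (Fin n) (PowerSeries (ResidueFieldAt ζ))}
    (hΓ : ∀ i j, D.IsTaylorExpansion ζ r (G i j) (Γ i j)) {ρ : ℝ}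
    (hconv : ∀ y : Fin n → PowerSeries (ResidueFieldAt ζ),
      (∀ i, derivative (ResidueFieldAt ζ) (y i) = ∑ j, Γ i j * y j) →
      ∀ i, ConvergesOnDisk ρ (y i)) {t : ℝ} (ht0 : 0 < t) (htρ : t < ρ) (ht1 : t ≤ 1) :
    ∃ K, 0 ≤ K ∧ ∀ m, ∀ l ≤ m, ∀ᶠ b in nearBoundary (commonDen G).1, ∀ i j,
      ‖evalAt b (systemNum unitDisk.deriv (commonDen G) (commonNum G) l i j).1‖ ≤
        K / t ^ m * ‖(l.factorial : k)‖ * ‖evalAt b (commonDen G).1‖ ^ l := by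
  have : CharZero (ResidueFieldAt ζ) :=
    charZero_of_injective_ringHom (constValue (k := k) ζ).injective
  set u := _root_.fundamentalCoeff fun l => Γ.map (coeff l) with hu
  have hbound : ∀ i j, ∃ K, 0 ≤ K ∧ ∀ m, ‖u m i j‖ * t ^ m ≤ K := by
    intro i j
    have h1 := hconv (fun i => PowerSeries.mk fun m => u m i j)
      (fun i => fundamentalCoeff_isSolution Γ i j) i t ht0.le htρ
    obtain ⟨K, hK0, hK⟩ := h1.exists_bound
    simp only [coeff_mk] at hK
    exact ⟨K, hK0, hK⟩
  choose K hK0 hK using hbound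
  have hsum0 : 0 ≤ ∑ i, ∑ j, K i j :=
    Finset.sum_nonneg fun i _ => Finset.sum_nonneg fun j _ => hK0 i j
  have hle : ∀ i j, K i j ≤ ∑ i, ∑ j, K i j := fun i j =>
    (Finset.single_le_sum (fun j _ => hK0 i j) (Finset.mem_univ j)).trans
      (Finset.single_le_sum (f := fun i => ∑ j, K i j)
        (fun i _ => Finset.sum_nonneg fun j _ => hK0 i j) (Finset.mem_univ i))
  refine ⟨∑ i, ∑ j, K i j + 1, by positivity, fun m l hl => ?_⟩
  have hev : ∀ᶠ b in nearBoundary (commonDen G).1, ∀ i j,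
      ‖_root_.fundamentalCoeff (fun l => Matrix.of fun i j => (G i j).taylorCoeff l b) l i j‖ ≤
        ‖u l i j‖ + 1 := by
    refine eventually_all.mpr fun i => eventually_all.mpr fun j => ?_
    have hpt := D.tendsto_rationalPoint ζ hζ (commonDen G).1
    refine (HasLimitValue.fundamentalCoeff (Γ := fun l => Γ.map (coeff l)) hpt ?_ l i
      j).eventually_norm_le hpt one_pos
    exact fun m i j => (hΓ i j).hasLimitValue hζ hr1 m
  obtain ⟨s, hs, hev⟩ := eventually_nearBoundary.mp hev
  refine eventually_nearBoundary.mpr ⟨s, hs, fun b hb hb1 hdb i j => ?_⟩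
  rw [evalAt_systemNum G hb1 hdb, norm_mul, norm_mul, norm_pow, mul_comm, mul_comm ‖(_ : k)‖]
  refine mul_le_mul_of_nonneg_right (mul_le_mul_of_nonneg_right ?_ (norm_nonneg _)) (by positivity)
  refine (hev b hb hb1 hdb i j).trans ?_
  rw [le_div_iff₀ (pow_pos ht0 m)]
  have h1 : (‖u l i j‖ + 1) * t ^ m ≤ (‖u l i j‖ + 1) * t ^ l :=
    mul_le_mul_of_nonneg_left (pow_le_pow_of_le_one ht0.le ht1 hl) (by positivity)
  have h2 : t ^ l ≤ 1 := pow_le_one₀ ht0.le ht1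
  have h3 := (hK i j l).trans (hle i j)
  linarith

/-- Solutions at a rational point of the disk are meromorphic on the disk of the generic radius:
the product of the solution with the gauge factor satisfies the Cauchy estimates of the generic
solutions, and the expansion of the gauge factor serves as denominator. -/
theorem CoordinateDisk.isMeromorphicOnDisk_genericRadius (hζ : frontier D.carrier = {ζ})
    (hr1 : r < 1) (hsing : HasOnlyApparentSingularities G) {x : k} (hx : ‖x‖ < 1)
    {y : Fin n → LaurentSeries k} (hy : IsSolutionAt G x y) (i : Fin n) :
    IsMeromorphicOnDisk (D.genericRadius ζ r G) (y i) := by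
  rcases le_or_gt (D.genericRadius ζ r G) 0 with hR | hR
  · -- The disk of radius zero is empty, so only the order of the pole matters.
    obtain ⟨N, hN⟩ := LaurentSeries.exists_X_pow_mul_mem_integers (y i)
    obtain ⟨h, hh⟩ := hN N le_rfl
    exact ⟨h, X ^ N, pow_ne_zero _ X_ne_zero, fun s h0 hs => absurd (hs.trans_le hR) h0.not_gt,
      fun s h0 hs => absurd (hs.trans_le hR) h0.not_gt, hh.symm⟩
  set d := commonDen G with hd
  have hd0 : d ≠ 0 := commonDen_ne_zero G
  have hne : {ρ : ℝ | 0 ≤ ρ ∧ ρ ≤ 1 ∧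
    ∃ Γ : Matrix (Fin n) (Fin n) (PowerSeries (ResidueFieldAt ζ)),
      (∀ i j, D.IsTaylorExpansion ζ r (G i j) (Γ i j)) ∧
      ∀ y : Fin n → PowerSeries (ResidueFieldAt ζ),
        (∀ i, derivative (ResidueFieldAt ζ) (y i) = ∑ j, Γ i j * y j) →
        ∀ i, ConvergesOnDisk ρ (y i)}.Nonempty := by
    rw [Set.nonempty_iff_ne_empty]
    intro h0
    rw [genericRadius, h0, Real.sSup_empty] at hR
    exact hR.false
  obtain ⟨-, -, -, Γ₀, hΓ₀, -⟩ := id hne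
  have hbd : ∀ᶠ b in nearBoundary d.1, ∀ i j,
      ‖(G i j).taylorCoeff 0 b‖ ≤ ∑ i, ∑ j, (‖coeff 0 (Γ₀ i j)‖ + 1) := by
    refine eventually_all.mpr fun i => eventually_all.mpr fun j => ?_
    filter_upwards [((hΓ₀ i j).hasLimitValue hζ hr1 0).eventually_norm_le
      (D.tendsto_rationalPoint ζ hζ _) one_pos] with b hb
    exact hb.trans ((Finset.single_le_sum (f := fun j => ‖coeff 0 (Γ₀ i j)‖ + 1)
      (fun j _ => by positivity) (Finset.mem_univ j)).trans
      (Finset.single_le_sum (f := fun i => ∑ j, (‖coeff 0 (Γ₀ i j)‖ + 1))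
        (fun i _ => Finset.sum_nonneg fun j _ => by positivity) (Finset.mem_univ i)))
  obtain ⟨q, hq0, hq1, hint, hdvd⟩ := unitDisk.exists_gauge hd0
    (fun a ha => by
      obtain ⟨Φ, hΦ⟩ := hsing a ha
      exact ⟨Φ, fun i j => (hΦ j).commonDen ha i⟩)
    (exists_num_bound_of_taylorCoeff_bound G hbd) hx y
  choose z hz using hint
  obtain ⟨K, hK0, hK⟩ := unitDisk.exists_norm_coeff_le hd0 hx (hy.commonDen hx) hq0 hq1 hdvd hz
  have hR1 : D.genericRadius ζ r G ≤ 1 := csSup_le hne fun ρ hρ => hρ.2.1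
  refine ⟨z i, recenter x q.1, ?_, fun s h0 hs => ?_, fun s h0 hs =>
    unitDisk.recenter_mem hx q s h0 (hs.trans_le hR1), (hz i).symm⟩
  · intro h0
    exact hq0 (unitDisk.expand_injective hx (h0.trans (map_zero _).symm))
  · obtain ⟨ρ, ⟨-, hρ1, Γ, hΓ, hconv⟩, hsρ⟩ := exists_lt_of_lt_csSup hne hs
    obtain ⟨t, hst, htρ⟩ := exists_between hsρ
    have ht0 : 0 < t := h0.trans_lt hst
    obtain ⟨K', hK'0, hK'⟩ := exists_systemNum_bound hζ hr1 hΓ hconv ht0 htρ (htρ.le.trans hρ1)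
    refine isRestricted_of_bound (M := K * K') h0 hst fun m => ?_
    have h1 := hK m (K' / t ^ m) (by positivity) (hK' m) i
    rwa [← mul_div_assoc, le_div_iff₀ (pow_pos ht0 m)] at h1

end Transfer

theorem theorem2p6 {p : ℕ} [Fact p.Prime] {k : Type u} [NormedField k] [NormedAlgebra ℚ_[p] k]
    [IsUltrametricDist k] [CompleteSpace k] [IsAlgClosed k]
    (Y : StrictAnalyticSpace k) (hY : Y.IsRigSmoothCurve)
    (D : CoordinateDisk Y) (ζ : Y.carrier) (hζ : frontier D.carrier = {ζ})
    (r : ℝ) (hr0 : 0 < r) (hr1 : r < 1) (hr : r ∈ Set.range fun c : k => ‖c‖)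
    (n : ℕ) (G : Matrix (Fin n) (Fin n) (UnitDiskMeromorphic k))
    (hG : ∀ i j, D.IsAnalyticElement r (G i j).num (G i j).den)
    (hsing : HasOnlyApparentSingularities G)
    (x : k) (hx : ‖x‖ < 1) (y : Fin n → LaurentSeries k) (hy : IsSolutionAt G x y) :
    ∀ i, IsMeromorphicOnDisk (D.genericRadius ζ r G) (y i) := by
  have : CharZero k := charZero_of_injective_ringHom (algebraMap ℚ_[p] k).injective
  have : Fact (∃ c : k, c ≠ 0 ∧ ‖c‖ < 1) := ⟨algebraMap ℚ_[p] k p, by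
    rw [map_ne_zero]
    exact_mod_cast (Fact.out : p.Prime).ne_zero, by
    rw [norm_algebraMap']
    exact Padic.norm_p_lt_one⟩
  exact fun i => D.isMeromorphicOnDisk_genericRadius hζ hr1 hsing hx hy i
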